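/- **Definitions.** Let $G$ be a finite non-empty undirected simple graph. If $G$ is connected, an *elimination tree* of $G$ is a rooted tree on $V(G)$ obtained recursively: choose a vertex $r$ as the root and, for every connected component of $G-r$, choose an elimination tree of that component and make its root a child of $r$. For an arbitrary $G$, an *elimination forest* of $G$ is the disjoint union of elimination trees, one for each connected component of $G$ (so for connected $G$ it is an elimination tree). For a vertex $w$, let $T(w)$ be the subtree of $T$ rooted at $w$. If $u$ is the parent of $v$ in $T$, the *rotation* of $uv$ produces the following rooted forest: $v$ takes the place of $u$ (its parent becomes the parent of $u$ in $T$, or it becomes a root if $u$ was one); $u$ becomes a child of $v$; a child $w$ of $v$ in $T$ becomes a child of $u$ if $u$ is adjacent in $G$ to some vertex of $T(w)$, and stays a child of $v$ otherwise; all other parents are unchanged. The *rotation distance* $\mathrm{dist}(T,T')$ is the minimum number of successive rotations that transform $T$ into $T'$. For an integer $c\ge 0$ and $k\ge1$ let $$f_c(k)=k^{\,k\cdot 2^{2^{\cdot^{\cdot^{\cdot^{2^{c k^2}}}}}}},$$ where the tower consists of $(3k+1)4k=O(k^2)$ twos, with $c k^2$ as the topmost exponent. The algorithm runs on a unit-cost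 word RAM (addition, truncated subtraction, multiplication, integer division, comparison, direct and indirect access to memory, each in one step). The input is $G$, two elimination forests $T,T'$ of $G$, and an integer $k\ge1$. The vertices are $0,\dots,n-1$ with $n=|V(G)|\ge 1$, the graph is stored in memory as its adjacency matrix (so that one adjacency test takes constant time), and $T$ and $T'$ are stored as arrays of parents. **Theorem 1.** *Rotation Distance on graph associahedra is fixed-parameter tractable for arbitrary graphs, parameterized by the distance $k$.* More precisely, there are constants $c$, $C$ and one word RAM program which, for every finite non-empty graph $G$, all elimination forests $T,T'$ of $G$ (elimination trees, if $G$ is connected) and every integer $k\ge 1$, decides whether $\mathrm{dist}(T,T')\le k$ in at most $C\cdot f_c(k)\cdot |V(G)|$ steps, using only words that hold numbers below $C\,(f_c(k)\,|V(G)|)^{C}$, that is, words of $O(\log (f_c(k)\,|V(G)|)+1)$ bits. -/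

import Mathlib

/-! ### Elimination trees and forests -/

namespace RotDist

section Forests

variable {V : Type*}

/-- `K` is the vertex set of a connected component of `G[S]`. -/
def IsComponent (G : SimpleGraph V) (S K : Set V) : Prop :=
  Maximal (fun A : Set V => A ⊆ S ∧ (G.induce A).Connected) K

/-- `IsElimTree G par S r`: the parent function `par`, restricted to `S \ {r}`, describes an
elimination tree of `G[S]` with root `r`. That is, a vertex `r` of `S` is chosen as the root,
an elimination tree is chosen for every connected component `K` of `G[S] - r`, and its root
`c K` becomes a child of `r`. -/
inductive IsElimTree (G : SimpleGraph V) (par : V → Option V) : Set V → V → Prop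
  | mk (S : Set V) (r : V) (hr : r ∈ S) (c : Set V → V)
      (hpar : ∀ K, IsComponent G (S \ {r}) K → par (c K) = some r)
      (hrec : ∀ K, IsComponent G (S \ {r}) K → IsElimTree G par K (c K)) :
      IsElimTree G par S r

/-- An elimination forest of `G`, given by its parent function (`none` at the roots): the
disjoint union of elimination trees of the connected components of `G`. For a connected graph
this is the same as an elimination tree of `G`. -/
structure ElimForest (G : SimpleGraph V) where
  parent : V → Option V
  isElim : ∀ K, IsComponent G Set.univ K → ∃ r, parent r = none ∧ IsElimTree G parent K r

/-- The vertex set of the subtree rooted at `w`: all descendants of `w`, including `w`. -/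
def subtree (par : V → Option V) (w : V) : Set V :=
  {x | Relation.ReflTransGen (fun a b => par a = some b) x w}

open Classical in
/-- The parent function obtained by rotating the edge `uv`, where `u` is the parent of `v`:
`v` takes the place of `u`, `u` becomes a child of `v`, and a child `w` of `v` becomes a child
of `u` if `u` is adjacent in `G` to a vertex of the subtree of `w`, and stays a child of `v`
otherwise. All other parents are unchanged. -/
noncomputable def rot (G : SimpleGraph V) (par : V → Option V) (u v : V) : V → Option V :=
  fun w =>
    if w = u then some v
    else if w = v then par u
    else if par w = some v ∧ ∃ x ∈ subtree par w, G.Adj u x then some u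
    else par w

/-- There is an `ℓ`-rotation sequence from the first parent function to the second. -/
inductive RotSeq (G : SimpleGraph V) : ℕ → (V → Option V) → (V → Option V) → Prop
  | nil (p : V → Option V) : RotSeq G 0 p p
  | cons {ℓ : ℕ} {p q : V → Option V} (u v : V) (huv : p v = some u)
      (h : RotSeq G ℓ (rot G p u v) q) : RotSeq G (ℓ + 1) p q

/-- The rotation distance: the least length of a rotation sequence from `T` to `T'`. -/
noncomputable def rotDist {G : SimpleGraph V} (T T' : ElimForest G) : ℕ∞ :=
  sInf {d : ℕ∞ | ∃ ℓ : ℕ, d = ℓ ∧ RotSeq G ℓ T.parent T'.parent}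

end Forests

/-! ### Word RAM programs with unit cost -/

/-- A memory state: registers and arrays, both indexed by natural numbers. A program mentions
only finitely many registers and finitely many arrays. Array cells are accessed directly. -/
structure State where
  reg : ℕ → ℕ
  arr : ℕ → ℕ → ℕ

/-- The arithmetical operations: addition, truncated subtraction, multiplication and division
rounded down. -/
inductive Op
  | add
  | sub
  | mul
  | div

def Op.eval : Op → ℕ → ℕ → ℕ
  | .add, a, b => a + b
  | .sub, a, b => a - b
  | .mul, a, b => a * b
  | .div, a, b => a / b

/-- Elementary instructions. -/
inductive Instr
  /-- `x := m` -/
  | const (x m : ℕ)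
  /-- `x := y o z` -/
  | op (o : Op) (x y z : ℕ)
  /-- `x := A[y]`, for an array `A` and registers `x`, `y` -/
  | load (x A y : ℕ)
  /-- `A[y] := x`, for an array `A` and registers `x`, `y` -/
  | store (A y x : ℕ)

/-- The number that an instruction writes. -/
def Instr.value (s : State) : Instr → ℕ
  | .const _ m => m
  | .op o _ y z => o.eval (s.reg y) (s.reg z)
  | .load _ A y => s.arr A (s.reg y)
  | .store _ _ x => s.reg x

/-- The state after an instruction. -/
def Instr.next (s : State) (i : Instr) : State :=
  match i with
  | .const x _ => { s with reg := Function.update s.reg x (i.value s) }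
  | .op _ x _ _ => { s with reg := Function.update s.reg x (i.value s) }
  | .load x _ _ => { s with reg := Function.update s.reg x (i.value s) }
  | .store A y _ =>
    let B := Function.update (s.arr A) (s.reg y) (i.value s)
    { s with arr := Function.update s.arr A B }

/-- Tests: comparisons of two registers. -/
inductive Test
  | lt (x y : ℕ)
  | eq (x y : ℕ)

def Test.holds (s : State) : Test → Prop
  | .lt x y => s.reg x < s.reg y
  | .eq x y => s.reg x = s.reg y

/-- Programs. -/
inductive Prog
  | instr (i : Instr)
  | seq (P Q : Prog)
  | ite (b : Test) (P Q : Prog)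
  | while (b : Test) (P : Prog)

/-- `Exec W P s t s'`: on a machine whose words hold the numbers below `W`, the program `P`,
started in the state `s`, halts in the state `s'` after exactly `t` steps. Every instruction
and every evaluation of a test costs one step. There is no run if a number that does not fit
into a word would have to be written. -/
inductive Exec (W : ℕ) : Prog → State → ℕ → State → Prop
  | instr (i : Instr) (s : State) (h : i.value s < W) : Exec W (.instr i) s 1 (i.next s)
  | seq {P Q : Prog} {s s₁ s₂ : State} {t₁ t₂ : ℕ} (hP : Exec W P s t₁ s₁)
      (hQ : Exec W Q s₁ t₂ s₂) : Exec W (.seq P Q) s (t₁ + t₂) s₂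
  | ite_true {b : Test} {P Q : Prog} {s s' : State} {t : ℕ} (hb : b.holds s)
      (hP : Exec W P s t s') : Exec W (.ite b P Q) s (t + 1) s'
  | ite_false {b : Test} {P Q : Prog} {s s' : State} {t : ℕ} (hb : ¬ b.holds s)
      (hQ : Exec W Q s t s') : Exec W (.ite b P Q) s (t + 1) s'
  | while_false {b : Test} {P : Prog} {s : State} (hb : ¬ b.holds s) :
      Exec W (.while b P) s 1 s
  | while_true {b : Test} {P : Prog} {s s₁ s₂ : State} {t₁ t₂ : ℕ} (hb : b.holds s)
      (hP : Exec W P s t₁ s₁) (hQ : Exec W (.while b P) s₁ t₂ s₂) :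
      Exec W (.while b P) s (t₁ + t₂ + 1) s₂

/-! ### The encoding of an instance -/

/-- A parent function on `Fin n` as an array: `0` at a root, and `j + 1` if the parent is `j`. -/
def parentCode {n : ℕ} (par : Fin n → Option (Fin n)) (i : ℕ) : ℕ :=
  if h : i < n then (match par ⟨i, h⟩ with
    | none => 0
    | some j => j + 1)
  else 0

open Classical in
/-- The adjacency matrix of a graph on `Fin n`, stored row by row. -/
noncomputable def matrixCode {n : ℕ} (G : SimpleGraph (Fin n)) (m : ℕ) : ℕ :=
  if ∃ i j : Fin n, m = i * n + j ∧ G.Adj i j then 1 else 0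

/-- The initial memory for the instance `(G, T, T', k)`: registers `0` and `1` hold the number
of vertices and `k`, array `0` the adjacency matrix of `G`, arrays `1` and `2` the parent
functions of `T` and `T'`. Everything else is `0`. -/
noncomputable def input {n : ℕ} (G : SimpleGraph (Fin n)) (T T' : ElimForest G) (k : ℕ) :
    State where
  reg := fun x => if x = 0 then n else if x = 1 then k else 0
  arr := fun A => if A = 0 then matrixCode G
    else if A = 1 then parentCode T.parent
    else if A = 2 then parentCode T'.parent
    else fun _ => 0

/-! ### The running time -/

/-- The tower `2 ^ (2 ^ (⋯ ^ (2 ^ x)))` with `h` twos. -/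
def tower : ℕ → ℕ → ℕ
  | 0, x => x
  | h + 1, x => 2 ^ tower h x

/-- `k ^ (k * tower)`, where the tower has `(3k+1)4k` twos and top exponent `c k²`. -/
def runtime (c k : ℕ) : ℕ :=
  k ^ (k * tower ((3 * k + 1) * (4 * k)) (c * k ^ 2))

end RotDist

open RotDist

/-! An elimination forest is handled through its ancestor order `Below`, subject to the three axioms
of `IsForest`. The order determines the forest, subtrees are connected in the graph, and a rotation
of `uv` changes the descendant sets of `u` and `v` only. Hence the descendants of a vertex that
takes no part in a sequence of rotations stay the same throughout, and rotations in two parts that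
are not joined by a forest edge can be reordered (`RotList.split`).

The core is a cancellation argument (`Twins.exists_shorter`). Let `w₀` and `w₁` be children of `n`
whose subtrees are adjacent to the same vertices on the path from `n` to the top `r` of the part
where rotations happen, and let no vertex below `w₀` be rotated. If the subtree of `w₁` is the same
at the end as at the beginning, all rotations that involve it are superfluous: they are left out,
and the subtree of `w₁` hangs, as a rigid block, wherever that of `w₀` hangs. Equal adjacency makes
the remaining rotations act correctly on this modified forest, and at the end it coincides with the
target.

This confines a shortest sequence to few vertices. The candidates are the parents of all vertices
whose parents differ, at most `6 * k` if the distance is at most `k`, and each round adds all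
parents of candidates and all their children that have at most `2 * k` siblings of the same type
(themselves included). Suppose that a shortest sequence rotates a vertex outside the set and that a
round adds no rotated vertex. Then either a whole component of rotated vertices avoids the set and
can be omitted, or some rotated child has an unrotated twin and cancellation applies; both
contradict minimality (`touched_subset_of_stable`). At most `2 * k` vertices are rotated, so `2 * k
+ 1` rounds capture them all (`CandidateSet.touched_subset`).

With `r` candidates there are at most `2 ^ r` types, so a round raises the length by at most two
exponentials, and the final length is below a tower of `2 * (2 * k + 1)` twos, far less than the
running time allows. A round is linear in the number of vertices because all subtrees adjacent to a
given vertex are found in linear time, by walking upwards from its neighbours until a flag is met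
(`runs_flags`). Finally all sequences of `k` candidates, read as the digits of a number below `r ^
k`, are simulated (`runs_search`). -/

namespace RotDist

/-! ### The ancestor order of an elimination forest. -/

section ForestTheory

variable {V : Type*}

/-- `x` is a descendant of `y` (possibly `y` itself). -/
def Below (p : V → Option V) (x y : V) : Prop :=
  Relation.ReflTransGen (fun a b => p a = some b) x y

namespace Below

variable {p : V → Option V} {x y z : V}

theorem refl (p : V → Option V) (x : V) : Below p x x := Relation.ReflTransGen.refl

theorem of_parent (h : p x = some y) : Below p x y := Relation.ReflTransGen.single h

theorem trans (h : Below p x y) (h' : Below p y z) : Below p x z :=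
  Relation.ReflTransGen.trans h h'

theorem head (h : p x = some y) (h' : Below p y z) : Below p x z :=
  Relation.ReflTransGen.head h h'

theorem tail (h : Below p x y) (h' : p y = some z) : Below p x z :=
  Relation.ReflTransGen.tail h h'

theorem exists_parent (h : Below p x z) (hne : x ≠ z) : ∃ y, p x = some y ∧ Below p y z := by
  rcases Relation.ReflTransGen.cases_head h with h | ⟨y, h1, h2⟩
  · exact absurd h hne
  · exact ⟨y, h1, h2⟩

theorem parent_below (h : Below p x z) (hne : x ≠ z) (hp : p x = some y) : Below p y z := by
  obtain ⟨y', h1, h2⟩ := h.exists_parent hne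
  rw [hp] at h1
  cases h1
  exact h2

theorem exists_child (h : Below p x z) (hne : x ≠ z) : ∃ y, p y = some z ∧ Below p x y := by
  rcases Relation.ReflTransGen.cases_tail h with h | ⟨y, h1, h2⟩
  · exact absurd h.symm hne
  · exact ⟨y, h2, h1⟩

theorem total (h : Below p x y) (h' : Below p x z) : Below p y z ∨ Below p z y := by
  refine Relation.ReflTransGen.total_of_right_unique ?_ h h'
  intro a b c hb hc
  rw [hb] at hc
  exact Option.some.inj hc

end Below

/-- The order-theoretic axioms of an elimination forest: the parent function is acyclic, the
edges of the graph join comparable vertices, and a parent is adjacent to the subtrees of its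
children. -/
structure IsForest (G : SimpleGraph V) (p : V → Option V) : Prop where
  acyclic : ∀ x y, p x = some y → ¬ Below p y x
  comparable : ∀ x y, G.Adj x y → Below p x y ∨ Below p y x
  adj_child : ∀ w u, p w = some u → ∃ x, Below p x w ∧ G.Adj u x

/-- There is a walk from the first vertex to the second all of whose later vertices lie in `S`. -/
def Conn (G : SimpleGraph V) (S : Set V) (x y : V) : Prop :=
  Relation.ReflTransGen (fun a b => G.Adj a b ∧ b ∈ S) x y

namespace Conn

variable {G : SimpleGraph V} {S S' : Set V} {x y z : V}

theorem mono (hS : S ⊆ S') (h : Conn G S x y) : Conn G S' x y :=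
  Relation.ReflTransGen.mono (fun _ _ hab => ⟨hab.1, hS hab.2⟩) _ _ h

theorem mem (h : Conn G S x y) (hx : x ∈ S) : y ∈ S := by
  induction h with
  | refl => exact hx
  | tail _ h _ => exact h.2

/-- Only the later vertices of a walk are required to lie in `S`, so reversal needs the first one
there too. -/
theorem symm (h : Conn G S x y) (hx : x ∈ S) : Conn G S y x := by
  induction h with
  | refl => exact Relation.ReflTransGen.refl
  | tail h1 h2 ih => exact Relation.ReflTransGen.head ⟨h2.1.symm, mem h1 hx⟩ ih

theorem trans (h : Conn G S x y) (h' : Conn G S y z) : Conn G S x z :=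
  Relation.ReflTransGen.trans h h'

theorem tail (h : Conn G S x y) (ha : G.Adj y z) (hz : z ∈ S) : Conn G S x z :=
  Relation.ReflTransGen.tail h ⟨ha, hz⟩

theorem single (ha : G.Adj x y) (hy : y ∈ S) : Conn G S x y :=
  Relation.ReflTransGen.single ⟨ha, hy⟩

end Conn

namespace IsForest

variable {G : SimpleGraph V} {p q : V → Option V} {u v w x y z : V}

theorem antisymm (hp : IsForest G p) (h : Below p x y) (h' : Below p y x) : x = y := by
  by_contra hne
  obtain ⟨z, hz, hzy⟩ := h.exists_parent hne
  exact hp.acyclic x z hz (hzy.trans h')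

theorem parent_ne (hp : IsForest G p) (h : p x = some y) : x ≠ y := by
  rintro rfl
  exact hp.acyclic x x h (Below.refl p x)

theorem wellFounded [Finite V] (hp : IsForest G p) :
    WellFounded (fun a b => p a = some b) := by
  have : IsTrans V (Relation.TransGen (fun a b => p a = some b)) := inferInstance
  have : Std.Irrefl (Relation.TransGen (fun a b => p a = some b)) := by
    constructor
    intro a h
    obtain ⟨b, h1, h2⟩ := Relation.TransGen.head'_iff.1 h
    exact hp.acyclic a b h1 h2
  exact (Finite.wellFounded_of_trans_of_irrefl
    (Relation.TransGen (fun a b => p a = some b))).mono (fun a b h => Relation.TransGen.single h)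

/-- The parent of a vertex is its least proper ancestor, so it can be read off the order. Forests
obtained by different rotations are compared in this way. -/
theorem ext (hp : IsForest G p) (hq : IsForest G q) (h : ∀ x y, Below p x y ↔ Below q x y) :
    p = q := by
  have key : ∀ {p q : V → Option V}, IsForest G p → IsForest G q →
      (∀ x y, Below p x y ↔ Below q x y) → ∀ x y, p x = some y → q x = some y := by
    intro p q hp hq h x y hxy
    have hne := hp.parent_ne hxy
    obtain ⟨z, hz, hzy⟩ := ((h x y).1 (Below.of_parent hxy)).exists_parent hne
    have hyz := ((h x z).2 (Below.of_parent hz)).parent_below (hq.parent_ne hz) hxy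
    rw [hz, hq.antisymm hzy ((h y z).1 hyz)]
  funext x
  apply Option.ext
  intro y
  exact ⟨key hp hq h x y, key hq hp (fun x y => (h x y).symm) x y⟩

/-- Induction from the leaves upwards: `adj_child` provides an edge from `w` into the subtree of
each of its children. -/
theorem conn_subtree [Finite V] (hp : IsForest G p) (h : Below p x w) :
    Conn G (subtree p w) w x := by
  induction w using hp.wellFounded.induction generalizing x with
  | _ w ih =>
    by_cases hne : x = w
    · rw [hne]; exact Relation.ReflTransGen.refl
    · obtain ⟨y, hy, hxy⟩ := h.exists_child hne
      obtain ⟨z, hz, ha⟩ := hp.adj_child y w hy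
      have hzx : Conn G (subtree p y) z x :=
        ((ih y hy hz).symm (Below.refl p y)).trans (ih y hy hxy)
      exact (Conn.single ha (show Below p z w from hz.tail hy)).trans
        (hzx.mono (fun a ha => show Below p a w from Below.tail ha hy))

theorem conn_of_below [Finite V] (hp : IsForest G p) (hx : Below p x w) (hy : Below p y w) :
    Conn G (subtree p w) x y :=
  ((hp.conn_subtree hx).symm (Below.refl p w)).trans (hp.conn_subtree hy)

/-- Edges join comparable vertices, so an edge leaves the subtree of `u` only towards a proper
ancestor of `u`; the only such ancestor below `v` is `v` itself. -/
theorem closed (hq : IsForest G q) (huv : q u = some v) (hx : Below q x u) (hy : Below q y v)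
    (hne : y ≠ v) (ha : G.Adj x y) : Below q y u := by
  rcases hq.comparable x y ha with h | h
  · rcases hx.total h with h' | h'
    · by_cases huy : u = y
      · rw [huy]; exact Below.refl q y
      · exact absurd (hq.antisymm hy (h'.parent_below huy huv)) hne
    · exact h'
  · exact h.trans hx

/-- The subtree of a child `u` of `v` is a connected component of the subtree of `v`
without `v`. -/
theorem below_iff_conn [Finite V] (hq : IsForest G q) (huv : q u = some v) :
    Below q x u ↔ Conn G {z | Below q z v ∧ z ≠ v} u x := by
  constructor
  · intro h
    refine (hq.conn_subtree h).mono ?_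
    rintro z hz
    refine ⟨Below.tail hz huv, ?_⟩
    rintro rfl
    exact hq.acyclic _ _ huv hz
  · intro h
    induction h with
    | refl => exact Below.refl q u
    | tail _ h2 ih => exact hq.closed huv ih h2.2.1 h2.2.2 h2.1

end IsForest

/-! ### The effect of a rotation on the order. -/

section Rotation

variable {G : SimpleGraph V} {p : V → Option V} {u v w x y z : V}

theorem rot_left (G : SimpleGraph V) (p : V → Option V) (u v : V) : rot G p u v u = some v := by
  simp [rot]

theorem rot_right (hne : v ≠ u) : rot G p u v v = p u := by
  simp [rot, hne]

theorem rot_moved (hu : w ≠ u) (hv : w ≠ v) (hw : p w = some v) (hx : Below p x w)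
    (ha : G.Adj u x) : rot G p u v w = some u := by
  have : ∃ x ∈ subtree p w, G.Adj u x := ⟨x, hx, ha⟩
  simp [rot, hu, hv, hw, this]

theorem rot_cases (hu : w ≠ u) (hv : w ≠ v) :
    (p w = some v ∧ (∃ x, Below p x w ∧ G.Adj u x) ∧ rot G p u v w = some u) ∨
      rot G p u v w = p w := by
  by_cases h : p w = some v ∧ ∃ x ∈ subtree p w, G.Adj u x
  · exact Or.inl ⟨h.1, h.2, by simp only [rot, if_neg hu, if_neg hv, if_pos h]⟩
  · exact Or.inr (by simp only [rot, if_neg hu, if_neg hv, if_neg h])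

theorem rot_of_parent_ne (hu : w ≠ u) (hv : w ≠ v) (h : p w ≠ some v) :
    rot G p u v w = p w := by
  rcases rot_cases (G := G) (p := p) hu hv with h' | h'
  · exact absurd h'.1 h
  · exact h'

/-- A rotation can enlarge only the descendant set of `v`; by `below_rot_of_below` it can shrink
only that of `u`. With `below_rot_right` for `v` and `below_rot_left_iff_conn` for `u` this
describes the new order completely. -/
theorem below_of_below_rot (huv : p v = some u) (hy : y ≠ v)
    (h : Below (rot G p u v) x y) : Below p x y := by
  induction h using Relation.ReflTransGen.head_induction_on with
  | refl => exact Below.refl p y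
  | @head a b hab _ ih =>
    by_cases ha : a = u
    · subst ha
      rw [rot_left] at hab
      cases hab
      exact ih.parent_below hy.symm huv
    by_cases ha' : a = v
    · subst ha'
      rw [rot_right ha] at hab
      exact (Below.of_parent huv).trans (Below.head hab ih)
    rcases rot_cases (G := G) (p := p) ha ha' with ⟨h1, _, h3⟩ | h'
    · rw [h3] at hab
      cases hab
      exact Below.head h1 (Below.head huv ih)
    · rw [h'] at hab
      exact Below.head hab ih

theorem below_rot_of_below (hne : v ≠ u) (huv : p v = some u) (hy : y ≠ u) (h : Below p x y) :
    Below (rot G p u v) x y := by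
  induction h using Relation.ReflTransGen.head_induction_on with
  | refl => exact Below.refl _ y
  | @head a b hab _ ih =>
    by_cases ha : a = u
    · subst ha
      refine Below.head (rot_left G p a v) (Below.head (y := b) ?_ ih)
      rw [rot_right hne, hab]
    by_cases ha' : a = v
    · subst ha'
      rw [huv] at hab
      cases hab
      exact ih.parent_below hy.symm (rot_left G p _ _)
    rcases rot_cases (G := G) (p := p) ha ha' with ⟨h1, _, h3⟩ | h'
    · rw [hab] at h1
      cases h1
      exact Below.head h3 (Below.head (rot_left G p u _) ih)
    · exact Below.head (h'.trans hab) ih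

theorem below_rot_right (hne : v ≠ u) (huv : p v = some u) :
    Below (rot G p u v) x v ↔ Below p x u := by
  constructor
  · intro h
    induction h using Relation.ReflTransGen.head_induction_on with
    | refl => exact Below.of_parent huv
    | @head a b hab _ ih =>
      by_cases ha : a = u
      · rw [ha]; exact Below.refl p u
      by_cases ha' : a = v
      · subst ha'
        exact Below.of_parent huv
      rcases rot_cases (G := G) (p := p) ha ha' with ⟨h1, _, h3⟩ | h'
      · exact Below.head h1 (Below.of_parent huv)
      · rw [h'] at hab
        exact Below.head hab ih
  · intro h
    induction h using Relation.ReflTransGen.head_induction_on with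
    | refl => exact Below.of_parent (rot_left G p u v)
    | @head a b hab _ ih =>
      by_cases ha : a = u
      · subst ha
        exact Below.of_parent (rot_left G p _ v)
      by_cases ha' : a = v
      · rw [ha']; exact Below.refl _ v
      rcases rot_cases (G := G) (p := p) ha ha' with ⟨h1, _, h3⟩ | h'
      · exact Below.head h3 (Below.of_parent (rot_left G p u v))
      · exact Below.head (h'.trans hab) ih

theorem below_rot_iff (hne : v ≠ u) (huv : p v = some u) (hu : y ≠ u) (hv : y ≠ v) :
    Below (rot G p u v) x y ↔ Below p x y :=
  ⟨below_of_below_rot huv hv, below_rot_of_below hne huv hu⟩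

theorem below_rot_left_moved (hp : IsForest G p) (huv : p v = some u) (hw : p w = some v)
    (hx : Below p x w) (ha : G.Adj u x) (hy : Below p y w) : Below (rot G p u v) y u := by
  have hwu : w ≠ u := by
    rintro rfl
    exact hp.acyclic _ _ hw (Below.of_parent huv)
  exact (below_rot_of_below (hp.parent_ne huv) huv hwu hy).tail
    (rot_moved hwu (hp.parent_ne hw) hw hx ha)

theorem IsForest.rot (hp : IsForest G p) (huv : p v = some u) : IsForest G (rot G p u v) := by
  have hne := hp.parent_ne huv
  refine ⟨?_, ?_, ?_⟩
  · intro a b hab hba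
    by_cases ha : a = u
    · subst ha
      rw [rot_left] at hab
      cases hab
      obtain ⟨c, hc, hca⟩ := hba.exists_parent hne
      rw [rot_right hne] at hc
      exact hp.acyclic _ _ hc (below_of_below_rot huv hne.symm hca)
    by_cases ha' : a = v
    · subst ha'
      rw [rot_right ha] at hab
      exact hp.acyclic _ _ hab ((below_rot_right hne huv).1 hba)
    have hba' := below_of_below_rot huv ha' hba
    rcases rot_cases (G := G) (p := p) ha ha' with ⟨h1, _, h3⟩ | h'
    · rw [h3] at hab
      cases hab
      exact hp.acyclic _ _ h1 (Below.head huv hba')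
    · rw [h'] at hab
      exact hp.acyclic _ _ hab hba'
  · have key : ∀ x y, G.Adj x y → Below p x y →
        Below (RotDist.rot G p u v) x y ∨ Below (RotDist.rot G p u v) y x := by
      intro x y ha hxy
      by_cases hy : y = u
      · subst hy
        by_cases hxv : x = v
        · subst hxv
          exact Or.inr (Below.of_parent (rot_left G p _ _))
        obtain ⟨w, hw, hxw⟩ := hxy.exists_child ha.ne
        left
        -- If `x` is a proper descendant of `v`, the subtree of a child of `v` that contains it is
        -- adjacent to `u` through `x`, so it moves to `u`. Otherwise `x` lies below another child
        -- of `u`, which keeps its parent.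
        by_cases hwv : w = v
        · subst hwv
          obtain ⟨c, hc, hxc⟩ := hxw.exists_child hxv
          exact below_rot_left_moved hp huv hc hxc ha.symm hxc
        · have hwu := hp.parent_ne hw
          refine (below_rot_of_below hne huv hwu hxw).tail ?_
          rw [rot_of_parent_ne hwu hwv, hw]
          rw [hw]
          intro h
          exact hne (Option.some.inj h).symm
      · exact Or.inl (below_rot_of_below hne huv hy hxy)
    intro x y ha
    rcases hp.comparable x y ha with h | h
    · exact key x y ha h
    · exact (key y x ha.symm h).symm
  · intro w b hw
    by_cases hwu : w = u
    · subst hwu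
      rw [rot_left] at hw
      cases hw
      -- Here `w` is the old parent. Either it is adjacent to `v` itself, or it is adjacent to the
      -- subtree of a child `c` of `v`; that subtree moves to `w` and contains a neighbour of `v`.
      obtain ⟨x, hx, ha⟩ := hp.adj_child v w huv
      by_cases hxv : x = v
      · subst hxv
        exact ⟨w, Below.refl _ w, ha.symm⟩
      obtain ⟨c, hc, hxc⟩ := hx.exists_child hxv
      obtain ⟨z, hz, hvz⟩ := hp.adj_child c v hc
      exact ⟨z, below_rot_left_moved hp huv hc hxc ha hz, hvz⟩
    by_cases hwv : w = v
    · subst hwv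
      rw [rot_right hne] at hw
      obtain ⟨x, hx, ha⟩ := hp.adj_child _ _ hw
      exact ⟨x, (below_rot_right hne huv).2 hx, ha⟩
    rcases rot_cases (G := G) (p := p) hwu hwv with ⟨h1, ⟨x, hx, ha⟩, h3⟩ | h'
    · rw [h3] at hw
      cases hw
      exact ⟨x, below_rot_of_below hne huv hwu hx, ha⟩
    · rw [h'] at hw
      obtain ⟨x, hx, ha⟩ := hp.adj_child _ _ hw
      exact ⟨x, below_rot_of_below hne huv hwu hx, ha⟩

/-- The new subtree of `u` after rotating `uv`. -/
theorem below_rot_left_iff_conn [Finite V] (hp : IsForest G p) (huv : p v = some u) :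
    Below (rot G p u v) x u ↔ Conn G {z | Below p z u ∧ z ≠ v} u x := by
  rw [(hp.rot huv).below_iff_conn (rot_left G p u v)]
  simp only [below_rot_right (hp.parent_ne huv) huv]

theorem below_of_below_rot_left (hp : IsForest G p) (huv : p v = some u)
    (h : Below (rot G p u v) x u) : Below p x u :=
  below_of_below_rot huv (hp.parent_ne huv).symm h

/-- Disjoint rotations commute. -/
theorem rot_comm [Finite V] {a b : V} (hp : IsForest G p) (huv : p v = some u) (hab : p b = some a)
    (hua : u ≠ a) (hub : u ≠ b) (hva : v ≠ a) (hvb : v ≠ b)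
    (huv' : rot G p a b v = some u) (hab' : rot G p u v b = some a) :
    rot G (rot G p u v) a b = rot G (rot G p a b) u v := by
  -- The two results are compared on the descendant sets of all vertices except `a` and `b`. The
  -- situation is symmetric, so exchanging the two rotated pairs covers `a` and `b`.
  have key : ∀ {a b u v : V}, p v = some u → p b = some a → u ≠ a → u ≠ b → v ≠ a → v ≠ b →
      rot G p a b v = some u → rot G p u v b = some a → ∀ x y,
      y ≠ a → y ≠ b → (Below (rot G (rot G p u v) a b) x y ↔
        Below (rot G (rot G p a b) u v) x y) := by
    intro a b u v huv hab hua hub hva hvb huv' hab' x y hya hyb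
    have h1 := hp.rot huv
    have h2 := hp.rot hab
    rw [below_rot_iff (h1.parent_ne hab') hab' hya hyb]
    by_cases hyu : y = u
    · subst hyu
      rw [below_rot_left_iff_conn h2 huv', below_rot_left_iff_conn hp huv]
      simp only [below_rot_iff (hp.parent_ne hab) hab hya hyb]
    by_cases hyv : y = v
    · subst hyv
      rw [below_rot_right (hp.parent_ne huv) huv, below_rot_right (h2.parent_ne huv') huv',
        below_rot_iff (hp.parent_ne hab) hab hua hub]
    rw [below_rot_iff (hp.parent_ne huv) huv hyu hyv,
      below_rot_iff (h2.parent_ne huv') huv' hyu hyv,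
      below_rot_iff (hp.parent_ne hab) hab hya hyb]
  refine ((hp.rot huv).rot hab').ext ((hp.rot hab).rot huv') ?_
  intro x y
  by_cases h : y ≠ a ∧ y ≠ b
  · exact key huv hab hua hub hva hvb huv' hab' x y h.1 h.2
  · have hy : y ≠ u ∧ y ≠ v := by
      constructor
      · rintro rfl; exact h ⟨hua, hub⟩
      · rintro rfl; exact h ⟨hva, hvb⟩
    exact (key hab huv hua.symm hva.symm hub.symm hvb.symm hab' huv' x y hy.1 hy.2).symm

end Rotation

end ForestTheory

end RotDist

namespace RotDist

/-! ### Sequences of rotations and their reordering. -/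

section Sequences

variable {V : Type*} {G : SimpleGraph V}

/-- The second parent function arises from the first by performing the rotations of a list. -/
inductive RotList (G : SimpleGraph V) : (V → Option V) → List (V × V) → (V → Option V) → Prop
  | nil (p : V → Option V) : RotList G p [] p
  | cons {p q : V → Option V} {L : List (V × V)} (u v : V) (huv : p v = some u)
      (h : RotList G (rot G p u v) L q) : RotList G p ((u, v) :: L) q

/-- The vertices involved in the rotations of a list. -/
def touched (L : List (V × V)) : Set V := {x | ∃ e ∈ L, x = e.1 ∨ x = e.2}

theorem touched_nil : touched ([] : List (V × V)) = ∅ := by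
  ext; simp [touched]

theorem touched_cons (u v : V) (L : List (V × V)) :
    touched ((u, v) :: L) = {u, v} ∪ touched L := by
  ext; simp [touched]

theorem rotSeq_iff_exists_rotList {ℓ : ℕ} {p q : V → Option V} :
    RotSeq G ℓ p q ↔ ∃ L, RotList G p L q ∧ L.length = ℓ := by
  constructor
  · intro h
    induction h with
    | nil p => exact ⟨[], RotList.nil p, rfl⟩
    | cons u v huv _ ih =>
      obtain ⟨L, hL, hl⟩ := ih
      exact ⟨(u, v) :: L, RotList.cons u v huv hL, by simp [hl]⟩
  · rintro ⟨L, hL, rfl⟩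
    induction hL with
    | nil p => exact RotSeq.nil p
    | cons u v huv _ ih => exact RotSeq.cons u v huv ih

namespace RotList

variable {p q r : V → Option V} {L L' : List (V × V)} {u v x y : V}

theorem append (h : RotList G p L q) (h' : RotList G q L' r) : RotList G p (L ++ L') r := by
  induction h with
  | nil p => exact h'
  | cons u v huv _ ih => exact RotList.cons u v huv (ih h')

theorem isForest (h : RotList G p L q) (hp : IsForest G p) : IsForest G q := by
  induction h with
  | nil p => exact hp
  | cons u v huv _ ih => exact ih (hp.rot huv)

theorem below_iff (h : RotList G p L q) (hp : IsForest G p) (hy : y ∉ touched L) :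
    Below q x y ↔ Below p x y := by
  induction h with
  | nil p => rfl
  | cons u v huv _ ih =>
    rw [touched_cons] at hy
    simp only [Set.mem_union, Set.mem_insert_iff, Set.mem_singleton_iff, not_or] at hy
    rw [ih (hp.rot huv) hy.2, below_rot_iff (hp.parent_ne huv) huv hy.1.1 hy.1.2]

/-- A vertex that is not rotated changes its parent only by passing from the lower to the upper
vertex of a rotated pair. So the first parent that it leaves and the last one that it gets are both
rotated. -/
theorem parents_touched (h : RotList G p L q) (hx : x ∉ touched L) (hne : p x ≠ q x) :
    (∃ a ∈ touched L, p x = some a) ∧ ∃ b ∈ touched L, q x = some b := by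
  induction h with
  | nil p => exact absurd rfl hne
  | @cons p q L u v huv _ ih =>
    rw [touched_cons] at hx ⊢
    simp only [Set.mem_union, Set.mem_insert_iff, Set.mem_singleton_iff, not_or] at hx
    by_cases hq : rot G p u v x = q x
    · rcases rot_cases (G := G) (p := p) hx.1.1 hx.1.2 with ⟨h1, _, h3⟩ | h'
      · exact ⟨⟨v, by simp, h1⟩, ⟨u, by simp, by rw [← hq, h3]⟩⟩
      · exact absurd (h'.symm.trans hq) hne
    · obtain ⟨⟨a, ha, ha'⟩, b, hb, hb'⟩ := ih hx.2 hq
      refine ⟨?_, ⟨b, Or.inr hb, hb'⟩⟩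
      rcases rot_cases (G := G) (p := p) hx.1.1 hx.1.2 with ⟨h1, _, h3⟩ | h'
      · exact ⟨v, by simp, h1⟩
      · exact ⟨a, Or.inr ha, by rw [← h', ha']⟩

/-- A rotation can be postponed after rotations of other vertices. -/
theorem postpone [Finite V] (hp : IsForest G p) (huv : p v = some u)
    (h : RotList G (rot G p u v) L r) (hu : u ∉ touched L) (hv : v ∉ touched L) :
    ∃ r', RotList G p L r' ∧ r' v = some u ∧ rot G r' u v = r := by
  induction L generalizing p with
  | nil =>
    cases h
    exact ⟨p, RotList.nil p, huv, rfl⟩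
  | cons e L ih =>
    obtain ⟨a, b⟩ := e
    rw [touched_cons] at hu hv
    simp only [Set.mem_union, Set.mem_insert_iff, Set.mem_singleton_iff, not_or] at hu hv
    cases h with
    | cons _ _ hab h =>
    have hab' : p b = some a := by
      rcases rot_cases (G := G) (p := p) (Ne.symm hu.1.2) (Ne.symm hv.1.2) with ⟨_, _, h3⟩ | h'
      · rw [h3] at hab
        exact absurd (Option.some.inj hab) hu.1.1
      · rw [← h', hab]
    have huv' : rot G p a b v = some u := by
      rw [rot_of_parent_ne hv.1.1 hv.1.2, huv]
      rw [huv]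
      exact fun h => hu.1.2 (Option.some.inj h)
    rw [rot_comm hp huv hab' hu.1.1 hu.1.2 hv.1.1 hv.1.2 huv' hab] at h
    obtain ⟨r', h1, h2, h3⟩ := ih (hp.rot hab') huv' h hu.2 hv.2
    exact ⟨r', RotList.cons a b hab' h1, h2, h3⟩

/-- No vertex of `X` is the parent or a child of a vertex of `Y`. -/
def NoEdge (p : V → Option V) (X Y : Set V) : Prop :=
  ∀ x ∈ X, ∀ y ∈ Y, p x ≠ some y ∧ p y ≠ some x

theorem NoEdge.symm {X Y : Set V} (h : NoEdge p X Y) : NoEdge p Y X :=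
  fun y hy x hx => (h x hx y hy).symm

/-- A vertex of `Y` is not a child of `v` and so keeps its parent. A vertex of `X` gets a parent in
`{u, v}` or one that some vertex of `X` had before. -/
theorem NoEdge.rot {X Y : Set V} (h : NoEdge p X Y) (hd : Disjoint X Y) (hne : v ≠ u)
    (hu : u ∈ X) (hv : v ∈ X) : NoEdge (rot G p u v) X Y := by
  intro x hx y hy
  have hyX : y ∉ X := fun h' => Set.disjoint_left.1 hd h' hy
  have hyu : y ≠ u := by rintro rfl; exact hyX hu
  have hyv : y ≠ v := by rintro rfl; exact hyX hv
  constructor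
  · by_cases hxu : x = u
    · rw [hxu, rot_left]
      exact fun h' => hyv (Option.some.inj h').symm
    by_cases hxv : x = v
    · rw [hxv, rot_right hne]
      exact (h u hu y hy).1
    rcases rot_cases (G := G) (p := p) hxu hxv with ⟨_, _, h3⟩ | h'
    · rw [h3]
      exact fun h' => hyu (Option.some.inj h').symm
    · rw [h']
      exact (h x hx y hy).1
  · rw [rot_of_parent_ne hyu hyv (h v hv y hy).2]
    exact (h x hx y hy).2

/-- Rotations in two parts of the forest that are not joined by a forest edge do not
interact. -/
theorem split [Finite V] {X Y : Set V} (h : RotList G p L q) (hp : IsForest G p)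
    (hd : Disjoint X Y) (hXY : NoEdge p X Y) (hL : touched L ⊆ X ∪ Y) :
    ∃ L₁ L₂ r, RotList G p L₁ r ∧ RotList G r L₂ q ∧ L₁.length + L₂.length = L.length ∧
      touched L₁ = touched L ∩ X ∧ touched L₂ = touched L ∩ Y := by
  induction h with
  | nil p => exact ⟨[], [], p, RotList.nil p, RotList.nil p, by simp [touched_nil]⟩
  | @cons p q L u v huv _ ih =>
    rw [touched_cons] at hL ⊢
    have hne := hp.parent_ne huv
    have hu : u ∈ X ∪ Y := hL (by simp)
    have hv : v ∈ X ∪ Y := hL (by simp)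
    have hL' : touched L ⊆ X ∪ Y := fun x hx => hL (Or.inr hx)
    have hX : ∀ x ∈ X, x ∉ Y := fun x h1 h2 => Set.disjoint_left.1 hd h1 h2
    rcases hu with hu | hu <;> rcases hv with hv | hv
    · obtain ⟨L₁, L₂, r, h1, h2, h3, h4, h5⟩ := ih (hp.rot huv) (hXY.rot hd hne hu hv) hL'
      refine ⟨(u, v) :: L₁, L₂, r, RotList.cons u v huv h1, h2, by simp [← h3]; omega, ?_, ?_⟩
      · rw [touched_cons, h4]
        ext x
        simp only [Set.mem_union, Set.mem_insert_iff, Set.mem_singleton_iff, Set.mem_inter_iff]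
        constructor
        · rintro ((rfl | rfl) | h)
          · exact ⟨Or.inl (Or.inl rfl), hu⟩
          · exact ⟨Or.inl (Or.inr rfl), hv⟩
          · exact ⟨Or.inr h.1, h.2⟩
        · rintro ⟨h | h, h'⟩
          · exact Or.inl h
          · exact Or.inr ⟨h, h'⟩
      · rw [h5]
        ext x
        simp only [Set.mem_union, Set.mem_insert_iff, Set.mem_singleton_iff, Set.mem_inter_iff]
        constructor
        · rintro ⟨h, h'⟩
          exact ⟨Or.inr h, h'⟩
        · rintro ⟨(rfl | rfl) | h, h'⟩
          · exact absurd h' (hX _ hu)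
          · exact absurd h' (hX _ hv)
          · exact ⟨h, h'⟩
    · exact absurd huv (hXY u hu v hv).2
    · exact absurd huv (hXY v hv u hu).1
    · have hu' : u ∉ X := fun h => hX u h hu
      have hv' : v ∉ X := fun h => hX v h hv
      obtain ⟨L₁, L₂, r, h1, h2, h3, h4, h5⟩ :=
        ih (hp.rot huv) (hXY.symm.rot hd.symm hne hu hv).symm hL'
      -- A leading rotation inside `Y` is carried past all the rotations inside `X`.
      obtain ⟨r', g1, g2, g3⟩ := postpone hp huv h1 (by rw [h4]; exact fun h => hu' h.2)
        (by rw [h4]; exact fun h => hv' h.2)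
      refine ⟨L₁, (u, v) :: L₂, r', g1, RotList.cons u v g2 (by rw [g3]; exact h2),
        by simp [← h3]; omega, ?_, ?_⟩
      · rw [h4]
        ext x
        simp only [Set.mem_union, Set.mem_insert_iff, Set.mem_singleton_iff, Set.mem_inter_iff]
        constructor
        · rintro ⟨h, h'⟩
          exact ⟨Or.inr h, h'⟩
        · rintro ⟨(rfl | rfl) | h, h'⟩
          · exact absurd h' hu'
          · exact absurd h' hv'
          · exact ⟨h, h'⟩
      · rw [touched_cons, h5]
        ext x
        simp only [Set.mem_union, Set.mem_insert_iff, Set.mem_singleton_iff, Set.mem_inter_iff]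
        constructor
        · rintro ((rfl | rfl) | h)
          · exact ⟨Or.inl (Or.inl rfl), hu⟩
          · exact ⟨Or.inl (Or.inr rfl), hv⟩
          · exact ⟨Or.inr h.1, h.2⟩
        · rintro ⟨h | h, h'⟩
          · exact Or.inl h
          · exact Or.inr ⟨h, h'⟩

end RotList

end Sequences

/-! ### Cancelling the rotations of a subtree against an unrotated twin. -/

section Twins

variable {V : Type*}

/-- `w₁` and `w₀` are children of `n`, no vertex below `w₀` is in `X`, all of `X` is below `r`,
and the vertices between `n` and `r` that are adjacent to the subtree of `w₁` are those adjacent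
to the subtree of `w₀`. -/
structure Twins (G : SimpleGraph V) (p : V → Option V) (X : Set V) (n r w₀ w₁ : V) : Prop where
  forest : IsForest G p
  parent_zero : p w₀ = some n
  parent_one : p w₁ = some n
  ne : w₀ ≠ w₁
  below_top : ∀ x ∈ X, Below p x r
  untouched : ∀ x, Below p x w₀ → x ∉ X
  pattern : ∀ a, Below p n a → Below p a r →
    ((∃ x, Below p x w₁ ∧ G.Adj a x) ↔ ∃ x, Below p x w₀ ∧ G.Adj a x)

/-- `f` is a forest obtained from `p` by rotations of vertices of `X`. -/
structure Reached (G : SimpleGraph V) (p : V → Option V) (X : Set V) (r : V)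
    (f : V → Option V) : Prop where
  forest : IsForest G f
  below_iff : ∀ x y, y ∉ X → (Below f x y ↔ Below p x y)
  below_top : ∀ x y, y ∈ X → Below f x y → Below p x r

/-- The order in which the subtree of `w₁` in `p` hangs in the forest `f` as the subtree of
`w₀` does. -/
def TwinBelow (p f : V → Option V) (w₀ w₁ x y : V) : Prop :=
  (Below p y w₁ ∧ Below p x y) ∨ (¬ Below p y w₁ ∧
    ((¬ Below p x w₁ ∧ Below f x y) ∨ (Below p x w₁ ∧ Below f w₀ y ∧ w₀ ≠ y)))

variable {G : SimpleGraph V} {p f h q : V → Option V} {X : Set V} {n r w₀ w₁ u v x y b d z : V}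

theorem Reached.rot (hf : Reached G p X r f) (hu : u ∈ X) (hv : v ∈ X) (huv : f v = some u) :
    Reached G p X r (rot G f u v) := by
  have hne := hf.forest.parent_ne huv
  refine ⟨hf.forest.rot huv, ?_, ?_⟩
  · intro x y hy
    have hyu : y ≠ u := by rintro rfl; exact hy hu
    have hyv : y ≠ v := by rintro rfl; exact hy hv
    rw [below_rot_iff hne huv hyu hyv, hf.below_iff x y hy]
  · intro x y hy hxy
    by_cases hyv : y = v
    · subst hyv
      exact hf.below_top x u hu ((below_rot_right hne huv).1 hxy)
    · exact hf.below_top x y hy (below_of_below_rot huv hyv hxy)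

namespace Twins

theorem not_below_zero (ht : Twins G p X n r w₀ w₁) (h : Below p n x) : ¬ Below p x w₀ :=
  fun h' => ht.forest.acyclic _ _ ht.parent_zero (h.trans h')

theorem not_below_one (ht : Twins G p X n r w₀ w₁) (h : Below p n x) : ¬ Below p x w₁ :=
  fun h' => ht.forest.acyclic _ _ ht.parent_one (h.trans h')

theorem zero_not_below_one (ht : Twins G p X n r w₀ w₁) (h : Below p x w₀) :
    ¬ Below p x w₁ := by
  intro h'
  rcases h.total h' with h1 | h1
  · exact ht.not_below_one (Below.refl p n) (h1.parent_below ht.ne ht.parent_zero)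
  · exact ht.not_below_zero (Below.refl p n) (h1.parent_below ht.ne.symm ht.parent_one)

/-- A neighbour of the subtree of `w₁` outside of it is a proper ancestor of `w₁`, because edges
join comparable vertices; these ancestors are `n` and the vertices above `n`. -/
theorem above_of_adj_one (ht : Twins G p X n r w₀ w₁) (hb : ¬ Below p b w₁) (hd : Below p d w₁)
    (ha : G.Adj b d) : Below p n b := by
  rcases ht.forest.comparable b d ha with h | h
  · exact absurd (h.trans hd) hb
  · rcases h.total hd with h' | h'
    · exact absurd h' hb
    · exact h'.parent_below (fun h => hb (h ▸ Below.refl p _)) ht.parent_one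

theorem above_of_adj_zero (ht : Twins G p X n r w₀ w₁) (hb : ¬ Below p b w₀) (hd : Below p d w₀)
    (ha : G.Adj b d) : Below p n b := by
  rcases ht.forest.comparable b d ha with h | h
  · exact absurd (h.trans hd) hb
  · rcases h.total hd with h' | h'
    · exact absurd h' hb
    · exact h'.parent_below (fun h => hb (h ▸ Below.refl p _)) ht.parent_zero

theorem below_zero_iff (ht : Twins G p X n r w₀ w₁) (hf : Reached G p X r f) (x : V) :
    Below f x w₀ ↔ Below p x w₀ :=
  hf.below_iff x w₀ (ht.untouched w₀ (Below.refl p w₀))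

theorem zero_below_of_adj_zero (ht : Twins G p X n r w₀ w₁) (hf : Reached G p X r f)
    (hb : Below p n b) (hz : Below p z w₀) (ha : G.Adj b z) : Below f w₀ b := by
  have hz' := (ht.below_zero_iff hf z).2 hz
  have hb' : ¬ Below f b w₀ := fun h => ht.not_below_zero hb ((ht.below_zero_iff hf b).1 h)
  rcases hf.forest.comparable b z ha with h | h
  · exact absurd (h.trans hz') hb'
  · exact (h.total hz').resolve_left hb'

theorem ne_zero_of_above (ht : Twins G p X n r w₀ w₁) (hb : Below p n b) : w₀ ≠ b := by
  rintro rfl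
  exact ht.not_below_zero hb (Below.refl p _)

/-- Below `r`, an outer neighbour of the subtree of `w₁` is by `pattern` also adjacent to the
subtree of `w₀`, which is intact in `f`, so it must be comparable with it. A vertex not below `r` is
not in `X` and has kept its descendants. -/
theorem zero_below_of_adj_one (ht : Twins G p X n r w₀ w₁) (hf : Reached G p X r f)
    (hb : ¬ Below p b w₁) (hd : Below p d w₁) (ha : G.Adj b d) : Below f w₀ b ∧ w₀ ≠ b := by
  have hnb := ht.above_of_adj_one hb hd ha
  refine ⟨?_, ht.ne_zero_of_above hnb⟩
  by_cases hbr : Below p b r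
  · obtain ⟨z, hz, haz⟩ := (ht.pattern b hnb hbr).1 ⟨d, hd, ha⟩
    exact ht.zero_below_of_adj_zero hf hnb hz haz
  · rw [hf.below_iff _ _ (fun h => hbr (ht.below_top b h))]
    exact Below.head ht.parent_zero hnb

/-- The subtree of a vertex stays connected without the subtree of `w₁`. -/
theorem conn_diff [Finite V] (ht : Twins G p X n r w₀ w₁) (hf : Reached G p X r f)
    (hv : v ∈ X) (hv' : ¬ Below p v w₁) (hx : ¬ Below p x w₁) (hxv : Below f x v) :
    Conn G {z | Below f z v ∧ ¬ Below p z w₁} v x := by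
  have near : ∀ y d, Below f y v → ¬ Below p y w₁ → Below p d w₁ → G.Adj y d →
      ∃ z, Below p z w₀ ∧ G.Adj y z := by
    intro y d hy hy' hd ha
    exact (ht.pattern y (ht.above_of_adj_one hy' hd ha) (hf.below_top y v hv hy)).1 ⟨d, hd, ha⟩
  have sub : ∀ y d, Below f y v → ¬ Below p y w₁ → Below p d w₁ → G.Adj y d →
      subtree p w₀ ⊆ {z | Below f z v ∧ ¬ Below p z w₁} := by
    intro y d hy hy' hd ha z hz
    exact ⟨(((ht.below_zero_iff hf z).2 hz).trans
      (ht.zero_below_of_adj_one hf hy' hd ha).1).trans hy, ht.zero_not_below_one hz⟩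
  -- A walk below `v` that enters the subtree of `w₁` is rerouted through that of `w₀`: the vertices
  -- where it enters and leaves are both adjacent to the latter, which is connected and lies below
  -- `v` as well.
  have key : ∀ y, Conn G (subtree f v) v y →
      (¬ Below p y w₁ → Conn G {z | Below f z v ∧ ¬ Below p z w₁} v y) ∧
      (Below p y w₁ → Conn G {z | Below f z v ∧ ¬ Below p z w₁} v w₀ ∧
        subtree p w₀ ⊆ {z | Below f z v ∧ ¬ Below p z w₁}) := by
    intro y hy
    induction hy with
    | refl => exact ⟨fun _ => Relation.ReflTransGen.refl, fun h => absurd h hv'⟩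
    | @tail a c hva hac ih =>
      have hav : Below f a v := Conn.mem (S := subtree f v) hva
        (show v ∈ subtree f v from Below.refl f v)
      by_cases ha : Below p a w₁
      · obtain ⟨h1, h2⟩ := ih.2 ha
        refine ⟨fun hc => ?_, fun _ => ⟨h1, h2⟩⟩
        obtain ⟨z, hz, haz⟩ := near c a hac.2 hc ha hac.1.symm
        exact (h1.trans ((ht.forest.conn_subtree hz).mono h2)).tail haz.symm ⟨hac.2, hc⟩
      · have h1 := ih.1 ha
        refine ⟨fun hc => h1.tail hac.1 ⟨hac.2, hc⟩, fun hc => ?_⟩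
        obtain ⟨z, hz, haz⟩ := near a c hav ha hc hac.1
        have h2 := sub a c hav ha hc hac.1
        exact ⟨(h1.tail haz (h2 hz)).trans
          ((ht.forest.conn_of_below hz (Below.refl p w₀)).mono h2), h2⟩
  exact (key x (hf.forest.conn_subtree hxv)).1 hx

/-- The parent `c` of `w₀` in `f` is adjacent to the subtree of `w₀`, hence by `pattern` to that of
`w₁`, provided that `c` is below `r`. Otherwise `c` has kept its descendants, `n` is one of them,
and `n` is adjacent to the subtree of its child `w₁`. -/
theorem exists_adj_one (ht : Twins G p X n r w₀ w₁) (hf : Reached G p X r f)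
    (h0 : Below f w₀ u) (hne : w₀ ≠ u) :
    ∃ b d, Below f b u ∧ ¬ Below p b w₁ ∧ Below p d w₁ ∧ G.Adj b d := by
  obtain ⟨c, hc, hcu⟩ := h0.exists_parent hne
  obtain ⟨z, hz, ha⟩ := hf.forest.adj_child _ _ hc
  have hc0 : ¬ Below p c w₀ := by
    rw [← ht.below_zero_iff hf]
    exact hf.forest.acyclic _ _ hc
  have hnc := ht.above_of_adj_zero hc0 ((ht.below_zero_iff hf z).1 hz) ha
  by_cases hcr : Below p c r
  · obtain ⟨d, hd, had⟩ := (ht.pattern c hnc hcr).2 ⟨z, (ht.below_zero_iff hf z).1 hz, ha⟩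
    exact ⟨c, d, hcu, ht.not_below_one hnc, hd, had⟩
  · obtain ⟨d, hd, had⟩ := ht.forest.adj_child _ _ ht.parent_one
    refine ⟨n, d, Below.trans ?_ hcu, ht.not_below_one (Below.refl p n), hd, had⟩
    exact (hf.below_iff _ _ (fun h => hcr (ht.below_top c h))).2 hnc

/-- A rotation that involves the subtree of `w₁` does not change the order elsewhere. -/
theorem below_rot_iff [Finite V] (ht : Twins G p X n r w₀ w₁) (hf : Reached G p X r f)
    (hu : u ∈ X) (hv : v ∈ X) (huv : f v = some u) (hD : Below p u w₁ ∨ Below p v w₁)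
    (hx : ¬ Below p x w₁) (hy : ¬ Below p y w₁) : Below (rot G f u v) x y ↔ Below f x y := by
  have hne := hf.forest.parent_ne huv
  have hf' := hf.rot hu hv huv
  by_cases hyu : y = u
  · subst hyu
    have hvD := hD.resolve_left hy
    refine ⟨below_of_below_rot_left hf.forest huv, fun h => ?_⟩
    rw [below_rot_left_iff_conn hf.forest huv]
    refine (ht.conn_diff hf hu hy hx h).mono ?_
    rintro z ⟨h1, h2⟩
    exact ⟨h1, fun h => h2 (h ▸ hvD)⟩
  by_cases hyv : y = v
  · subst hyv
    have huD := hD.resolve_right hy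
    constructor
    · intro h
      rw [hf.forest.below_iff_conn huv]
      refine (ht.conn_diff hf' hv hy hx h).mono ?_
      rintro z ⟨h1, h2⟩
      exact ⟨(below_rot_right hne huv).1 h1, fun h => h2 (h ▸ huD)⟩
    · intro h
      exact (below_rot_right hne huv).2 (h.tail huv)
  exact RotDist.below_rot_iff hne huv hyu hyv

/-- Such a rotation is invisible in the twin order, so the shortened sequence just skips it. -/
theorem twinBelow_rot_of_mem [Finite V] (ht : Twins G p X n r w₀ w₁) (hf : Reached G p X r f)
    (hu : u ∈ X) (hv : v ∈ X) (huv : f v = some u) (hD : Below p u w₁ ∨ Below p v w₁) (x y : V) :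
    TwinBelow p (rot G f u v) w₀ w₁ x y ↔ TwinBelow p f w₀ w₁ x y := by
  have h0 := ht.zero_not_below_one (Below.refl p w₀)
  unfold TwinBelow
  by_cases hy : Below p y w₁
  · simp [hy]
  by_cases hx : Below p x w₁
  · simp [hx, hy, ht.below_rot_iff hf hu hv huv hD h0 hy]
  · simp [hx, hy, ht.below_rot_iff hf hu hv huv hD hx hy]

/-- Outside the subtree of `w₁` the two orders agree, and as this subtree contains all descendants
of its elements, none of them can lie between `v` and `u`. -/
theorem parent_of_twinBelow (hf : IsForest G f) (hh : IsForest G h)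
    (H : ∀ x y, Below h x y ↔ TwinBelow p f w₀ w₁ x y) (huv : f v = some u)
    (hu : ¬ Below p u w₁) (hv : ¬ Below p v w₁) : h v = some u := by
  have h1 : Below h v u := (H v u).2 (Or.inr ⟨hu, Or.inl ⟨hv, Below.of_parent huv⟩⟩)
  obtain ⟨c, hc, hcu⟩ := h1.exists_parent (hf.parent_ne huv)
  have hvc : ¬ Below p c w₁ ∧ Below f v c := by
    rcases (H v c).1 (Below.of_parent hc) with h | ⟨h, h' | h'⟩
    · exact absurd (h.2.trans h.1) hv
    · exact ⟨h, h'.2⟩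
    · exact absurd h'.1 hv
  have hcu' : Below f c u := by
    rcases (H c u).1 hcu with h | ⟨h, h' | h'⟩
    · exact absurd h.1 hu
    · exact h'.2
    · exact absurd h'.1 hvc.1
  rw [hc, hf.antisymm hcu' (hvc.2.parent_below (hh.parent_ne hc) huv)]

/-- Such a rotation is performed in the twin forest too. The delicate point is the new descendant
set of `u`, a connected component: the subtree of `w₁` falls into it exactly if `w₀` does. -/
theorem twinBelow_rot_of_not_mem [Finite V] (ht : Twins G p X n r w₀ w₁)
    (hf : Reached G p X r f) (hh : IsForest G h)
    (H : ∀ x y, Below h x y ↔ TwinBelow p f w₀ w₁ x y) (hu : u ∈ X) (hv : v ∈ X)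
    (huv : f v = some u) (hu' : ¬ Below p u w₁) (hv' : ¬ Below p v w₁) (x y : V) :
    Below (rot G h u v) x y ↔ TwinBelow p (rot G f u v) w₀ w₁ x y := by
  have huvh := parent_of_twinBelow hf.forest hh H huv hu' hv'
  have hne := hf.forest.parent_ne huv
  have hf' := hf.rot hu hv huv
  have h0X := ht.untouched w₀ (Below.refl p w₀)
  have h0u : w₀ ≠ u := by rintro rfl; exact h0X hu
  have h0v : w₀ ≠ v := by rintro rfl; exact h0X hv
  by_cases hyv : y = v
  · subst hyv
    rw [below_rot_right hne huvh, H]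
    simp [TwinBelow, hu', hv', below_rot_right hne huv, h0u, h0v]
  by_cases hyu : y = u
  · subst hyu
    rw [below_rot_left_iff_conn hh huvh]
    have hT : ∀ x, TwinBelow p (rot G f y v) w₀ w₁ x y ↔
        (¬ Below p x w₁ ∧ Below (rot G f y v) x y) ∨
        (Below p x w₁ ∧ Below (rot G f y v) w₀ y) := by
      intro x
      simp [TwinBelow, hu', h0u]
    have hB : ∀ x, Below h x y ↔ (¬ Below p x w₁ ∧ Below f x y) ∨
        (Below p x w₁ ∧ Below f w₀ y) := by
      intro x
      rw [H]
      simp [TwinBelow, hu', h0u]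
    constructor
    · intro hc
      rw [hT]
      induction hc with
      | refl => exact Or.inl ⟨hu', Below.refl _ y⟩
      | @tail a b _ hab ih =>
        obtain ⟨hadj, hbh, hbv⟩ := hab
        rw [hB] at hbh
        by_cases hb : Below p b w₁
        · right
          refine ⟨hb, ?_⟩
          rcases ih with ⟨ha, hay⟩ | ⟨ha, hay⟩
          · exact (ht.zero_below_of_adj_one hf' ha hb hadj).1.trans hay
          · exact hay
        · left
          refine ⟨hb, ?_⟩
          have hbf : Below (rot G f y v) b v := by
            rw [below_rot_right hne huv]
            rcases hbh with h | h
            · exact h.2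
            · exact absurd h.1 hb
          rcases ih with ⟨ha, hay⟩ | ⟨ha, hay⟩
          · exact hf'.forest.closed (rot_left G f y v) hay hbf hbv hadj
          -- The walk leaves the subtree of `w₁` at `b`. Both `b` and `y` are above `w₀`, hence
          -- comparable, and `b` strictly above `y` would force `b = v`.
          · have h0b := (ht.zero_below_of_adj_one hf' hb ha hadj.symm).1
            rcases hay.total h0b with h | h
            · by_cases hyb : y = b
              · rw [hyb]; exact Below.refl _ b
              · exact absurd (hf'.forest.antisymm hbf
                  (h.parent_below hyb (rot_left G f y v))) hbv
            · exact h
    · have hsub : {z | Below (rot G f y v) z y ∧ ¬ Below p z w₁} ⊆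
          {z | Below h z y ∧ z ≠ v} := by
        rintro z ⟨h1, h2⟩
        refine ⟨(hB z).2 (Or.inl ⟨h2, below_of_below_rot_left hf.forest huv h1⟩), ?_⟩
        rintro rfl
        exact hf'.forest.acyclic _ _ (rot_left G f y z) h1
      rw [hT]
      rintro (⟨hx, hxy⟩ | ⟨hx, h0y⟩)
      · exact (ht.conn_diff hf' hu hu' hx hxy).mono hsub
      -- Since `w₀` is below `y`, an edge joins the part below `y` to the subtree of `w₁`, and
      -- through it the whole connected subtree is reached.
      · obtain ⟨b, d, hb, hb', hd, hbd⟩ := ht.exists_adj_one hf' h0y h0u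
        have hsub' : subtree p w₁ ⊆ {z | Below h z y ∧ z ≠ v} := by
          intro z hz
          refine ⟨(hB z).2 (Or.inr ⟨hz, below_of_below_rot_left hf.forest huv h0y⟩), ?_⟩
          rintro rfl
          exact hv' hz
        exact (((ht.conn_diff hf' hu hu' hb' hb).mono hsub).tail hbd (hsub' hd)).trans
          ((ht.forest.conn_of_below hd hx).mono hsub')
  rw [RotDist.below_rot_iff (hh.parent_ne huvh) huvh hyu hyv, H]
  unfold TwinBelow
  simp only [RotDist.below_rot_iff hne huv hyu hyv]

theorem reached_self (ht : Twins G p X n r w₀ w₁) (hX : ∀ x ∈ X, Below p x r) :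
    Reached G p X r p :=
  ⟨ht.forest, fun _ _ _ => Iff.rfl, fun _ y hy hxy => hxy.trans (hX y hy)⟩

/-- Where the intact subtree of `w₁` hangs is forced: its parent is adjacent to it and hence above
`w₀`, and conversely what lies properly above `w₀` has a descendant adjacent to it. This applies to
the first and the last forest of the sequence. -/
theorem below_iff_twinBelow (ht : Twins G p X n r w₀ w₁) (hf : Reached G p X r f)
    (hsame : ∀ y, Below p y w₁ → ∀ x, Below f x y ↔ Below p x y) (x y : V) :
    Below f x y ↔ TwinBelow p f w₀ w₁ x y := by
  unfold TwinBelow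
  by_cases hy : Below p y w₁
  · simp [hy, hsame y hy]
  by_cases hx : Below p x w₁
  · simp only [hx, hy, not_true_eq_false, not_false_eq_true, false_and, true_and, false_or]
    have hs := hsame w₁ (Below.refl p w₁)
    have hxf : Below f x w₁ := (hs x).2 hx
    constructor
    · intro hxy
      have h1 : Below f w₁ y := by
        rcases hxf.total hxy with h | h
        · exact h
        · exact absurd ((hs y).1 h) hy
      have hne : w₁ ≠ y := by rintro rfl; exact hy (Below.refl p _)
      obtain ⟨b, hb, hby⟩ := h1.exists_parent hne
      obtain ⟨d, hd, hbd⟩ := hf.forest.adj_child _ _ hb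
      have hb' : ¬ Below p b w₁ := by
        rw [← hs]
        exact hf.forest.acyclic _ _ hb
      have h2 := ht.zero_below_of_adj_one hf hb' ((hs d).1 hd) hbd
      refine ⟨h2.1.trans hby, ?_⟩
      rintro rfl
      exact h2.2 (hf.forest.antisymm h2.1 hby)
    · rintro ⟨h0, hne⟩
      obtain ⟨b, d, hb, hb', hd, hbd⟩ := ht.exists_adj_one hf h0 hne
      have hdf : Below f d w₁ := (hs d).2 hd
      have hdb : Below f d b := by
        rcases hf.forest.comparable b d hbd with h | h
        · exact absurd ((hs b).1 (h.trans hdf)) hb'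
        · exact h
      rcases hdb.total hdf with h | h
      · exact absurd ((hs b).1 h) hb'
      · exact hxf.trans (h.trans hb)
  · simp [hx, hy]

/-- The rotations that involve the subtree of `w₁` can be omitted if this subtree is the same at
the end as at the beginning. -/
theorem exists_shorter [Finite V] {L : List (V × V)} (ht : Twins G p X n r w₀ w₁)
    (hL : RotList G p L q) (hX : touched L ⊆ X) (h1 : w₁ ∈ touched L)
    (hsame : ∀ y, Below p y w₁ → ∀ x, Below q x y ↔ Below p x y) :
    ∃ L', RotList G p L' q ∧ L'.length < L.length := by
  -- While `f` runs through the given sequence, `h` runs through the shortened one and always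
  -- carries the twin order of `f`. A rotation of `w₁` itself is dropped, which gives the strict
  -- inequality.
  have key : ∀ (L : List (V × V)) (f h : V → Option V), RotList G f L q → Reached G p X r f →
      IsForest G h → (∀ x y, Below h x y ↔ TwinBelow p f w₀ w₁ x y) → touched L ⊆ X →
      ∃ L', RotList G h L' q ∧ L'.length ≤ L.length ∧
        (w₁ ∈ touched L → L'.length < L.length) := by
    intro L
    induction L with
    | nil =>
      intro f h hL hf hh H _
      cases hL
      have : h = q := hh.ext hf.forest
        (fun x y => (H x y).trans (ht.below_iff_twinBelow hf hsame x y).symm)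
      exact ⟨[], this ▸ RotList.nil h, le_rfl, by simp [touched_nil]⟩
    | cons e L ih =>
      intro f h hL hf hh H hLX
      cases hL with
      | cons u v huv hL =>
      rw [touched_cons] at hLX ⊢
      have hu : u ∈ X := hLX (by simp)
      have hv : v ∈ X := hLX (by simp)
      have hLX' : touched L ⊆ X := fun x hx => hLX (Or.inr hx)
      have hf' := hf.rot hu hv huv
      by_cases hD : Below p u w₁ ∨ Below p v w₁
      · obtain ⟨L', g1, g2, _⟩ := ih _ h hL hf' hh
          (fun x y => (H x y).trans (ht.twinBelow_rot_of_mem hf hu hv huv hD x y).symm) hLX'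
        exact ⟨L', g1, by simp; omega, fun _ => by simp; omega⟩
      · rw [not_or] at hD
        obtain ⟨L', g1, g2, g3⟩ := ih _ (RotDist.rot G h u v) hL hf'
          (hh.rot (parent_of_twinBelow hf.forest hh H huv hD.1 hD.2))
          (ht.twinBelow_rot_of_not_mem hf hh H hu hv huv hD.1 hD.2) hLX'
        refine ⟨(u, v) :: L', RotList.cons u v
          (parent_of_twinBelow hf.forest hh H huv hD.1 hD.2) g1, by simp; omega, ?_⟩
        rintro ((rfl | rfl) | h)
        · exact absurd (Below.refl p _) hD.1
        · exact absurd (Below.refl p _) hD.2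
        · have := g3 h
          simp; omega
  have hp := ht.reached_self ht.below_top
  obtain ⟨L', g1, _, g3⟩ := key L p p hL hp ht.forest
    (ht.below_iff_twinBelow hp (fun _ _ _ => Iff.rfl)) hX
  exact ⟨L', g1, g3 h1⟩

end Twins

end Twins

end RotDist

namespace RotDist

/-! ### Candidate sets that contain all vertices rotated by a shortest sequence. -/

section Candidates

variable {V : Type*} {G : SimpleGraph V} {p q : V → Option V} {L : List (V × V)}
  {A A' X M : Set V}

/-- Above every vertex `n` of `M` there is a last vertex that is reached inside `M`. -/
theorem IsForest.exists_top [Finite V] (hp : IsForest G p) {n : V} (hn : n ∈ M) :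
    ∃ r, Below p n r ∧ (∀ y, Below p n y → Below p y r → y ∈ M) ∧
      ∀ b, p r = some b → b ∉ M := by
  have hwf : WellFounded (Function.swap (fun a b => p a = some b)) := by
    have : IsTrans V (Function.swap (Relation.TransGen (fun a b => p a = some b))) :=
      ⟨fun a b c h1 h2 => Relation.TransGen.trans h2 h1⟩
    have : Std.Irrefl (Function.swap (Relation.TransGen (fun a b => p a = some b))) := by
      constructor
      intro a h
      obtain ⟨b, h1, h2⟩ := Relation.TransGen.head'_iff.1 h
      exact hp.acyclic a b h1 h2
    exact (Finite.wellFounded_of_trans_of_irrefl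
      (Function.swap (Relation.TransGen (fun a b => p a = some b)))).mono
      (fun a b h => Relation.TransGen.single h)
  induction n using hwf.induction with
  | _ n ih =>
    by_cases h : ∃ b, p n = some b ∧ b ∈ M
    · obtain ⟨b, hb, hbM⟩ := h
      obtain ⟨r, h1, h2, h3⟩ := ih b hb hbM
      refine ⟨r, Below.head hb h1, fun y hy hyr => ?_, h3⟩
      by_cases hny : n = y
      · exact hny ▸ hn
      · exact h2 y (hy.parent_below hny hb) hyr
    · refine ⟨n, Below.refl p n, fun y hy hyn => hp.antisymm hy hyn ▸ hn, fun b hb hbM => ?_⟩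
      exact h ⟨b, hb, hbM⟩

/-- Induction from the leaves upwards: equal children with equal subtrees give equal subtrees. -/
theorem below_iff_of_children [Finite V] (hp : IsForest G p) (hX : ∀ v ∈ X, ∀ c, p c = some v ↔ q c = some v)
    (hc : ∀ v ∈ X, ∀ c, p c = some v → c ∈ X ∨ ∀ x, Below p x c ↔ Below q x c) :
    ∀ v ∈ X, ∀ x, Below p x v ↔ Below q x v := by
  intro v
  induction v using hp.wellFounded.induction with
  | _ v ih =>
    intro hv x
    have hchild : ∀ c, p c = some v → (Below p x c ↔ Below q x c) := by
      intro c hcv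
      rcases hc v hv c hcv with h | h
      · exact ih c hcv h x
      · exact h x
    by_cases hxv : x = v
    · subst hxv
      exact iff_of_true (Below.refl p x) (Below.refl q x)
    constructor
    · intro h
      obtain ⟨c, h1, h2⟩ := h.exists_child hxv
      exact ((hchild c h1).1 h2).tail ((hX v hv c).1 h1)
    · intro h
      obtain ⟨c, h1, h2⟩ := h.exists_child hxv
      have h1' := (hX v hv c).2 h1
      exact ((hchild c h1').2 h2).tail h1'

/-- If no shorter list of rotations exists and `A ⊆ A'` are sets of vertices such that passing
from `A` to `A'` adds no vertex involved in the rotations, then all these vertices are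
in `A`. -/
theorem touched_subset_of_stable [Finite V] (hp : IsForest G p) (hL : RotList G p L q)
    (hmin : ∀ L', RotList G p L' q → L.length ≤ L'.length)
    (hdiff : ∀ v, v ∉ A → ∀ c, p c = some v ↔ q c = some v)
    (hpar : ∀ a ∈ A, ∀ b, p a = some b → b ∈ A')
    (hrare : ∀ n ∈ A, ∀ w, p w = some n → w ∈ touched L → w ∉ A' → ∃ w₀, p w₀ = some n ∧
      (∀ x, Below p x w₀ → x ∉ touched L) ∧
      ∀ a ∈ A, (∃ x, Below p x w ∧ G.Adj a x) ↔ ∃ x, Below p x w₀ ∧ G.Adj a x)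
    (hstable : touched L ∩ A' ⊆ A) : touched L ⊆ A := by
  by_contra hnot
  obtain ⟨m, hm, hmA⟩ := Set.not_subset.1 hnot
  -- `X` will be the component of `m` among the rotated vertices, with respect to the edges of the
  -- forest `p`.
  set E : V → V → Prop := fun a b =>
    a ∈ touched L ∧ b ∈ touched L ∧ (p a = some b ∨ p b = some a) with hE
  have hEs : Std.Symm E := ⟨fun a b h => ⟨h.2.1, h.1, h.2.2.symm⟩⟩
  set X : Set V := {x | Relation.ReflTransGen E m x} with hXdef
  have hmX : m ∈ X := Relation.ReflTransGen.refl
  have hXL : X ⊆ touched L := by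
    intro x hx
    rcases Relation.ReflTransGen.cases_tail hx with h | ⟨b, _, h⟩
    · exact h ▸ hm
    · exact h.2.1
  have hXE : ∀ x ∈ X, ∀ y, y ∈ touched L → (p x = some y ∨ p y = some x) → y ∈ X :=
    fun x hx y hy h => Relation.ReflTransGen.tail hx ⟨hXL hx, hy, h⟩
  have hno : RotList.NoEdge p X (touched L \ X) := by
    intro x hx y hy
    exact ⟨fun h => hy.2 (hXE x hx y hy.1 (Or.inl h)), fun h => hy.2 (hXE x hx y hy.1 (Or.inr h))⟩
  have hcov : touched L ⊆ X ∪ (touched L \ X) := by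
    intro x hx
    by_cases h : x ∈ X
    · exact Or.inl h
    · exact Or.inr ⟨hx, h⟩
  have hdisj : Disjoint X (touched L \ X) := Set.disjoint_sdiff_right
  have huntouched : ∀ c, c ∉ touched L → ∀ x, Below p x c ↔ Below q x c :=
    fun c hc x => (hL.below_iff hp hc).symm
  -- If `X` meets `A`, a subtree is cancelled against a twin; if not, all rotations in `X` can be
  -- omitted.
  by_cases hXA : ∃ a ∈ X, a ∈ A
  · obtain ⟨a, haX, haA⟩ := hXA
    have hcross : ∃ y ∈ X, ∃ n ∈ X, y ∉ A ∧ n ∈ A ∧ E y n := by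
      by_contra hcon
      push Not at hcon
      have : ∀ x, Relation.ReflTransGen E m x → x ∉ A := by
        intro x hx
        induction hx with
        | refl => exact hmA
        | @tail b c hb hbc ih =>
          intro hc
          exact hcon b hb c (Relation.ReflTransGen.tail hb hbc) ih hc hbc
      exact this a haX haA
    obtain ⟨y, hyX, n, hnX, hyA, hnA, hyn⟩ := hcross
    -- All parents of vertices of `A` are in `A'`, so `y` can only be a child of `n`, and one that
    -- the round did not add.
    have hyA' : y ∉ A' := fun h => hyA (hstable ⟨hXL hyX, h⟩)
    have hpy : p y = some n := by
      rcases hyn.2.2 with h | h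
      · exact h
      · exact absurd (hpar n hnA y h) hyA'
    obtain ⟨w₀, hw₀, hw₀L, hpat⟩ := hrare n hnA y hpy (hXL hyX) hyA'
    -- The path from `n` to `r` consists of rotated vertices. By stability it stays in `A`, so types
    -- with respect to `A` determine the adjacencies that `Twins` needs. As `r` has no rotated
    -- parent, all of `X` is below `r`.
    obtain ⟨r, hnr, hrM, hrtop⟩ := hp.exists_top (hXL hnX)
    have hchain : ∀ b, Below p n b → Below p b r → b ∈ A := by
      intro b hb
      induction hb with
      | refl => exact fun _ => hnA
      | @tail b c hb hbc ih =>
        intro hc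
        exact hstable ⟨hrM c (Below.tail hb hbc) hc, hpar b (ih (Below.head hbc hc)) c hbc⟩
    have hXr : ∀ x ∈ X, Below p x r := by
      have hstep : ∀ x, Relation.ReflTransGen E n x → Below p x r := by
        intro x hx
        induction hx with
        | refl => exact hnr
        | @tail b c _ hbc ih =>
          rcases hbc.2.2 with h | h
          · by_cases hbr : b = r
            · subst hbr
              exact absurd hbc.2.1 (hrtop c h)
            · exact ih.parent_below hbr h
          · exact Below.head h ih
      intro x hx
      exact hstep x ((Relation.ReflTransGen.stdSymm.symm _ _ hnX).trans hx)
    have ht : Twins G p X n r w₀ y := by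
      refine ⟨hp, hw₀, hpy, ?_, hXr, fun x hx hxX => hw₀L x hx (hXL hxX), ?_⟩
      · rintro rfl
        exact hw₀L _ (Below.refl p _) (hXL hyX)
      · intro b hb hbr
        exact hpat b (hchain b hb hbr)
    -- By connectedness a vertex `d ≠ y` of the subtree of `y` has a neighbour in it. If `d` were in
    -- `A`, equality of types would give it a neighbour below `w₀` too, but vertices below different
    -- siblings are incomparable.
    have hDA : ∀ d, Below p d y → d ∉ A := by
      intro d hd hdA
      have hne : d ≠ y := by rintro rfl; exact hyA hdA
      obtain ⟨z, hz, _⟩ := (Relation.ReflTransGen.cases_head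
        (hp.conn_of_below hd (Below.refl p y))).resolve_left hne
      obtain ⟨x, hx, hdx⟩ := (hpat d hdA).1 ⟨z, hz.2, hz.1⟩
      rcases hp.comparable d x hdx with h | h
      · exact ht.zero_not_below_one (h.trans hx) hd
      · exact ht.zero_not_below_one hx (h.trans hd)
    obtain ⟨L₁, L₂, r', h1, h2, h3, h4, h5⟩ := hL.split hp hdisj hno hcov
    have hr' := h1.isForest hp
    have hDsame : ∀ d, Below p d y → ∀ x, Below p x d ↔ Below q x d :=
      below_iff_of_children (X := {d | Below p d y}) hp
        (fun d hd c => hdiff d (hDA d hd) c) (fun d hd c hc => Or.inl (Below.head hc hd))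
    obtain ⟨L₃, g1, g2⟩ := ht.exists_shorter h1 (by rw [h4]; exact Set.inter_subset_right)
      (by rw [h4]; exact ⟨hXL hyX, hyX⟩) (by
        intro d hd x
        -- A vertex `d` of `X` is not rotated in `L₂`, so its descendants after `L₁` are already the
        -- final ones; any other `d` is not rotated in `L₁`.
        by_cases hdX : d ∈ X
        · rw [← h2.below_iff hr' (by rw [h5]; exact fun h => h.2.2 hdX), hDsame d hd]
        · exact h1.below_iff hp (by rw [h4]; exact fun h => hdX h.2))
    have := hmin _ (g1.append h2)
    simp only [List.length_append] at this
    omega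
  · push Not at hXA
    have hXsame : ∀ v ∈ X, ∀ x, Below p x v ↔ Below q x v := by
      refine below_iff_of_children hp (fun v hv c => hdiff v (hXA v hv) c) ?_
      intro v hv c hc
      by_cases hcL : c ∈ touched L
      · exact Or.inl (hXE v hv c hcL (Or.inr hc))
      · exact Or.inr (huntouched c hcL)
    -- Here the rotations outside `X` come at the front, and they alone already lead to `q`.
    obtain ⟨L₁, L₂, r, h1, h2, h3, h4, h5⟩ := hL.split hp hdisj.symm hno.symm
      (by rw [Set.union_comm]; exact hcov)
    have hr := h1.isForest hp
    have hrq : r = q := by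
      refine hr.ext (hL.isForest hp) (fun x y => ?_)
      by_cases hy : y ∈ X
      · rw [h1.below_iff hp (by rw [h4]; exact fun h => h.2.2 hy), hXsame y hy]
      · exact (h2.below_iff hr (by rw [h5]; exact fun h => hy h.2)).symm
    have hpos : L₂ ≠ [] := by
      rintro rfl
      have : m ∈ touched ([] : List (V × V)) := by rw [h5]; exact ⟨hm, hmX⟩
      simp [touched_nil] at this
    have := hmin L₁ (hrq ▸ h1)
    have := List.length_pos_of_ne_nil hpos
    omega

theorem ncard_touched_le (L : List (V × V)) : (touched L).ncard ≤ 2 * L.length := by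
  induction L with
  | nil => simp [touched_nil]
  | cons e L ih =>
    obtain ⟨u, v⟩ := e
    rw [touched_cons]
    have h1 := Set.ncard_union_le {u, v} (touched L)
    have h2 := Set.ncard_insert_le u {v}
    rw [Set.ncard_singleton] at h2
    simp only [List.length_cons]
    omega

/-- The parents of the vertices whose parents in `p` and `q` differ. -/
def diffParents (p q : V → Option V) : Set V :=
  {a | ∃ w, p w ≠ q w ∧ (p w = some a ∨ q w = some a)}

theorem parent_iff_of_notMem {v : V} (h : v ∉ diffParents p q) (c : V) :
    p c = some v ↔ q c = some v := by
  by_cases hc : p c = q c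
  · rw [hc]
  · exact ⟨fun h' => absurd ⟨c, hc, Or.inl h'⟩ h, fun h' => absurd ⟨c, hc, Or.inr h'⟩ h⟩

/-- A changed vertex is either rotated, and contributes its old and its new parent, or its two
parents are rotated. A rotation involves two vertices, which gives the factor 2 + 2 + 2. -/
theorem ncard_diffParents_le [Finite V] (hL : RotList G p L q) :
    (diffParents p q).ncard ≤ 6 * L.length := by
  have hsub : diffParents p q ⊆ touched L ∪ ((fun w => (p w).getD w) '' touched L ∪
      (fun w => (q w).getD w) '' touched L) := by
    rintro a ⟨w, hw, ha⟩
    by_cases hwL : w ∈ touched L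
    · right
      rcases ha with ha | ha
      · exact Or.inl ⟨w, hwL, by simp [ha]⟩
      · exact Or.inr ⟨w, hwL, by simp [ha]⟩
    · left
      obtain ⟨⟨b, hb, hb'⟩, c, hc, hc'⟩ := hL.parents_touched hwL hw
      rcases ha with ha | ha
      · rw [ha] at hb'; cases hb'; exact hb
      · rw [ha] at hc'; cases hc'; exact hc
  have h1 := Set.ncard_le_ncard hsub (Set.toFinite _)
  have h2 := Set.ncard_union_le (touched L) ((fun w => (p w).getD w) '' touched L ∪
      (fun w => (q w).getD w) '' touched L)
  have h3 := Set.ncard_union_le ((fun w => (p w).getD w) '' touched L)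
    ((fun w => (q w).getD w) '' touched L)
  have h4 := Set.ncard_image_le (s := touched L) (f := fun w => (p w).getD w)
  have h5 := Set.ncard_image_le (s := touched L) (f := fun w => (q w).getD w)
  have h6 := ncard_touched_le L
  omega

/-- The children of `n` whose subtrees are adjacent to the same vertices of `A` as the subtree
of `w`. -/
def sameType (G : SimpleGraph V) (p : V → Option V) (A : Set V) (n w : V) : Set V :=
  {w' | p w' = some n ∧
    ∀ a ∈ A, (∃ x, Below p x w ∧ G.Adj a x) ↔ ∃ x, Below p x w' ∧ G.Adj a x}

/-- The sets reached by the following rounds, which start with the parents of the vertices whose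
parents differ: a round adds all parents, and all children with few siblings of the same type. -/
inductive CandidateSet (G : SimpleGraph V) (p q : V → Option V) (k : ℕ) : ℕ → Set V → Prop
  | zero (A : Set V) (h : diffParents p q ⊆ A) : CandidateSet G p q k 0 A
  | succ (i : ℕ) (A A' : Set V) (h : CandidateSet G p q k i A) (hsub : A ⊆ A')
      (hpar : ∀ a ∈ A, ∀ b, p a = some b → b ∈ A')
      (hrare : ∀ n ∈ A, ∀ w, p w = some n → w ∉ A' → 2 * k < (sameType G p A n w).ncard) :
      CandidateSet G p q k (i + 1) A'

theorem CandidateSet.diffParents_subset {k i : ℕ} (h : CandidateSet G p q k i A) :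
    diffParents p q ⊆ A := by
  induction h with
  | zero A h => exact h
  | succ i A A' _ hsub _ _ ih => exact ih.trans hsub

/-- Subtrees of different siblings are disjoint, so at most `2 * k` of them contain a rotated
vertex. -/
theorem exists_untouched_twin [Finite V] (hp : IsForest G p) {k : ℕ} (hk : L.length ≤ k) {n w : V}
    (hcard : 2 * k < (sameType G p A n w).ncard) :
    ∃ w₀, p w₀ = some n ∧ (∀ x, Below p x w₀ → x ∉ touched L) ∧
      ∀ a ∈ A, (∃ x, Below p x w ∧ G.Adj a x) ↔ ∃ x, Below p x w₀ ∧ G.Adj a x := by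
  by_contra hcon
  push Not at hcon
  have : ∀ w' ∈ sameType G p A n w, ∃ x, Below p x w' ∧ x ∈ touched L := by
    intro w' hw'
    by_contra h
    push Not at h
    obtain ⟨a, ha, h'⟩ := hcon w' hw'.1 h
    rcases h' with ⟨h1, h2⟩ | ⟨h1, x, h2, h3⟩
    · obtain ⟨x, hx, hax⟩ := (hw'.2 a ha).1 h1
      exact h2 x hx hax
    · obtain ⟨z, hz, haz⟩ := (hw'.2 a ha).2 ⟨x, h2, h3⟩
      exact h1 z hz haz
  choose! f hf using this
  have hinj : Set.InjOn f (sameType G p A n w) := by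
    intro a ha b hb hab
    have h1 := (hf a ha).1
    have h2 := (hf b hb).1
    rw [hab] at h1
    by_contra hne
    rcases h1.total h2 with h | h
    · exact hp.acyclic b n hb.1 (h.parent_below hne ha.1)
    · exact hp.acyclic a n ha.1 (h.parent_below (Ne.symm hne) hb.1)
  have h1 := Set.ncard_le_ncard_of_injOn f (fun a ha => (hf a ha).2) hinj (Set.toFinite _)
  have h2 := ncard_touched_le L
  omega

/-- As long as a rotated vertex is missing, every round captures a new one by
`touched_subset_of_stable`, and there are at most `2 * k` of them. -/
theorem CandidateSet.touched_subset [Finite V] {k i : ℕ} (hA : CandidateSet G p q k i A) (hp : IsForest G p)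
    (hL : RotList G p L q) (hk : L.length ≤ k)
    (hmin : ∀ L', RotList G p L' q → L.length ≤ L'.length) (hi : 2 * k < i) :
    touched L ⊆ A := by
  have key : touched L ⊆ A ∨ i ≤ (touched L ∩ A).ncard := by
    clear hi
    induction hA with
    | zero A h => exact Or.inr (Nat.zero_le _)
    | succ i A A' h hsub hpar hrare ih =>
      rcases ih with ih | ih
      · exact Or.inl (ih.trans hsub)
      · by_cases hst : touched L ∩ A' ⊆ A
        · refine Or.inl ((touched_subset_of_stable hp hL hmin
            (fun v hv => parent_iff_of_notMem (fun h' => hv (h.diffParents_subset h')))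
            hpar ?_ hst).trans hsub)
          intro n hn w hw _ hwA
          exact exists_untouched_twin hp hk (hrare n hn w hw hwA)
        · right
          obtain ⟨x, hx, hxA⟩ := Set.not_subset.1 hst
          have : touched L ∩ A ⊂ touched L ∩ A' := by
            refine ⟨Set.inter_subset_inter_right _ hsub, fun h' => hxA (h' hx).2⟩
          have := Set.ncard_lt_ncard this (Set.toFinite _)
          omega
  rcases key with h | h
  · exact h
  · have h1 := Set.ncard_le_ncard (Set.inter_subset_left (s := touched L) (t := A))
      (Set.toFinite _)
    have h2 := ncard_touched_le L
    omega

theorem exists_rotList_in_candidateSet [Finite V] {k i ℓ : ℕ} (hA : CandidateSet G p q k i A)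
    (hp : IsForest G p) (h : RotSeq G ℓ p q) (hk : ℓ ≤ k) (hi : 2 * k < i) :
    ∃ L, RotList G p L q ∧ L.length ≤ k ∧ touched L ⊆ A := by
  classical
  have hex : ∃ ℓ, RotSeq G ℓ p q := ⟨ℓ, h⟩
  obtain ⟨L, hL, hlen⟩ := rotSeq_iff_exists_rotList.1 (Nat.find_spec hex)
  have hle : L.length ≤ k := hlen ▸ (Nat.find_min' hex h).trans hk
  refine ⟨L, hL, hle, hA.touched_subset hp hL hle (fun L' hL' => ?_) hi⟩
  rw [hlen]
  exact Nat.find_min' hex (rotSeq_iff_exists_rotList.2 ⟨L', hL', rfl⟩)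

end Candidates

/-! ### The recursive definition implies the axioms of the order. -/

section ElimForests

variable {V : Type*} {G : SimpleGraph V} {par : V → Option V} {S K : Set V} {r x y : V}

theorem exists_isComponent [Finite V] (hx : x ∈ S) : ∃ K, IsComponent G S K ∧ x ∈ K := by
  have h : ({x} : Set V) ⊆ S ∧ (G.induce {x}).Connected := by
    refine ⟨by simpa using hx, ?_⟩
    have : Nonempty ({x} : Set V) := ⟨⟨x, rfl⟩⟩
    have : Subsingleton ({x} : Set V) := by
      constructor
      rintro ⟨a, rfl⟩ ⟨b, rfl⟩
      rfl
    exact ⟨SimpleGraph.Preconnected.of_subsingleton⟩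
  obtain ⟨K, hK, hmax⟩ := Finite.exists_le_maximal
    (p := fun A : Set V => A ⊆ S ∧ (G.induce A).Connected) h
  exact ⟨K, hmax, hK rfl⟩

theorem IsComponent.mem_of_adj (hK : IsComponent G S K) (hx : x ∈ K) (hy : y ∈ S)
    (ha : G.Adj x y) : y ∈ K := by
  have hpair := G.induce_pair_connected_of_adj ha
  have h := G.induce_union_connected hK.prop.2.preconnected hpair.preconnected
    ⟨x, hx, by simp⟩
  have hsub : K ∪ {x, y} ⊆ S := by
    rintro z (hz | rfl | rfl)
    · exact hK.prop.1 hz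
    · exact hK.prop.1 hx
    · exact hy
  exact hK.le_of_ge ⟨hsub, h⟩ Set.subset_union_left (Or.inr (by simp))

theorem IsElimTree.spec [Finite V] (h : IsElimTree G par S r) (hS : (G.induce S).Connected) :
    (∀ x ∈ S, Below par x r) ∧
    (∀ x ∈ S, ∀ y ∈ S, G.Adj x y → Below par x y ∨ Below par y x) ∧
    ∀ w ∈ S, w ≠ r → ∀ u, par w = some u → ∃ x, Below par x w ∧ G.Adj u x := by
  induction h with
  | mk S r hr c hpar hrec ih =>
    have hbelow : ∀ x ∈ S, Below par x r := by
      intro x hx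
      by_cases hxr : x = r
      · rw [hxr]; exact Below.refl par r
      obtain ⟨K, hK, hxK⟩ := exists_isComponent (G := G) (show x ∈ S \ {r} from ⟨hx, hxr⟩)
      exact ((ih K hK hK.prop.2).1 x hxK).tail (hpar K hK)
    refine ⟨hbelow, ?_, ?_⟩
    · intro x hx y hy ha
      by_cases hxr : x = r
      · rw [hxr]; exact Or.inr (hbelow y hy)
      by_cases hyr : y = r
      · rw [hyr]; exact Or.inl (hbelow x hx)
      obtain ⟨K, hK, hxK⟩ := exists_isComponent (G := G) (show x ∈ S \ {r} from ⟨hx, hxr⟩)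
      exact (ih K hK hK.prop.2).2.1 x hxK y (hK.mem_of_adj hxK ⟨hy, hyr⟩ ha) ha
    · intro w hw hwr u hu
      obtain ⟨K, hK, hwK⟩ := exists_isComponent (G := G) (show w ∈ S \ {r} from ⟨hw, hwr⟩)
      by_cases hwc : w = c K
      · subst hwc
        rw [hpar K hK] at hu
        cases hu
        -- `G[S]` is connected, so some walk leads from the component `K` to `r`; the vertex at
        -- which it leaves `K` can only be `r`.
        obtain ⟨walk⟩ := hS.preconnected ⟨c K, hw⟩ ⟨r, hr⟩
        obtain ⟨d, _, hd1, hd2⟩ := walk.exists_boundary_dart {z | z.1 ∈ K} hwK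
          (fun h => (hK.prop.1 h).2 rfl)
        have hadj : G.Adj d.fst.1 d.snd.1 := d.adj
        have hdr : d.snd.1 = r := by
          by_contra hne
          exact hd2 (hK.mem_of_adj hd1 ⟨d.snd.2, hne⟩ hadj)
        rw [hdr] at hadj
        exact ⟨d.fst.1, (ih K hK hK.prop.2).1 _ hd1, hadj.symm⟩
      · exact (ih K hK hK.prop.2).2.2 w hwK hwc u hu

theorem ElimForest.isForest [Finite V] (T : ElimForest G) : IsForest G T.parent := by
  have hcomp : ∀ x, ∃ K r, IsComponent G Set.univ K ∧ x ∈ K ∧ T.parent r = none ∧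
      IsElimTree G T.parent K r := by
    intro x
    obtain ⟨K, hK, hx⟩ := exists_isComponent (G := G) (Set.mem_univ x)
    obtain ⟨r, hr, h⟩ := T.isElim K hK
    exact ⟨K, r, hK, hx, hr, h⟩
  refine ⟨?_, ?_, ?_⟩
  · intro x y hxy hyx
    obtain ⟨K, r, hK, hxK, hr, h⟩ := hcomp x
    have hxr := (h.spec hK.prop.2).1 x hxK
    clear hxK
    -- If `x` lies on a cycle, so does its parent, and therefore every vertex on the way to the
    -- root; but the root has no parent.
    induction hxr using Relation.ReflTransGen.head_induction_on generalizing y with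
    | refl => rw [hr] at hxy; cases hxy
    | @head a b hab _ ih =>
      rw [hab] at hxy
      cases hxy
      by_cases hba : b = a
      · exact ih b (by rw [← hba] at hab; exact hab) (Below.refl _ b)
      · obtain ⟨z, hz, hza⟩ := hyx.exists_parent hba
        exact ih z hz (hza.tail hab)
  · intro x y ha
    obtain ⟨K, r, hK, hxK, hr, h⟩ := hcomp x
    exact (h.spec hK.prop.2).2.1 x hxK y (hK.mem_of_adj hxK (Set.mem_univ y) ha) ha
  · intro w u hu
    obtain ⟨K, r, hK, hwK, hr, h⟩ := hcomp w
    refine (h.spec hK.prop.2).2.2 w hwK ?_ u hu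
    rintro rfl
    rw [hr] at hu
    cases hu

theorem rotDist_le_iff {T T' : ElimForest G} {k : ℕ} :
    rotDist T T' ≤ k ↔ ∃ ℓ ≤ k, RotSeq G ℓ T.parent T'.parent := by
  constructor
  · intro h
    by_cases hne : {d : ℕ∞ | ∃ ℓ : ℕ, d = ℓ ∧ RotSeq G ℓ T.parent T'.parent}.Nonempty
    · obtain ⟨ℓ, h1, h2⟩ := csInf_mem hne
      refine ⟨ℓ, ?_, h2⟩
      have : rotDist T T' = ℓ := h1
      rw [this] at h
      exact_mod_cast h
    · rw [Set.not_nonempty_iff_eq_empty] at hne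
      rw [rotDist, hne, sInf_empty] at h
      exact absurd h (by simp)
  · rintro ⟨ℓ, h1, h2⟩
    have h3 : rotDist T T' ≤ ℓ := sInf_le ⟨ℓ, rfl, h2⟩
    exact h3.trans (by exact_mod_cast h1)

end ElimForests

end RotDist

namespace RotDist

/-! ### A program logic for word RAM programs with time bounds. -/

section Machine

/-- The state with the number `m` in register `x`. -/
def State.setReg (s : State) (x m : ℕ) : State := { s with reg := Function.update s.reg x m }

/-- The state with the number `m` in cell `y` of array `A`. -/
def State.setArr (s : State) (A y m : ℕ) : State :=
  { s with arr := Function.update s.arr A (Function.update (s.arr A) y m) }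

@[simp] theorem State.setReg_reg (s : State) (x m y : ℕ) :
    (s.setReg x m).reg y = if y = x then m else s.reg y := by
  simp [State.setReg, Function.update_apply]

@[simp] theorem State.setReg_arr (s : State) (x m : ℕ) : (s.setReg x m).arr = s.arr := rfl

@[simp] theorem State.setArr_reg (s : State) (A y m : ℕ) : (s.setArr A y m).reg = s.reg := rfl

@[simp] theorem State.setArr_arr (s : State) (A y m B : ℕ) :
    (s.setArr A y m).arr B = if B = A then Function.update (s.arr A) y m else s.arr B := by
  simp only [State.setArr, Function.update_apply]

/-- The program `P`, started in `s`, halts, and the final state and the number of steps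
satisfy `Q`. -/
def Runs (W : ℕ) (P : Prog) (s : State) (Q : State → ℕ → Prop) : Prop :=
  ∃ t s', Exec W P s t s' ∧ Q s' t

variable {W : ℕ} {P P' : Prog} {s : State} {Q Q' : State → ℕ → Prop}

theorem Runs.mono (h : Runs W P s Q) (hQ : ∀ s' t, Q s' t → Q' s' t) : Runs W P s Q' := by
  obtain ⟨t, s', h1, h2⟩ := h
  exact ⟨t, s', h1, hQ s' t h2⟩

-- This rule and the following ones turn a claim about a run into a claim about the start state, so
-- that `simp` executes straight-line code symbolically.
@[simp] theorem runs_const {x m : ℕ} :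
    Runs W (.instr (.const x m)) s Q ↔ m < W ∧ Q (s.setReg x m) 1 := by
  constructor
  · rintro ⟨t, s', h, hQ⟩
    cases h with
    | instr _ _ hlt => exact ⟨hlt, hQ⟩
  · rintro ⟨h, hQ⟩
    exact ⟨1, _, Exec.instr _ s h, hQ⟩

@[simp] theorem runs_op {o : Op} {x y z : ℕ} :
    Runs W (.instr (.op o x y z)) s Q ↔
      o.eval (s.reg y) (s.reg z) < W ∧ Q (s.setReg x (o.eval (s.reg y) (s.reg z))) 1 := by
  constructor
  · rintro ⟨t, s', h, hQ⟩
    cases h with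
    | instr _ _ hlt => exact ⟨hlt, hQ⟩
  · rintro ⟨h, hQ⟩
    exact ⟨1, _, Exec.instr _ s h, hQ⟩

@[simp] theorem runs_load {x A y : ℕ} :
    Runs W (.instr (.load x A y)) s Q ↔
      s.arr A (s.reg y) < W ∧ Q (s.setReg x (s.arr A (s.reg y))) 1 := by
  constructor
  · rintro ⟨t, s', h, hQ⟩
    cases h with
    | instr _ _ hlt => exact ⟨hlt, hQ⟩
  · rintro ⟨h, hQ⟩
    exact ⟨1, _, Exec.instr _ s h, hQ⟩

@[simp] theorem runs_store {x A y : ℕ} :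
    Runs W (.instr (.store A y x)) s Q ↔
      s.reg x < W ∧ Q (s.setArr A (s.reg y) (s.reg x)) 1 := by
  constructor
  · rintro ⟨t, s', h, hQ⟩
    cases h with
    | instr _ _ hlt => exact ⟨hlt, hQ⟩
  · rintro ⟨h, hQ⟩
    exact ⟨1, _, Exec.instr _ s h, hQ⟩

@[simp] theorem runs_seq :
    Runs W (.seq P P') s Q ↔ Runs W P s (fun s' t => Runs W P' s' (fun s'' t' => Q s'' (t + t'))) := by
  constructor
  · rintro ⟨t, s', h, hQ⟩
    cases h with
    | seq h1 h2 => exact ⟨_, _, h1, _, _, h2, hQ⟩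
  · rintro ⟨t, s', h1, t', s'', h2, hQ⟩
    exact ⟨_, _, Exec.seq h1 h2, hQ⟩

theorem runs_ite {b : Test} :
    Runs W (.ite b P P') s Q ↔ (b.holds s → Runs W P s (fun s' t => Q s' (t + 1))) ∧
      (¬ b.holds s → Runs W P' s (fun s' t => Q s' (t + 1))) := by
  constructor
  · rintro ⟨t, s', h, hQ⟩
    cases h with
    | ite_true hb h => exact ⟨fun _ => ⟨_, _, h, hQ⟩, fun h' => absurd hb h'⟩
    | ite_false hb h => exact ⟨fun h' => absurd h' hb, fun _ => ⟨_, _, h, hQ⟩⟩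
  · rintro ⟨h1, h2⟩
    by_cases hb : b.holds s
    · obtain ⟨t, s', h, hQ⟩ := h1 hb
      exact ⟨_, _, Exec.ite_true hb h, hQ⟩
    · obtain ⟨t, s', h, hQ⟩ := h2 hb
      exact ⟨_, _, Exec.ite_false hb h, hQ⟩

@[simp] theorem Test.holds_lt {x y : ℕ} : (Test.lt x y).holds s ↔ s.reg x < s.reg y := Iff.rfl

@[simp] theorem Test.holds_eq {x y : ℕ} : (Test.eq x y).holds s ↔ s.reg x = s.reg y := Iff.rfl

attribute [simp] Op.eval

/-- While loops, with an invariant that mentions the time spent so far. -/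
theorem runs_while {b : Test} (I : State → ℕ → Prop) (μ : State → ℕ)
    (h0 : I s 0) (hbody : ∀ s t, I s t → b.holds s →
      Runs W P s (fun s' t' => I s' (t + t' + 1) ∧ μ s' < μ s))
    (hend : ∀ s t, I s t → ¬ b.holds s → Q s (t + 1)) : Runs W (.while b P) s Q := by
  have key : ∀ m s t, μ s < m → I s t →
      Runs W (.while b P) s (fun s' t' => Q s' (t + t')) := by
    intro m
    induction m with
    | zero => intro s t h; omega
    | succ m ih =>
      intro s t hm hI
      by_cases hb : b.holds s
      · obtain ⟨t', s', h1, h2, h3⟩ := hbody s t hI hb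
        obtain ⟨t'', s'', h4, h5⟩ := ih s' (t + t' + 1) (by omega) h2
        refine ⟨t' + t'' + 1, s'', Exec.while_true hb h1 h4, ?_⟩
        have : t + (t' + t'' + 1) = t + t' + 1 + t'' := by omega
        simpa only [this] using h5
      · exact ⟨1, s, Exec.while_false hb, hend s t hI hb⟩
  obtain ⟨t, s', h1, h2⟩ := key _ s 0 (Nat.lt_succ_self _) h0
  exact ⟨t, s', h1, by simpa using h2⟩

/-- `P₁; P₂; …`. -/
def seqs : List Prog → Prog
  | [] => .instr (.const 99 0)
  | [P] => P
  | P :: P' :: L => .seq P (seqs (P' :: L))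

@[simp] theorem runs_seqs_singleton : Runs W (seqs [P]) s Q ↔ Runs W P s Q := Iff.rfl

@[simp] theorem runs_seqs_cons {L : List Prog} : Runs W (seqs (P :: P' :: L)) s Q ↔
    Runs W P s (fun s' t => Runs W (seqs (P' :: L)) s' (fun s'' t' => Q s'' (t + t'))) :=
  runs_seq

/-- `x := m`. -/
abbrev Prog.const (x m : ℕ) : Prog := .instr (.const x m)

/-- `x := y + z`. -/
abbrev Prog.plus (x y z : ℕ) : Prog := .instr (.op .add x y z)

/-- `x := y - z`. -/
abbrev Prog.minus (x y z : ℕ) : Prog := .instr (.op .sub x y z)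

/-- `x := y * z`. -/
abbrev Prog.times (x y z : ℕ) : Prog := .instr (.op .mul x y z)

/-- `x := y / z`. -/
abbrev Prog.divide (x y z : ℕ) : Prog := .instr (.op .div x y z)

/-- `x := A[y]`. -/
abbrev Prog.load (x A y : ℕ) : Prog := .instr (.load x A y)

/-- `A[y] := x`. -/
abbrev Prog.store (A y x : ℕ) : Prog := .instr (.store A y x)

/-- An instruction without effect on the registers and arrays in use. -/
def skip : Prog := .instr (.const 99 0)

theorem runs_skip : Runs W skip s Q ↔ 0 < W ∧ Q (s.setReg 99 0) 1 := runs_const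

/-- `for i := 0 to reg b - 1 do P`, if register `2` holds `1`. -/
def forLoop (i b : ℕ) (P : Prog) : Prog :=
  .seq (.instr (.const i 0)) (.while (.lt i b) (.seq P (.instr (.op .add i i 2))))

/-- For loops, with a potential to amortize the time. -/
theorem runs_forLoop_potential {i b N B : ℕ} (I : ℕ → State → Prop) (Φ : State → ℕ)
    (hN : N < W) (h0 : I 0 (s.setReg i 0))
    (hI : ∀ j s, I j s → s.reg b = N ∧ s.reg 2 = 1)
    (hbody : ∀ j s, j < N → I j s → s.reg i = j → Runs W P s (fun s' t =>
      t + Φ (s'.setReg i (j + 1)) ≤ B + Φ s ∧ s'.reg i = j ∧ s'.reg 2 = 1 ∧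
        I (j + 1) (s'.setReg i (j + 1)))) :
    Runs W (forLoop i b P) s (fun s' t =>
      t + Φ s' ≤ N * (B + 2) + 2 + Φ (s.setReg i 0) ∧ s'.reg i = N ∧ I N s') := by
  rw [forLoop, runs_seq, runs_const]
  refine ⟨by omega, ?_⟩
  -- Each iteration costs two steps besides the body, the test and the increment. The final summand
  -- 2 stands for the initialization and the last test.
  refine runs_while (fun s' t => ∃ j, s'.reg i = j ∧ j ≤ N ∧ I j s' ∧
    t + Φ s' ≤ j * (B + 2) + Φ (s.setReg i 0)) (fun s' => N - s'.reg i) ?_ ?_ ?_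
  · exact ⟨0, by simp, Nat.zero_le _, h0, by simp⟩
  · rintro s' t ⟨j, hj, hjN, hIj, ht⟩ hb
    rw [Test.holds_lt, hj, (hI j s' hIj).1] at hb
    rw [runs_seq]
    refine (hbody j s' hb hIj hj).mono ?_
    rintro s'' t' ⟨h1, h2, h3, h4⟩
    rw [runs_op]
    simp only [Op.eval, h2, h3]
    refine ⟨by omega, ⟨j + 1, by simp, hb, h4, ?_⟩, ?_⟩
    · have : (j + 1) * (B + 2) = j * (B + 2) + B + 2 := by ring
      omega
    · simp [hj]; omega
  · rintro s' t ⟨j, hj, hjN, hIj, ht⟩ hb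
    rw [Test.holds_lt, hj, (hI j s' hIj).1] at hb
    have : j = N := by omega
    subst this
    exact ⟨by omega, hj, hIj⟩

theorem runs_forLoop {i b N B : ℕ} (I : ℕ → State → Prop)
    (hN : N < W) (h0 : I 0 (s.setReg i 0))
    (hI : ∀ j s, I j s → s.reg b = N ∧ s.reg 2 = 1)
    (hbody : ∀ j s, j < N → I j s → s.reg i = j → Runs W P s (fun s' t =>
      t ≤ B ∧ s'.reg i = j ∧ s'.reg 2 = 1 ∧ I (j + 1) (s'.setReg i (j + 1)))) :
    Runs W (forLoop i b P) s (fun s' t => t ≤ N * (B + 2) + 2 ∧ s'.reg i = N ∧ I N s') := by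
  refine (runs_forLoop_potential I (fun _ => 0) hN h0 hI (B := B) ?_).mono (fun _ _ h => h)
  intro j s hj hIj hi
  exact (hbody j s hj hIj hi).mono (fun s' t h => ⟨by simpa using h.1, h.2⟩)

end Machine

/-! ### Correctness of the encoding of forests and graphs. -/

section Codes

variable {n : ℕ} {G : SimpleGraph (Fin n)} {p q : Fin n → Option (Fin n)}

theorem parentCode_of_none {i : Fin n} (h : p i = none) : parentCode p i = 0 := by
  simp [parentCode, h]

theorem parentCode_of_some {i j : Fin n} (h : p i = some j) : parentCode p i = j + 1 := by
  simp [parentCode, h]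

theorem parentCode_le (p : Fin n → Option (Fin n)) (i : ℕ) : parentCode p i ≤ n := by
  by_cases h : i < n
  · rcases hp : p ⟨i, h⟩ with _ | j
    · exact (parentCode_of_none hp).trans_le (Nat.zero_le _)
    · exact (parentCode_of_some hp).trans_le j.2
  · simp [parentCode, h]

theorem parentCode_eq_succ_iff {i j : Fin n} : parentCode p i = j + 1 ↔ p i = some j := by
  rcases hp : p i with _ | l
  · simp [parentCode_of_none hp]
  · rw [parentCode_of_some hp]
    simp [Fin.ext_iff]

theorem parentCode_inj (h : ∀ i < n, parentCode p i = parentCode q i) : p = q := by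
  funext i
  apply Option.ext
  intro j
  rw [← parentCode_eq_succ_iff, ← parentCode_eq_succ_iff, h i i.2]

theorem matrixCode_eq_one_iff {i j : Fin n} : matrixCode G (i * n + j) = 1 ↔ G.Adj i j := by
  have hn : 0 < n := i.pos
  have h : (∃ i' j' : Fin n, (i : ℕ) * n + j = i' * n + j' ∧ G.Adj i' j') ↔ G.Adj i j := by
    constructor
    · rintro ⟨i', j', h, ha⟩
      have h1 : (i : ℕ) = i' := by
        have := congrArg (· / n) h
        simpa [Nat.add_div_of_dvd_right, Nat.mul_add_div hn, mul_comm _ n,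
          Nat.div_eq_of_lt j.2, Nat.div_eq_of_lt j'.2] using this
      have h2 : (j : ℕ) = j' := by rw [h1] at h; omega
      rw [Fin.ext h1, Fin.ext h2]
      exact ha
    · exact fun ha => ⟨i, j, rfl, ha⟩
  simp [matrixCode, h]

theorem matrixCode_le (G : SimpleGraph (Fin n)) (m : ℕ) : matrixCode G m ≤ 1 := by
  unfold matrixCode
  split_ifs <;> simp

end Codes

end RotDist

namespace RotDist

/-! ### Finding all subtrees adjacent to a vertex in linear time. -/

section Flags

/-- For the vertex `a` in register `29`, sets cell `w + 1` of array `4` to `1` if `a` is adjacent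
to the subtree of `w` in the forest stored in array `A`, and to `0` otherwise: from every
neighbour of `a`, walk upwards until a flag is met. -/
def flags (A : ℕ) : Prog := seqs
  [forLoop 30 0 (seqs [.plus 31 30 2, .store 4 31 3]),
   .store 4 3 2,
   forLoop 30 0 (seqs
    [.times 31 29 0, .plus 31 31 30, .load 31 0 31,
     .ite (.eq 31 2)
      (seqs [.plus 32 30 2, .load 33 4 32,
        .while (.lt 33 2)
          (seqs [.store 4 32 2, .minus 31 32 2, .load 32 A 31, .load 33 4 32])])
      skip])]

variable {n W : ℕ} {G : SimpleGraph (Fin n)} {p : Fin n → Option (Fin n)} {s : State}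

/-- `a` is adjacent to the subtree of `w`. -/
def AdjSubtree (G : SimpleGraph (Fin n)) (p : Fin n → Option (Fin n)) (a w : Fin n) : Prop :=
  ∃ x, Below p x w ∧ G.Adj a x

/-- The array `F` stores the parent function `p`. -/
def Stores (F : ℕ → ℕ) (p : Fin n → Option (Fin n)) : Prop := ∀ i < n, F i = parentCode p i

/-- The situation while flags are set: only correct flags are set, and flagged vertices have
flagged parents, except for those with the parent code `y`. -/
structure FlagInv (G : SimpleGraph (Fin n)) (p : Fin n → Option (Fin n)) (a : Fin n)
    (F : ℕ → ℕ) (y j : ℕ) : Prop where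
  zero : F 0 = 1
  le : ∀ i ≤ n, F i ≤ 1
  sound : ∀ w : Fin n, F (w + 1) = 1 → AdjSubtree G p a w
  closed : ∀ w : Fin n, F (w + 1) = 1 → F (parentCode p w) = 1 ∨ parentCode p w = y
  started : ∀ x : Fin n, (x : ℕ) < j → G.Adj a x → F (x + 1) = 1 ∨ (x : ℕ) + 1 = y

/-- The number of vertices without a flag. -/
def unflagged (n : ℕ) (F : ℕ → ℕ) : ℕ := ((Finset.range (n + 1)).filter (fun i => F i = 0)).card

theorem unflagged_update {F : ℕ → ℕ} {y : ℕ} (hy : y ≤ n) (hF : F y = 0) :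
    unflagged n (Function.update F y 1) + 1 = unflagged n F := by
  unfold unflagged
  have h : (Finset.range (n + 1)).filter (fun i => Function.update F y 1 i = 0) =
      ((Finset.range (n + 1)).filter (fun i => F i = 0)).erase y := by
    ext i
    by_cases hi : i = y
    · subst hi; simp
    · simp [hi]
  rw [h, Finset.card_erase_add_one]
  simp [hF]
  omega

theorem unflagged_le (n : ℕ) (F : ℕ → ℕ) : unflagged n F ≤ n + 1 :=
  (Finset.card_filter_le _ _).trans (by simp)

/-- The flag is set in cell `y`, and the cell of the parent becomes the only pending one. Cell `0`
always has a flag, so `y - 1` is a genuine vertex here. -/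
theorem FlagInv.step {a : Fin n} {F : ℕ → ℕ} {y j : ℕ} (h : FlagInv G p a F y j) (hy : y ≤ n)
    (hF : F y < 1) (hs : ∀ w : Fin n, y = w + 1 → AdjSubtree G p a w) :
    FlagInv G p a (Function.update F y 1) (parentCode p (y - 1)) j := by
  have hy0 : y ≠ 0 := by
    rintro rfl
    rw [h.zero] at hF
    omega
  have hmono : ∀ i, F i = 1 → Function.update F y 1 i = 1 := by
    intro i hi
    by_cases hiy : i = y
    · subst hiy; simp
    · simp [hiy, hi]
  refine ⟨hmono 0 h.zero, ?_, ?_, ?_, ?_⟩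
  · intro i hi
    by_cases hiy : i = y
    · subst hiy; simp
    · simpa [hiy] using h.le i hi
  · intro w hw
    by_cases hwy : (w : ℕ) + 1 = y
    · exact hs w hwy.symm
    · rw [Function.update_of_ne hwy] at hw
      exact h.sound w hw
  · intro w hw
    by_cases hwy : (w : ℕ) + 1 = y
    · right
      rw [← hwy]
      simp
    · rw [Function.update_of_ne hwy] at hw
      rcases h.closed w hw with h' | h'
      · exact Or.inl (hmono _ h')
      · left
        rw [h']
        simp
  · intro x hx ha
    rcases h.started x hx ha with h' | h'
    · exact Or.inl (hmono _ h')
    · left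
      rw [h']
      simp

/-- If no cell of a vertex is pending, flags pass from the neighbours of `a` to all their ancestors.
-/
theorem FlagInv.eq_one_iff {a : Fin n} {F : ℕ → ℕ} (h : FlagInv G p a F 0 n) (w : Fin n) :
    F (w + 1) = 1 ↔ AdjSubtree G p a w := by
  refine ⟨h.sound w, ?_⟩
  rintro ⟨x, hx, ha⟩
  have h1 : F (x + 1) = 1 := (h.started x x.2 ha).resolve_right (by omega)
  clear ha
  induction hx using Relation.ReflTransGen.head_induction_on with
  | refl => exact h1
  | @head b c hbc _ ih =>
    have h2 := h.closed b h1
    rw [parentCode_of_some hbc] at h2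
    exact ih (h2.resolve_right (by omega))

theorem FlagInv.of_one {a : Fin n} {F : ℕ → ℕ} {y j : ℕ} (h : FlagInv G p a F y j)
    (hy : F y = 1) : FlagInv G p a F 0 j := by
  refine ⟨h.zero, h.le, h.sound, ?_, ?_⟩
  · intro w hw
    rcases h.closed w hw with h' | h'
    · exact Or.inl h'
    · exact Or.inl (h' ▸ hy)
  · intro x hx ha
    rcases h.started x hx ha with h' | h'
    · exact Or.inl h'
    · exact Or.inl (h' ▸ hy)

/-- Every step of an upward walk sets a flag that was not set before, so all walks together, and not
just each single one, take linear time. -/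
theorem runs_flags {A : ℕ} {a : Fin n} (hA : A ≠ 4) (hW : n * n + n + 1 < W)
    (h0 : s.reg 0 = n) (h2 : s.reg 2 = 1) (h3 : s.reg 3 = 0) (ha : s.reg 29 = a)
    (hG : s.arr 0 = matrixCode G) (hp : Stores (s.arr A) p) :
    Runs W (flags A) s (fun s' t => t ≤ 40 * n + 40 ∧ (∀ x < 30, s'.reg x = s.reg x) ∧
      (∀ B, B ≠ 4 → s'.arr B = s.arr B) ∧
      ∀ w : Fin n, s'.arr 4 (w + 1) ≤ 1 ∧ (s'.arr 4 (w + 1) = 1 ↔ AdjSubtree G p a w)) := by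
  have han : (a : ℕ) * n + n ≤ n * n := by
    have : ((a : ℕ) + 1) * n ≤ n * n := Nat.mul_le_mul_right n a.2
    rw [Nat.succ_mul] at this
    exact this
  rw [flags, runs_seqs_cons]
  refine (runs_forLoop (N := n) (B := 2) (fun j s' => (∀ x < 30, s'.reg x = s.reg x) ∧
      (∀ B, B ≠ 4 → s'.arr B = s.arr B) ∧ ∀ i < j, s'.arr 4 (i + 1) = 0)
    (by omega) ?_ ?_ ?_).mono ?_
  · refine ⟨fun x hx => ?_, fun B hB => rfl, by simp⟩
    have : x ≠ 30 := by omega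
    simp [this]
  · rintro j s' ⟨h, _⟩
    rw [h 0 (by omega), h 2 (by omega)]
    exact ⟨h0, h2⟩
  · rintro j s' hj ⟨g1, g2, g3⟩ hi
    have e2 := (g1 2 (by omega)).trans h2
    have e3 := (g1 3 (by omega)).trans h3
    simp [hi, e2, e3]
    refine ⟨by omega, by omega, fun x hx => ?_, fun B hB => ?_, fun i hij => ?_⟩
    · have h1 : x ≠ 30 := by omega
      have h2 : x ≠ 31 := by omega
      simp [h1, h2, g1 x hx]
    · simp [hB, g2 B hB]
    · by_cases hij' : i = j
      · subst hij'; simp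
      · simp [hij', g3 i (by omega)]
  rintro s₁ t₁ ⟨ht₁, -, g1, g2, g3⟩
  have e2 := (g1 2 (by omega)).trans h2
  have e3 := (g1 3 (by omega)).trans h3
  rw [runs_seqs_cons, runs_store, e2, e3]
  refine ⟨by omega, ?_⟩
  -- Cell `0` belongs to the parent code of roots. Its flag is a sentinel that stops every walk.
  set s₂ := s₁.setArr 4 0 1 with hs₂
  have hF0 : FlagInv G p a (s₂.arr 4) 0 0 := by
    have hz : ∀ i ≤ n, s₂.arr 4 i = if i = 0 then 1 else 0 := by
      intro i hi
      rcases i with _ | i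
      · simp [hs₂]
      · simp [hs₂, g3 i (by omega)]
    refine ⟨by simp [hs₂], ?_, ?_, ?_, by simp⟩
    · intro i hi
      rw [hz i hi]
      split_ifs <;> omega
    · intro w hw
      rw [hz _ w.2] at hw
      simp at hw
    · intro w hw
      rw [hz _ w.2] at hw
      simp at hw
  rw [runs_seqs_singleton]
  -- A pass of the inner loop takes four instructions and one test, paid for by the drop of the
  -- potential by five when a flag is set.
  refine (runs_forLoop_potential (N := n) (B := 8) (fun j s' => (∀ x < 30, s'.reg x = s.reg x) ∧
      (∀ B, B ≠ 4 → s'.arr B = s.arr B) ∧ FlagInv G p a (s'.arr 4) 0 j)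
      (fun s' => 5 * unflagged n (s'.arr 4)) (by omega) ?_ ?_ ?_).mono ?_
  · refine ⟨fun x hx => ?_, fun B hB => ?_, hF0⟩
    · have : x ≠ 30 := by omega
      simp [this, hs₂, g1 x hx]
    · simp [hs₂, hB, g2 B hB]
  · rintro j s' ⟨h, _⟩
    rw [h 0 (by omega), h 2 (by omega)]
    exact ⟨h0, h2⟩
  · rintro j s' hj ⟨k1, k2, k3⟩ hi
    have f0 := (k1 0 (by omega)).trans h0
    have f2 := (k1 2 (by omega)).trans h2
    have fa := (k1 29 (by omega)).trans ha
    have fG := (k2 0 (by omega)).trans hG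
    have hm := matrixCode_le G (a * n + j)
    simp [hi, f0, fa, fG, f2, runs_ite]
    refine ⟨by omega, by omega, by omega, ?_, ?_⟩
    · intro hadj
      have hadj' : G.Adj a ⟨j, hj⟩ := (matrixCode_eq_one_iff (j := ⟨j, hj⟩)).1 hadj
      refine ⟨by omega, lt_of_le_of_lt (k3.le (j + 1) hj) (by omega), ?_⟩
      refine runs_while (fun s'' t => ∃ y ≤ n, s''.reg 32 = y ∧ s''.reg 33 = s''.arr 4 y ∧
          s''.reg 30 = j ∧ (∀ x < 30, s''.reg x = s.reg x) ∧
          (∀ B, B ≠ 4 → s''.arr B = s.arr B) ∧ FlagInv G p a (s''.arr 4) y (j + 1) ∧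
          (∀ w : Fin n, y = w + 1 → AdjSubtree G p a w) ∧
          t + 5 * unflagged n (s''.arr 4) ≤ 5 * unflagged n (s'.arr 4))
          (fun s'' => unflagged n (s''.arr 4)) ?_ ?_ ?_
      · refine ⟨j + 1, hj, by simp, by simp, by simp [hi], fun x hx => ?_, ?_, ?_, ?_, by simp⟩
        · have h1 : x ≠ 31 := by omega
          have h2 : x ≠ 32 := by omega
          have h3 : x ≠ 33 := by omega
          simp [h1, h2, h3, k1 x hx]
        · simpa using k2
        · refine ⟨k3.zero, k3.le, k3.sound, ?_, ?_⟩
          · intro w hw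
            rcases k3.closed w hw with h | h
            · exact Or.inl h
            · left
              rw [h]
              exact k3.zero
          · intro x hx hax
            by_cases hxj : (x : ℕ) = j
            · right; omega
            · left
              exact (k3.started x (by omega) hax).resolve_right (by omega)
        · intro w hw
          have : w = ⟨j, hj⟩ := Fin.ext (by simp; omega)
          exact ⟨w, Below.refl p w, this ▸ hadj'⟩
      · rintro s'' t ⟨y, hy, l1, l2, l3, l4, l5, l6, l7, l8⟩ hb
        have m2 := (l4 2 (by omega)).trans h2
        rw [Test.holds_lt, l2, m2] at hb
        have hy0 : y ≠ 0 := by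
          rintro rfl
          rw [l6.zero] at hb
          omega
        have hpy : s''.arr A (y - 1) = parentCode p (y - 1) := by
          rw [l5 A hA, hp _ (by omega)]
        have hstep := l6.step hy hb l7
        have hle := parentCode_le p (y - 1)
        have hun := unflagged_update hy (show s''.arr 4 y = 0 by omega)
        simp [l1, m2, hA, hpy]
        refine ⟨by omega, by omega, by omega,
          lt_of_le_of_lt (hstep.le _ hle) (by omega), ⟨hle, l3,
          fun x hx => ?_, fun B hB => ?_, hstep, ?_, by omega⟩, by omega⟩
        · have h1 : x ≠ 31 := by omega
          have h2 : x ≠ 32 := by omega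
          have h3 : x ≠ 33 := by omega
          simp [h1, h2, h3, l4 x hx]
        · simp [hB, l5 B hB]
        · intro w hw
          have hyn : y - 1 < n := by omega
          have hpw : p ⟨y - 1, hyn⟩ = some w := parentCode_eq_succ_iff.1 hw
          obtain ⟨x, hx, hax⟩ := l7 ⟨y - 1, hyn⟩ (by simp; omega)
          exact ⟨x, hx.tail hpw, hax⟩
      · rintro s'' t ⟨y, hy, l1, l2, l3, l4, l5, l6, l7, l8⟩ hb
        have m2 := (l4 2 (by omega)).trans h2
        rw [Test.holds_lt, l2, m2] at hb
        have hle := l6.le y hy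
        refine ⟨by omega, l3, m2, fun x hx => ?_, l5, l6.of_one (by omega)⟩
        have : x ≠ 30 := by omega
        simp [this, l4 x hx]
    · intro hadj
      rw [runs_skip]
      refine ⟨by omega, by simp, by simp [hi], by simp [f2], fun x hx => ?_, ?_, ?_⟩
      · have h1 : x ≠ 30 := by omega
        have h2 : x ≠ 31 := by omega
        have h3 : x ≠ 99 := by omega
        simp [h1, h2, h3, k1 x hx]
      · simpa using k2
      · refine ⟨k3.zero, k3.le, k3.sound, k3.closed, ?_⟩
        intro x hx hax
        by_cases hxj : (x : ℕ) = j
        · refine absurd ?_ hadj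
          have := (matrixCode_eq_one_iff (G := G)).2 hax
          rwa [hxj] at this
        · exact k3.started x (by omega) hax
  · rintro s₃ t₃ ⟨ht₃, -, k1, k2, k3⟩
    have hun := unflagged_le n (s₂.arr 4)
    simp only [State.setReg_arr] at ht₃
    refine ⟨by omega, k1, k2, fun w => ⟨k3.le _ w.2, k3.eq_one_iff w⟩⟩

end Flags

end RotDist

namespace RotDist

/-! ### Rotations on the machine. -/

section Rotate

/-- Rotates the vertex in register `20` with its parent, if it has one, in the forest stored in
array `3`. -/
def rotate : Prog := seqs
  [.load 21 3 20,
   .ite (.lt 3 21)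
    (seqs
      [.minus 22 21 2, .plus 29 22 3, flags 3, .plus 23 20 2, .load 24 3 22,
       forLoop 25 0 (seqs
        [.load 26 3 25,
         .ite (.eq 26 23)
          (seqs [.plus 27 25 2, .load 27 4 27, .ite (.eq 27 2) (.store 3 25 21) skip])
          skip]),
       .store 3 20 24, .store 3 22 23])
    skip]

variable {n W : ℕ} {G : SimpleGraph (Fin n)} {p : Fin n → Option (Fin n)} {s : State}

/-- The rotation of `v` with its parent, or nothing if `v` is a root. -/
noncomputable def rotStep (G : SimpleGraph (Fin n)) (p : Fin n → Option (Fin n)) (v : Fin n) :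
    Fin n → Option (Fin n) :=
  match p v with
  | none => p
  | some u => rot G p u v

theorem rotStep_of_some {u v : Fin n} (h : p v = some u) : rotStep G p v = rot G p u v := by
  simp [rotStep, h]

theorem rotStep_of_none {v : Fin n} (h : p v = none) : rotStep G p v = p := by
  simp [rotStep, h]

open Classical in
theorem parentCode_rot (u v w : Fin n) : parentCode (rot G p u v) w =
    if w = u then (v : ℕ) + 1 else if w = v then parentCode p u
    else if parentCode p w = v + 1 ∧ AdjSubtree G p u w then (u : ℕ) + 1
    else parentCode p w := by
  have key : ∀ (q : Fin n → Option (Fin n)) (w : Fin n),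
      parentCode q w = match q w with | none => 0 | some j => (j : ℕ) + 1 := by
    intro q w
    rcases h : q w with _ | j <;> simp [parentCode, h]
  simp only [parentCode_eq_succ_iff]
  rw [key]
  simp only [rot]
  split_ifs with h1 h2 h3 h4 h5
  · rfl
  · rw [key]
  · rfl
  · exact absurd ⟨h3.1, h3.2⟩ h4
  · exact absurd ⟨h5.1, h5.2⟩ h3
  · rw [key]

/-- The flags are computed before any parent is changed, and the entries of `u` and `v` are written
after the loop, so that every test refers to the old forest. -/
theorem runs_rotate {v : Fin n} (hW : n * n + n + 1 < W)
    (h0 : s.reg 0 = n) (h2 : s.reg 2 = 1) (h3 : s.reg 3 = 0) (hv : s.reg 20 = v)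
    (hG : s.arr 0 = matrixCode G) (hp : Stores (s.arr 3) p) :
    Runs W rotate s (fun s' t => t ≤ 60 * n + 80 ∧ (∀ x < 21, s'.reg x = s.reg x) ∧
      (∀ B, B ≠ 3 → B ≠ 4 → s'.arr B = s.arr B) ∧ Stores (s'.arr 3) (rotStep G p v)) := by
  have hpv := hp v v.2
  have hle := parentCode_le p v
  rw [rotate, runs_seqs_cons, runs_load, hv, hpv]
  refine ⟨by omega, ?_⟩
  rw [runs_seqs_singleton, runs_ite]
  constructor
  · intro hpos
    simp [h3] at hpos
    obtain ⟨u, hu⟩ : ∃ u, p v = some u := by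
      rcases h : p v with _ | u
      · rw [parentCode_of_none h] at hpos
        omega
      · exact ⟨u, rfl⟩
    have hcode := parentCode_of_some hu
    have hun := u.2
    have hvn := v.2
    simp [h2, h3, hcode]
    refine ⟨by omega, ?_⟩
    refine (runs_flags (A := 3) (a := u) (p := p) (G := G) (by norm_num) hW ?_ ?_ ?_ ?_ ?_ ?_).mono ?_
    · simp [h0]
    · simp [h2]
    · simp [h3]
    · simp
    · simp [hG]
    · simpa using hp
    rintro s₁ t₁ ⟨ht₁, g1, g2, g3⟩
    have e0 : s₁.reg 0 = n := by rw [g1 0 (by norm_num)]; simp [h0]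
    have e2 : s₁.reg 2 = 1 := by rw [g1 2 (by norm_num)]; simp [h2]
    have e20 : s₁.reg 20 = v := by rw [g1 20 (by norm_num)]; simp [hv]
    have e21 : s₁.reg 21 = u + 1 := by rw [g1 21 (by norm_num)]; simp
    have e22 : s₁.reg 22 = u := by rw [g1 22 (by norm_num)]; simp
    have e3 : Stores (s₁.arr 3) p := by rw [g2 3 (by norm_num)]; simpa using hp
    have hpu := parentCode_le p u
    simp [e2, e20, e22, e3 u u.2]
    refine ⟨by omega, by omega, ?_⟩
    refine (runs_forLoop (N := n) (B := 8) (fun j s' =>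
      (∀ x < 25, s'.reg x = ((s₁.setReg 23 (v + 1)).setReg 24 (parentCode p u)).reg x) ∧
      (∀ B, B ≠ 3 → s'.arr B = s₁.arr B) ∧ ∀ i < n, s'.arr 3 i =
        if i < j ∧ parentCode p i = v + 1 ∧ s₁.arr 4 (i + 1) = 1 then (u : ℕ) + 1
        else parentCode p i) (by omega) ?_ ?_ ?_).mono ?_
    · refine ⟨fun x hx => ?_, fun B hB => rfl, fun i hi => ?_⟩
      · have : x ≠ 25 := by omega
        simp [this]
      · simp [e3 i hi]
    · rintro j s' ⟨h, _⟩
      rw [h 0 (by omega), h 2 (by omega)]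
      simp [e0, e2]
    · rintro j s' hj ⟨k1, k2, k3⟩ hi
      have f2 : s'.reg 2 = 1 := by rw [k1 2 (by norm_num)]; simp [e2]
      have f21 : s'.reg 21 = u + 1 := by rw [k1 21 (by norm_num)]; simp [e21]
      have f23 : s'.reg 23 = v + 1 := by rw [k1 23 (by norm_num)]; simp
      have hj3 : s'.arr 3 j = parentCode p j := by rw [k3 j hj]; simp
      have hj4 : s'.arr 4 (j + 1) = s₁.arr 4 (j + 1) := by rw [k2 4 (by norm_num)]
      have hjle := parentCode_le p j
      have hF := (g3 ⟨j, hj⟩).1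
      simp only [] at hF
      simp [hi, hj3, f2, f21, f23, runs_ite, runs_skip, hj4]
      refine ⟨by omega, fun hc => ⟨by omega, by omega, fun hF1 => ⟨by omega, fun x hx => ?_,
        fun B hB => ?_, fun i hin => ?_⟩, fun hF1 => ⟨by omega, fun x hx => ?_,
        fun B hB => ?_, fun i hin => ?_⟩⟩, fun hc => ⟨by omega, fun x hx => ?_,
        fun B hB => ?_, fun i hin => ?_⟩⟩
      · have := k1 x hx
        simp at this
        grind
      · simp [hB, k2 B hB]
      · by_cases hij : i = j
        · subst hij
          simp [hc, hF1]
        · have : i ≤ j ↔ i < j := by omega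
          simp [hij, k3 i hin, this]
      · have := k1 x hx
        simp at this
        grind
      · exact k2 B hB
      · by_cases hij : i = j
        · subst hij
          simp [hc, hF1, k3 i hin]
        · have : i ≤ j ↔ i < j := by omega
          simp [k3 i hin, this]
      · have := k1 x hx
        simp at this
        grind
      · exact k2 B hB
      · by_cases hij : i = j
        · subst hij
          simp [hc, k3 i hin]
        · have : i ≤ j ↔ i < j := by omega
          simp [k3 i hin, this]
    · rintro s₂ t₂ ⟨ht₂, -, k1, k2, k3⟩
      have f20 : s₂.reg 20 = v := by rw [k1 20 (by norm_num)]; simp [e20]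
      have f22 : s₂.reg 22 = u := by rw [k1 22 (by norm_num)]; simp [e22]
      have f23 : s₂.reg 23 = v + 1 := by rw [k1 23 (by norm_num)]; simp
      have f24 : s₂.reg 24 = parentCode p u := by rw [k1 24 (by norm_num)]; simp
      simp [f20, f22, f23, f24]
      refine ⟨by omega, by omega, by omega, fun x hx => ?_, fun B hB hB' => ?_, ?_⟩
      · have h1 := k1 x (by omega)
        have h2 := g1 x (by omega)
        simp at h1 h2
        grind
      · simp [hB, k2 B hB, g2 B hB']
      · intro i hi
        rw [rotStep_of_some hu]
        have hcode' := parentCode_rot (G := G) (p := p) u v ⟨i, hi⟩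
        have h4 := (g3 ⟨i, hi⟩).2
        simp only [] at hcode' h4
        rw [hcode']
        simp only [Function.update_apply, Fin.ext_iff]
        by_cases hiu : i = u
        · simp [hiu]
        by_cases hiv : i = v
        · simp [hiv]
        simp only [hiu, hiv, if_false, k3 i hi]
        by_cases ha : AdjSubtree G p u ⟨i, hi⟩ <;> simp [hi, h4, ha]
  · intro hpos
    simp [h3] at hpos
    have hnone : p v = none := by
      rcases h : p v with _ | u
      · rfl
      · rw [parentCode_of_some h] at hpos
        omega
    rw [runs_skip, rotStep_of_none hnone]
    refine ⟨by omega, by omega, fun x hx => ?_, fun B _ _ => rfl, by simpa using hp⟩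
    simp
    grind

end Rotate

end RotDist

namespace RotDist

/-! ### Codes for the types of subtrees. -/

section Types

/-- Stores in array `6` a code for the type of every vertex with respect to the vertices listed
in array `5`, and in register `10` a bound for the codes. -/
def typeCodes : Prog := seqs
  [forLoop 9 0 (.store 6 9 3), .const 10 1,
   forLoop 11 4 (seqs
    [.load 29 5 11, flags 1,
     forLoop 12 0 (seqs
      [.plus 13 12 2, .load 13 4 13, .times 13 13 10, .load 14 6 12, .plus 13 13 14,
       .store 6 12 13]),
     .plus 10 10 10])]

variable {n W r : ℕ} {G : SimpleGraph (Fin n)} {p : Fin n → Option (Fin n)} {s : State}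

theorem runs_addFlags {N : ℕ} (hW : n + 1 < W) (h0 : s.reg 0 = n) (h2 : s.reg 2 = 1)
    (h10 : s.reg 10 = N) (hN : N + N < W) (hF : ∀ i < n, s.arr 4 (i + 1) ≤ 1)
    (hC : ∀ i < n, s.arr 6 i < N) :
    Runs W (forLoop 12 0 (seqs [.plus 13 12 2, .load 13 4 13, .times 13 13 10, .load 14 6 12,
      .plus 13 13 14, .store 6 12 13])) s (fun s' t => t ≤ 8 * n + 2 ∧
        (∀ x < 12, s'.reg x = s.reg x) ∧ (∀ B, B ≠ 6 → s'.arr B = s.arr B) ∧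
        ∀ i < n, s'.arr 6 i = s.arr 6 i + s.arr 4 (i + 1) * N) := by
  refine (runs_forLoop (N := n) (B := 6) (fun j s' => (∀ x < 12, s'.reg x = s.reg x) ∧
      (∀ B, B ≠ 6 → s'.arr B = s.arr B) ∧ ∀ i < n, s'.arr 6 i =
        if i < j then s.arr 6 i + s.arr 4 (i + 1) * N else s.arr 6 i) (by omega) ?_ ?_ ?_).mono ?_
  · refine ⟨fun x hx => ?_, fun B _ => rfl, by simp⟩
    have : x ≠ 12 := by omega
    simp [this]
  · rintro j s' ⟨h, _⟩
    rw [h 0 (by omega), h 2 (by omega)]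
    exact ⟨h0, h2⟩
  · rintro j s' hj ⟨k1, k2, k3⟩ hi
    have e2 := (k1 2 (by omega)).trans h2
    have e10 := (k1 10 (by omega)).trans h10
    have e4 : s'.arr 4 (j + 1) = s.arr 4 (j + 1) := by rw [k2 4 (by omega)]
    have e6 : s'.arr 6 j = s.arr 6 j := by rw [k3 j hj]; simp
    have hF' := hF j hj
    have hC' := hC j hj
    have hFN : s.arr 4 (j + 1) * N ≤ N := by
      calc _ ≤ 1 * N := Nat.mul_le_mul_right N hF'
        _ = N := one_mul N
    simp [hi, e2, e10, e4, e6]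
    refine ⟨by omega, by omega, by omega, by omega, by omega, fun x hx => ?_, fun B hB => ?_,
      fun i hin => ?_⟩
    · grind
    · simp [hB, k2 B hB]
    · by_cases hij : i = j
      · subst hij
        simp [add_comm]
      · have : i ≤ j ↔ i < j := by omega
        simp [hij, k3 i hin, this]
  · rintro s' t ⟨ht, -, k1, k2, k3⟩
    exact ⟨by omega, k1, k2, fun i hi => by rw [k3 i hi, if_pos hi]⟩

/-- Equal codes mean equal types with respect to the first `j` vertices of the list `F`. -/
structure CodeInv (G : SimpleGraph (Fin n)) (p : Fin n → Option (Fin n)) (F D : ℕ → ℕ) (j : ℕ) :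
    Prop where
  lt : ∀ i < n, D i < 2 ^ j
  inj : ∀ x y : Fin n, D x = D y → ∀ l < j, ∀ a : Fin n, F l = a →
    (AdjSubtree G p a x ↔ AdjSubtree G p a y)

/-- The new flag becomes the binary digit of weight `2 ^ j`. As the earlier codes are smaller than
this, equal codes agree in the new digit and in the earlier part. -/
theorem CodeInv.succ {F D D' E : ℕ → ℕ} {j : ℕ} (h : CodeInv G p F D j) {a : Fin n}
    (ha : F j = a) (hE : ∀ w : Fin n, E (w + 1) ≤ 1 ∧ (E (w + 1) = 1 ↔ AdjSubtree G p a w))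
    (hD : ∀ i < n, D' i = D i + E (i + 1) * 2 ^ j) : CodeInv G p F D' (j + 1) := by
  have hE' : ∀ w : Fin n, E (w + 1) = 0 ∨ E (w + 1) = 1 := by
    intro w
    have := (hE w).1
    omega
  refine ⟨fun i hi => ?_, fun x y hxy l hl b hb => ?_⟩
  · have h1 := h.lt i hi
    rw [hD i hi, pow_succ]
    rcases hE' ⟨i, hi⟩ with h2 | h2 <;> simp only [] at h2 <;> rw [h2] <;> omega
  · rw [hD x x.2, hD y y.2] at hxy
    have h1 := h.lt x x.2
    have h2 := h.lt y y.2
    have h3 : E (x + 1) = E (y + 1) ∧ D x = D y := by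
      rcases hE' x with h3 | h3 <;> rcases hE' y with h4 | h4 <;> rw [h3, h4] at hxy <;>
        rw [h3, h4] <;> constructor <;> omega
    rcases Nat.lt_succ_iff_lt_or_eq.1 hl with hl' | hl'
    · exact h.inj x y h3.2 l hl' b hb
    · subst hl'
      have : a = b := Fin.ext (by omega)
      subst this
      rw [← (hE x).2, ← (hE y).2, h3.1]

theorem runs_typeCodes (hn : 1 ≤ n) (hW : n * n + n + 1 < W) (hr : 2 ^ r < W)
    (h0 : s.reg 0 = n) (h2 : s.reg 2 = 1) (h3 : s.reg 3 = 0) (h4 : s.reg 4 = r)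
    (hG : s.arr 0 = matrixCode G) (hp : Stores (s.arr 1) p) (hL : ∀ j < r, s.arr 5 j < n) :
    Runs W typeCodes s (fun s' t => t ≤ r * (48 * n + 48) + 3 * n + 8 ∧
      (∀ x < 9, s'.reg x = s.reg x) ∧ (∀ B, B ≠ 4 → B ≠ 6 → s'.arr B = s.arr B) ∧
      s'.reg 10 = 2 ^ r ∧ CodeInv G p (s.arr 5) (s'.arr 6) r) := by
  rw [typeCodes, runs_seqs_cons]
  refine (runs_forLoop (N := n) (B := 1) (fun j s' => (∀ x < 9, s'.reg x = s.reg x) ∧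
      (∀ B, B ≠ 6 → s'.arr B = s.arr B) ∧ ∀ i < j, s'.arr 6 i = 0) (by omega) ?_ ?_ ?_).mono ?_
  · refine ⟨fun x hx => ?_, fun B _ => rfl, by simp⟩
    have : x ≠ 9 := by omega
    simp [this]
  · rintro j s' ⟨h, _⟩
    rw [h 0 (by omega), h 2 (by omega)]
    exact ⟨h0, h2⟩
  · rintro j s' hj ⟨k1, k2, k3⟩ hi
    have e2 := (k1 2 (by omega)).trans h2
    have e3 := (k1 3 (by omega)).trans h3
    simp [hi, e2, e3]
    refine ⟨by omega, fun x hx => ?_, fun B hB => ?_, fun i hij => ?_⟩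
    · grind
    · simp [hB, k2 B hB]
    · by_cases hij' : i = j
      · subst hij'; simp
      · simp [hij', k3 i (by omega)]
  rintro s₁ t₁ ⟨ht₁, -, g1, g2, g3⟩
  rw [runs_seqs_cons, runs_const]
  refine ⟨by omega, ?_⟩
  rw [runs_seqs_singleton]
  have hrW : r < 2 ^ r := Nat.lt_two_pow_self
  refine (runs_forLoop (N := r) (B := 48 * n + 46) (fun j s' => (∀ x < 9, s'.reg x = s.reg x) ∧
      (∀ B, B ≠ 4 → B ≠ 6 → s'.arr B = s.arr B) ∧ s'.reg 10 = 2 ^ j ∧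
      CodeInv G p (s.arr 5) (s'.arr 6) j) (by omega) ?_ ?_ ?_).mono ?_
  · refine ⟨fun x hx => ?_, fun B _ hB => by simp [g2 B hB], by simp, ⟨fun i hi => ?_, ?_⟩⟩
    · have h1 : x ≠ 10 := by omega
      have h2 : x ≠ 11 := by omega
      simp [h1, h2, g1 x hx]
    · simp [g3 i hi]
    · intro x y _ l hl
      omega
  · rintro j s' ⟨h, _⟩
    rw [h 4 (by omega), h 2 (by omega)]
    exact ⟨h4, h2⟩
  · rintro j s' hj ⟨k1, k2, k3, k4⟩ hi
    have e0 := (k1 0 (by omega)).trans h0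
    have e2 := (k1 2 (by omega)).trans h2
    have e3 := (k1 3 (by omega)).trans h3
    have e5 : s'.arr 5 = s.arr 5 := k2 5 (by omega) (by omega)
    have hLj := hL j hj
    have hpow : 2 ^ (j + 1) ≤ 2 ^ r := Nat.pow_le_pow_right (by norm_num) hj
    rw [pow_succ] at hpow
    rw [runs_seqs_cons, runs_load, hi, e5]
    refine ⟨by omega, ?_⟩
    rw [runs_seqs_cons]
    refine (runs_flags (A := 1) (a := ⟨s.arr 5 j, hLj⟩) (p := p) (G := G) (by norm_num) hW
      ?_ ?_ ?_ ?_ ?_ ?_).mono ?_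
    · simp [e0]
    · simp [e2]
    · simp [e3]
    · simp
    · simp [k2 0 (by omega) (by omega), hG]
    · simpa [k2 1 (by omega) (by omega)] using hp
    rintro s₂ t₂ ⟨ht₂, l1, l2, l3⟩
    have f0 : s₂.reg 0 = n := by rw [l1 0 (by omega)]; simp [e0]
    have f2 : s₂.reg 2 = 1 := by rw [l1 2 (by omega)]; simp [e2]
    have f10 : s₂.reg 10 = 2 ^ j := by rw [l1 10 (by omega)]; simp [k3]
    have f11 : s₂.reg 11 = j := by rw [l1 11 (by omega)]; simp [hi]
    have f6 : s₂.arr 6 = s'.arr 6 := by rw [l2 6 (by omega)]; simp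
    rw [runs_seqs_cons]
    refine (runs_addFlags (N := 2 ^ j) (by omega) f0 f2 f10 (by omega)
      (fun i hi => (l3 ⟨i, hi⟩).1) (by rw [f6]; exact k4.lt)).mono ?_
    rintro s₃ t₃ ⟨ht₃, m1, m2, m3⟩
    rw [runs_seqs_singleton, runs_op]
    have m10 := (m1 10 (by omega)).trans f10
    simp only [Op.eval, m10]
    refine ⟨by omega, by omega, ?_, ?_, ?_, ?_, ?_, ?_⟩
    · simp [m1 11 (by omega), f11]
    · simp [m1 2 (by omega), f2]
    · intro x hx
      have h1 := m1 x (by omega)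
      have h2 := l1 x (by omega)
      have h3 := k1 x hx
      simp at h2
      simp
      grind
    · intro B hB4 hB6
      simp [m2 B hB6, l2 B hB4, k2 B hB4 hB6]
    · simp [pow_succ]; omega
    · refine k4.succ (a := ⟨s.arr 5 j, hLj⟩) rfl l3 ?_
      intro i hi'
      simp [m3 i hi', f6]
  · rintro s' t ⟨ht, -, k1, k2, k3, k4⟩
    refine ⟨by nlinarith, k1, k2, k3, k4⟩

end Types

end RotDist

namespace RotDist

/-! ### Extending the list of candidates. -/

section Rounds

/-- Appends the parents of the listed vertices to the list. -/
def appendParents : Prog := seqs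
  [.plus 15 4 3,
   forLoop 11 15 (seqs [.load 16 5 11, .load 16 1 16, .minus 16 16 2, .store 5 4 16, .plus 4 4 2])]

/-- Runs the instruction `P` for all vertices, in register `12`, whose parent code is in register
`16` and whose type code is in register `17`. -/
def forType (P : Prog) : Prog := forLoop 12 0 (seqs
  [.load 13 1 12, .ite (.eq 13 16) (seqs [.load 14 6 12, .ite (.eq 14 17) P skip]) skip])

/-- For every listed vertex, appends its children of rare types to the list. -/
def appendRare : Prog :=
  forLoop 11 15 (seqs
    [.load 16 5 11, .plus 16 16 2,
     forLoop 17 10 (seqs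
      [.const 18 0, forType (.plus 18 18 2),
       .ite (.lt 6 18) skip (forType (.seq (.store 5 4 12) (.plus 4 4 2)))])])

/-- Extends the list of candidates. -/
def round : Prog := seqs [typeCodes, appendParents, appendRare]

variable {n W r r' r'' : ℕ} {G : SimpleGraph (Fin n)} {p : Fin n → Option (Fin n)} {s : State}
  {F F' F'' D : ℕ → ℕ}

/-- `x` occurs in the list of length `r` stored in `F`. -/
def Listed (F : ℕ → ℕ) (r x : ℕ) : Prop := ∃ l < r, F l = x

/-- The second list is a list of vertices that extends the first one. -/
structure Extends (n r : ℕ) (F : ℕ → ℕ) (r' : ℕ) (F' : ℕ → ℕ) : Prop where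
  le : r ≤ r'
  eq : ∀ l < r, F' l = F l
  lt : ∀ l < r', F' l < n

theorem Extends.listed (h : Extends n r F r' F') {x : ℕ} (hx : Listed F r x) :
    Listed F' r' x := by
  obtain ⟨l, hl, rfl⟩ := hx
  exact ⟨l, hl.trans_le h.le, h.eq l hl⟩

theorem Extends.refl (h : ∀ l < r, F l < n) : Extends n r F r F := ⟨le_rfl, fun _ _ => rfl, h⟩

theorem Extends.trans (h : Extends n r F r' F') (h' : Extends n r' F' r'' F'') :
    Extends n r F r'' F'' :=
  ⟨h.le.trans h'.le, fun l hl => (h'.eq l (hl.trans_le h.le)).trans (h.eq l hl), h'.lt⟩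

theorem Extends.append (h : Extends n r F r' F') {x : ℕ} (hx : x < n) :
    Extends n r F (r' + 1) (Function.update F' r' x) := by
  have hle := h.le
  refine ⟨by omega, fun l hl => ?_, fun l hl => ?_⟩
  · rw [Function.update_of_ne (by omega)]
    exact h.eq l hl
  · by_cases hlr : l = r'
    · subst hlr
      simpa using hx
    · rw [Function.update_of_ne hlr]
      exact h.lt l (by omega)

/-- For a root, truncated subtraction yields vertex `0`, which is appended as well. This does no
harm, since supersets and repetitions are allowed, and it makes the length exactly double. -/
theorem runs_appendParents (hn : 1 ≤ n) (hW : 2 * r + n + 1 < W)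
    (h2 : s.reg 2 = 1) (h3 : s.reg 3 = 0) (h4 : s.reg 4 = r)
    (hp : Stores (s.arr 1) p) (hL : ∀ j < r, s.arr 5 j < n) :
    Runs W appendParents s (fun s' t => t ≤ 7 * r + 3 ∧
      (∀ x < 11, x ≠ 4 → s'.reg x = s.reg x) ∧ (∀ B, B ≠ 5 → s'.arr B = s.arr B) ∧
      s'.reg 15 = r ∧ s'.reg 4 = 2 * r ∧ Extends n r (s.arr 5) (2 * r) (s'.arr 5) ∧
      ∀ j < r, Listed (s'.arr 5) (2 * r) (parentCode p (s.arr 5 j) - 1)) := by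
  rw [appendParents, runs_seqs_cons, runs_op]
  simp only [Op.eval, h3, h4]
  refine ⟨by omega, ?_⟩
  rw [runs_seqs_singleton]
  refine (runs_forLoop (N := r) (B := 5) (fun j s' =>
      (∀ x < 11, x ≠ 4 → s'.reg x = s.reg x) ∧ (∀ B, B ≠ 5 → s'.arr B = s.arr B) ∧
      s'.reg 15 = r ∧ s'.reg 4 = r + j ∧ Extends n r (s.arr 5) (r + j) (s'.arr 5) ∧
      ∀ l < j, Listed (s'.arr 5) (r + j) (parentCode p (s.arr 5 l) - 1)) (by omega)
      ?_ ?_ ?_).mono ?_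
  · refine ⟨fun x hx hx4 => ?_, fun B _ => rfl, by simp, by simp [h4], Extends.refl hL, ?_⟩
    · have h1 : x ≠ 11 := by omega
      have h2 : x ≠ 15 := by omega
      simp [h1, h2]
    · intro l hl
      omega
  · rintro j s' ⟨h, _, h', _⟩
    rw [h 2 (by omega) (by omega)]
    exact ⟨h', h2⟩
  · rintro j s' hj ⟨k1, k2, k3, k4, k5, k6⟩ hi
    have e2 := (k1 2 (by omega) (by omega)).trans h2
    have e5 := k5.eq j hj
    have hLj := hL j hj
    have e1 : s'.arr 1 (s.arr 5 j) = parentCode p (s.arr 5 j) := by rw [k2 1 (by omega), hp _ hLj]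
    have hle := parentCode_le p (s.arr 5 j)
    have happ := k5.append (x := parentCode p (s.arr 5 j) - 1) (by omega)
    simp [hi, e2, e5, e1, k4]
    refine ⟨by omega, by omega, by omega, by omega, fun x hx hx4 => ?_, fun B hB => ?_, k3,
      by omega, happ, fun l hl => ?_⟩
    · grind
    · simp [hB, k2 B hB]
    · by_cases hlj : l = j
      · subst hlj
        exact ⟨r + l, by omega, by simp⟩
      · obtain ⟨m, hm, hm'⟩ := k6 l (by omega)
        refine ⟨m, by omega, ?_⟩
        rw [Function.update_of_ne (by omega)]
        exact hm'
  · rintro s' t ⟨ht, -, k1, k2, k3, k4, k5, k6⟩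
    have : r + r = 2 * r := by omega
    rw [this] at k4 k5 k6
    exact ⟨by omega, k1, k2, k3, k4, k5, k6⟩

/-- The number of vertices below `j` with parent code `a` and type code `c`. -/
def typeCount (p : Fin n → Option (Fin n)) (D : ℕ → ℕ) (a c j : ℕ) : ℕ :=
  ((Finset.range j).filter (fun x => parentCode p x = a ∧ D x = c)).card

theorem typeCount_succ (p : Fin n → Option (Fin n)) (D : ℕ → ℕ) (a c j : ℕ) :
    typeCount p D a c (j + 1) =
      typeCount p D a c j + if parentCode p j = a ∧ D j = c then 1 else 0 := by
  unfold typeCount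
  rw [Finset.range_add_one, Finset.filter_insert]
  split_ifs with h
  · rw [Finset.card_insert_of_notMem (by simp)]
  · rfl

theorem typeCount_le (p : Fin n → Option (Fin n)) (D : ℕ → ℕ) (a c j : ℕ) :
    typeCount p D a c j ≤ j :=
  (Finset.card_filter_le _ _).trans (by simp)

theorem typeCount_mono (p : Fin n → Option (Fin n)) (D : ℕ → ℕ) (a c : ℕ) {i j : ℕ} (h : i ≤ j) :
    typeCount p D a c i ≤ typeCount p D a c j :=
  Finset.card_le_card (Finset.filter_subset_filter _ (Finset.range_subset_range.2 h))

/-- A common rule for counting the vertices of a type and for appending them. An invariant has to be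
insensitive to the scratch registers and to vertices with another parent or another code. -/
theorem runs_forType {P : Prog} {a c B : ℕ} (I : ℕ → State → Prop) (hW : n < W)
    (hp : Stores F p) (hD : ∀ i < n, D i < W)
    (h0 : I 0 (s.setReg 12 0))
    (hI : ∀ j s, I j s → s.reg 0 = n ∧ s.reg 2 = 1 ∧ s.reg 16 = a ∧ s.reg 17 = c ∧
      s.arr 1 = F ∧ s.arr 6 = D)
    (hscratch : ∀ j s x m, x = 13 ∨ x = 14 ∨ x = 99 ∨ x = 12 → I j s → I j (s.setReg x m))
    (hother : ∀ j s, j < n → ¬ (parentCode p j = a ∧ D j = c) → I j s → I (j + 1) s)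
    (hbody : ∀ j s, j < n → parentCode p j = a → D j = c → I j s → s.reg 12 = j →
      Runs W P s (fun s' t => t ≤ B ∧ s'.reg 12 = j ∧ I (j + 1) s')) :
    Runs W (forType P) s (fun s' t => t ≤ n * (B + 7) + 2 ∧ I n s') := by
  refine (runs_forLoop (N := n) (B := B + 5) I hW h0 (fun j s h => ?_) ?_).mono ?_
  · exact ⟨(hI j s h).1, (hI j s h).2.1⟩
  · intro j s hj hIj hi
    obtain ⟨e0, e2, e16, e17, e1, e6⟩ := hI j s hIj
    have hle := parentCode_le p j
    have hDj := hD j hj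
    rw [runs_seqs_cons, runs_load, hi, e1, hp j hj]
    refine ⟨by omega, ?_⟩
    rw [runs_seqs_singleton, runs_ite]
    have hI1 := hscratch j s 13 (parentCode p j) (by simp) hIj
    refine ⟨fun hc => ?_, fun hc => ?_⟩
    · simp [e16] at hc
      rw [runs_seqs_cons, runs_load]
      simp only [State.setReg_reg, State.setReg_arr, hi, e6]
      refine ⟨by simpa using hDj, ?_⟩
      rw [runs_seqs_singleton, runs_ite]
      have hI2 := hscratch j _ 14 (D j) (by simp) hI1
      refine ⟨fun hd => ?_, fun hd => ?_⟩
      · simp [e17] at hd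
        refine (hbody j _ hj hc hd (by simpa using hI2) (by simp [hi])).mono ?_
        rintro s' t ⟨h1, h2, h3⟩
        exact ⟨by omega, h2, (hI _ _ h3).2.1, hscratch _ _ _ _ (by simp) h3⟩
      · simp [e17] at hd
        rw [runs_skip]
        refine ⟨by omega, by omega, by simp [hi], by simp [e2], ?_⟩
        have := hother j _ hj (fun h => hd h.2) (hscratch j _ 99 0 (by simp) hI2)
        simpa using hscratch _ _ 12 (j + 1) (by simp) this
    · simp [e16] at hc
      rw [runs_skip]
      refine ⟨by omega, by omega, by simp [hi], by simp [e2], ?_⟩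
      have := hother j _ hj (fun h => hc h.1) (hscratch j _ 99 0 (by simp) hI1)
      simpa using hscratch _ _ 12 (j + 1) (by simp) this
  · rintro s' t ⟨h1, _, h2⟩
    exact ⟨h1, h2⟩

theorem runs_countType {a c : ℕ} (hW : n + 1 < W) (h0 : s.reg 0 = n) (h2 : s.reg 2 = 1)
    (h16 : s.reg 16 = a) (h17 : s.reg 17 = c) (h18 : s.reg 18 = 0) (hp : Stores (s.arr 1) p)
    (hD : ∀ i < n, s.arr 6 i < W) :
    Runs W (forType (.plus 18 18 2)) s (fun s' t => t ≤ 8 * n + 2 ∧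
      (∀ x < 12, s'.reg x = s.reg x) ∧ (∀ x, 15 ≤ x → x ≤ 17 → s'.reg x = s.reg x) ∧
      s'.arr = s.arr ∧ s'.reg 18 = typeCount p (s.arr 6) a c n) := by
  refine (runs_forType (n := n) (p := p) (F := s.arr 1) (D := s.arr 6) (a := a) (c := c) (B := 1)
    (fun j s' => (∀ x < 12, s'.reg x = s.reg x) ∧ (∀ x, 15 ≤ x → x ≤ 17 → s'.reg x = s.reg x) ∧
      s'.arr = s.arr ∧ s'.reg 18 = typeCount p (s.arr 6) a c j)
    (by omega) hp hD ?_ ?_ ?_ ?_ ?_).mono ?_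
  · refine ⟨fun x hx => ?_, fun x hx _ => ?_, rfl, by simp [h18, typeCount]⟩
    · have : x ≠ 12 := by omega
      simp [this]
    · have : x ≠ 12 := by omega
      simp [this]
  · rintro j s' ⟨k1, k2, k3, _⟩
    rw [k1 0 (by omega), k1 2 (by omega), k2 16 (by omega) (by omega),
      k2 17 (by omega) (by omega), k3]
    exact ⟨h0, h2, h16, h17, rfl, rfl⟩
  · rintro j s' x m hx ⟨k1, k2, k3, k4⟩
    refine ⟨fun y hy => ?_, fun y hy hy' => ?_, k3, ?_⟩
    · have : y ≠ x := by omega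
      simp [this, k1 y hy]
    · have : y ≠ x := by omega
      simp [this, k2 y hy hy']
    · have : 18 ≠ x := by omega
      simp [this, k4]
  · rintro j s' _ hne ⟨k1, k2, k3, k4⟩
    exact ⟨k1, k2, k3, by rw [k4, typeCount_succ, if_neg hne]; rfl⟩
  · rintro j s' hj ha hc ⟨k1, k2, k3, k4⟩ hi
    have e2 := (k1 2 (by omega)).trans h2
    have hle := typeCount_le p (s.arr 6) a c j
    rw [runs_op]
    simp only [Op.eval, e2, k4]
    refine ⟨by omega, le_rfl, by simp [hi], fun y hy => ?_, fun y hy hy' => ?_, k3, ?_⟩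
    · have : y ≠ 18 := by omega
      simp [this, k1 y hy]
    · have : y ≠ 18 := by omega
      simp [this, k2 y hy hy']
    · simp [typeCount_succ, ha, hc]
  · rintro s' t ⟨ht, k1, k2, k3, k4⟩
    exact ⟨by omega, k1, k2, k3, k4⟩

theorem runs_appendType {a c : ℕ} (h0 : s.reg 0 = n) (h2 : s.reg 2 = 1)
    (h16 : s.reg 16 = a) (h17 : s.reg 17 = c) (h4 : s.reg 4 = r) (hp : Stores (s.arr 1) p)
    (hD : ∀ i < n, s.arr 6 i < W) (hL : ∀ j < r, s.arr 5 j < n)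
    (hW : r + n + typeCount p (s.arr 6) a c n + 1 < W) :
    Runs W (forType (.seq (.store 5 4 12) (.plus 4 4 2))) s (fun s' t => t ≤ 9 * n + 2 ∧
      (∀ x < 12, x ≠ 4 → s'.reg x = s.reg x) ∧ (∀ x, 15 ≤ x → x ≤ 17 → s'.reg x = s.reg x) ∧
      (∀ B, B ≠ 5 → s'.arr B = s.arr B) ∧ s'.reg 4 = r + typeCount p (s.arr 6) a c n ∧
      Extends n r (s.arr 5) (s'.reg 4) (s'.arr 5) ∧
      ∀ x < n, parentCode p x = a → s.arr 6 x = c → Listed (s'.arr 5) (s'.reg 4) x) := by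
  refine (runs_forType (n := n) (p := p) (F := s.arr 1) (D := s.arr 6) (a := a) (c := c) (B := 2)
    (fun j s' => (∀ x < 12, x ≠ 4 → s'.reg x = s.reg x) ∧
      (∀ x, 15 ≤ x → x ≤ 17 → s'.reg x = s.reg x) ∧
      (∀ B, B ≠ 5 → s'.arr B = s.arr B) ∧ s'.reg 4 = r + typeCount p (s.arr 6) a c j ∧
      Extends n r (s.arr 5) (s'.reg 4) (s'.arr 5) ∧
      ∀ x < j, parentCode p x = a → s.arr 6 x = c → Listed (s'.arr 5) (s'.reg 4) x)
    (by omega) hp hD ?_ ?_ ?_ ?_ ?_).mono ?_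
  · refine ⟨fun x hx _ => ?_, fun x hx _ => ?_, fun B _ => rfl, by simp [h4, typeCount], ?_, ?_⟩
    · have : x ≠ 12 := by omega
      simp [this]
    · have : x ≠ 12 := by omega
      simp [this]
    · simpa [h4] using Extends.refl hL
    · intro x hx
      omega
  · rintro j s' ⟨k1, k2, k3, _⟩
    rw [k1 0 (by omega) (by omega), k1 2 (by omega) (by omega), k2 16 (by omega) (by omega),
      k2 17 (by omega) (by omega), k3 1 (by omega), k3 6 (by omega)]
    exact ⟨h0, h2, h16, h17, rfl, rfl⟩
  · rintro j s' x m hx ⟨k1, k2, k3, k4, k5, k6⟩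
    have h4x : 4 ≠ x := by omega
    refine ⟨fun y hy hy4 => ?_, fun y hy hy' => ?_, k3, by simp [h4x, k4], by simpa [h4x] using k5,
      by simpa [h4x] using k6⟩
    · have : y ≠ x := by omega
      simp [this, k1 y hy hy4]
    · have : y ≠ x := by omega
      simp [this, k2 y hy hy']
  · rintro j s' _ hne ⟨k1, k2, k3, k4, k5, k6⟩
    refine ⟨k1, k2, k3, by rw [k4, typeCount_succ, if_neg hne]; rfl, k5, ?_⟩
    intro x hx ha hc
    by_cases hxj : x = j
    · subst hxj
      exact absurd ⟨ha, hc⟩ hne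
    · exact k6 x (by omega) ha hc
  · rintro j s' hj ha hc ⟨k1, k2, k3, k4, k5, k6⟩ hi
    have e2 := (k1 2 (by omega) (by omega)).trans h2
    have hle := typeCount_mono p (s.arr 6) a c hj.le
    have hcs : typeCount p (s.arr 6) a c (j + 1) = typeCount p (s.arr 6) a c j + 1 := by
      rw [typeCount_succ, if_pos ⟨ha, hc⟩]
    have happ := k5.append hj
    rw [runs_seq, runs_store, hi]
    refine ⟨by omega, ?_⟩
    rw [runs_op]
    simp only [Op.eval, State.setArr_reg, e2]
    refine ⟨by omega, le_rfl, by simp [hi], fun y hy hy4 => ?_, fun y hy hy' => ?_, fun B hB => ?_,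
      by simp [hcs, k4]; omega, by simpa using happ, fun x hx ha' hc' => ?_⟩
    · simp [hy4, k1 y hy hy4]
    · have : y ≠ 4 := by omega
      simp [this, k2 y hy hy']
    · simp [hB, k3 B hB]
    · simp
      by_cases hxj : x = j
      · subst hxj
        exact ⟨s'.reg 4, by omega, by simp⟩
      · obtain ⟨m, hm, hm'⟩ := k6 x (by omega) ha' hc'
        refine ⟨m, by omega, ?_⟩
        rw [Function.update_of_ne (by omega)]
        exact hm'
  · rintro s' t ⟨ht, k1, k2, k3, k4, k5, k6⟩
    exact ⟨by omega, k1, k2, k3, k4, k5, k6⟩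

end Rounds

end RotDist

namespace RotDist

/-! ### One round of the candidate construction. -/

section RoundSpec

variable {n W r K E : ℕ} {G : SimpleGraph (Fin n)} {p q : Fin n → Option (Fin n)} {s : State}

/-- Each of the `E` codes contributes at most `K` children, because a code with more than `K` of
them is skipped. -/
theorem runs_rareChildren {a : ℕ} (h0 : s.reg 0 = n) (h2 : s.reg 2 = 1) (h6 : s.reg 6 = K)
    (h10 : s.reg 10 = E) (h16 : s.reg 16 = a) (h4 : s.reg 4 = r) (hp : Stores (s.arr 1) p)
    (hD : ∀ i < n, s.arr 6 i < E) (hL : ∀ j < r, s.arr 5 j < n)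
    (hW : r + E * K + E + n + 1 < W) :
    Runs W (forLoop 17 10 (seqs
      [.const 18 0, forType (.plus 18 18 2),
       .ite (.lt 6 18) skip (forType (.seq (.store 5 4 12) (.plus 4 4 2)))])) s
      (fun s' t => t ≤ E * (17 * n + 8) + 2 ∧
      (∀ x < 12, x ≠ 4 → s'.reg x = s.reg x) ∧ (∀ x, 15 ≤ x → x ≤ 16 → s'.reg x = s.reg x) ∧
      (∀ B, B ≠ 5 → s'.arr B = s.arr B) ∧ s'.reg 4 ≤ r + E * K ∧
      Extends n r (s.arr 5) (s'.reg 4) (s'.arr 5) ∧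
      ∀ x < n, parentCode p x = a → typeCount p (s.arr 6) a (s.arr 6 x) n ≤ K →
        Listed (s'.arr 5) (s'.reg 4) x) := by
  refine (runs_forLoop (N := E) (B := 17 * n + 6) (fun c s' =>
      (∀ x < 12, x ≠ 4 → s'.reg x = s.reg x) ∧ (∀ x, 15 ≤ x → x ≤ 16 → s'.reg x = s.reg x) ∧
      (∀ B, B ≠ 5 → s'.arr B = s.arr B) ∧ s'.reg 4 ≤ r + c * K ∧
      Extends n r (s.arr 5) (s'.reg 4) (s'.arr 5) ∧
      ∀ x < n, s.arr 6 x < c → parentCode p x = a → typeCount p (s.arr 6) a (s.arr 6 x) n ≤ K →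
        Listed (s'.arr 5) (s'.reg 4) x) (by omega) ?_ ?_ ?_).mono ?_
  · refine ⟨fun x hx _ => ?_, fun x hx _ => ?_, fun B _ => rfl, by simp [h4], ?_, ?_⟩
    · have : x ≠ 17 := by omega
      simp [this]
    · have : x ≠ 17 := by omega
      simp [this]
    · simpa [h4] using Extends.refl hL
    · intro x _ hx
      omega
  · rintro c s' ⟨k1, _⟩
    rw [k1 10 (by omega) (by omega), k1 2 (by omega) (by omega)]
    exact ⟨h10, h2⟩
  · rintro c s' hc ⟨k1, k2, k3, k4, k5, k6⟩ hi
    have hcK : c * K + K ≤ E * K := by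
      have : (c + 1) * K ≤ E * K := Nat.mul_le_mul_right K hc
      rwa [Nat.succ_mul] at this
    have e0 := (k1 0 (by omega) (by omega)).trans h0
    have e2 := (k1 2 (by omega) (by omega)).trans h2
    have e6 := (k1 6 (by omega) (by omega)).trans h6
    have e16 := (k2 16 (by omega) (by omega)).trans h16
    have a1 : s'.arr 1 = s.arr 1 := k3 1 (by omega)
    have a6 : s'.arr 6 = s.arr 6 := k3 6 (by omega)
    rw [runs_seqs_cons, runs_const]
    refine ⟨by omega, ?_⟩
    rw [runs_seqs_cons]
    refine (runs_countType (n := n) (p := p) (a := a) (c := c) (by omega) (by simp [e0])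
      (by simp [e2]) (by simp [e16]) (by simp [hi]) (by simp) (by simpa [a1] using hp) ?_).mono ?_
    · intro i hi
      have := hD i hi
      simp [a6]
      omega
    rintro s₂ t₂ ⟨ht₂, l1, l2, l3, l4⟩
    have f0 : s₂.reg 0 = n := by rw [l1 0 (by omega)]; simp [e0]
    have f2 : s₂.reg 2 = 1 := by rw [l1 2 (by omega)]; simp [e2]
    have f4 : s₂.reg 4 = s'.reg 4 := by rw [l1 4 (by omega)]; simp
    have f6 : s₂.reg 6 = K := by rw [l1 6 (by omega)]; simp [e6]
    have f16 : s₂.reg 16 = a := by rw [l2 16 (by omega) (by omega)]; simp [e16]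
    have f17 : s₂.reg 17 = c := by rw [l2 17 (by omega) (by omega)]; simp [hi]
    have b1 : s₂.arr 1 = s.arr 1 := by rw [l3]; simp [a1]
    have b5 : s₂.arr 5 = s'.arr 5 := by rw [l3]; simp
    have b6 : s₂.arr 6 = s.arr 6 := by rw [l3]; simp [a6]
    simp only [State.setReg_arr, a6] at l4
    rw [runs_seqs_singleton, runs_ite]
    constructor
    · intro hlt
      rw [Test.holds_lt, f6, l4] at hlt
      rw [runs_skip]
      refine ⟨by omega, by omega, by simp [f17], by simp [f2], fun x hx hx4 => ?_,
        fun x hx hx' => ?_, fun B hB => ?_, ?_, ?_, ?_⟩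
      · have h1 := l1 x hx
        have h2 := k1 x hx hx4
        simp at h1
        simp
        grind
      · have h1 := l2 x (by omega) (by omega)
        have h2 := k2 x hx hx'
        simp at h1
        simp
        grind
      · simp [l3, k3 B hB]
      · simp [f4, Nat.succ_mul]
        omega
      · simpa [f4, b5] using k5
      · intro x hx hxc ha hcard
        have : s.arr 6 x ≠ c := by
          intro h
          rw [h] at hcard
          omega
        simpa [f4, b5] using k6 x hx (by omega) ha hcard
    · intro hlt
      rw [Test.holds_lt, f6, l4] at hlt
      refine (runs_appendType (n := n) (p := p) (a := a) (c := c) (r := s'.reg 4) f0 f2 f16 f17 f4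
        (by rw [b1]; exact hp) ?_ ?_ ?_).mono ?_
      · intro i hi
        rw [b6]
        have := hD i hi
        omega
      · rw [b5]
        exact k5.lt
      · rw [b6]
        omega
      rintro s₃ t₃ ⟨ht₃, m1, m2, m3, m4, m5, m6⟩
      rw [b6] at m4
      have hext : Extends n r (s.arr 5) (s₃.reg 4) (s₃.arr 5) := by
        rw [b5] at m5
        exact k5.trans m5
      refine ⟨by omega, by rw [m2 17 (by omega) (by omega), f17],
        by rw [m1 2 (by omega) (by omega), f2], fun x hx hx4 => ?_,
        fun x hx hx' => ?_, fun B hB => ?_, ?_, by simpa using hext, ?_⟩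
      · have h1 := l1 x hx
        have h2 := k1 x hx hx4
        have h3 := m1 x hx hx4
        simp at h1
        simp
        grind
      · have h1 := l2 x (by omega) (by omega)
        have h2 := k2 x hx hx'
        have h3 := m2 x (by omega) (by omega)
        simp at h1
        simp
        grind
      · simp [m3 B hB, l3, k3 B hB]
      · simp [m4, Nat.succ_mul]
        omega
      · intro x hx hxc ha hcard
        simp
        by_cases hxc' : s.arr 6 x = c
        · exact m6 x hx ha (by rw [b6]; exact hxc')
        · rw [b5] at m5
          exact m5.listed (k6 x hx (by omega) ha hcard)
  · rintro s' t ⟨ht, -, k1, k2, k3, k4, k5, k6⟩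
    exact ⟨ht, k1, k2, k3, k4, k5, fun x hx => k6 x hx (hD x hx)⟩

/-- Only the first `m` entries are processed. In a round these are the list before parents were
appended, to which the type codes refer. -/
theorem runs_appendRare {m : ℕ} (h0 : s.reg 0 = n) (h2 : s.reg 2 = 1) (h6 : s.reg 6 = K)
    (h10 : s.reg 10 = E) (h15 : s.reg 15 = m) (h4 : s.reg 4 = r) (hm : m ≤ r)
    (hp : Stores (s.arr 1) p) (hD : ∀ i < n, s.arr 6 i < E) (hL : ∀ j < r, s.arr 5 j < n)
    (hW : r + m * (E * K) + E + n + 1 < W) :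
    Runs W appendRare s (fun s' t => t ≤ m * (E * (17 * n + 8) + 6) + 2 ∧
      (∀ x < 11, x ≠ 4 → s'.reg x = s.reg x) ∧ (∀ B, B ≠ 5 → s'.arr B = s.arr B) ∧
      s'.reg 4 ≤ r + m * (E * K) ∧ Extends n r (s.arr 5) (s'.reg 4) (s'.arr 5) ∧
      ∀ l < m, ∀ x < n, parentCode p x = s.arr 5 l + 1 →
        typeCount p (s.arr 6) (s.arr 5 l + 1) (s.arr 6 x) n ≤ K →
        Listed (s'.arr 5) (s'.reg 4) x) := by
  refine (runs_forLoop (N := m) (B := E * (17 * n + 8) + 4) (fun j s' =>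
      (∀ x < 11, x ≠ 4 → s'.reg x = s.reg x) ∧ s'.reg 15 = m ∧ (∀ B, B ≠ 5 → s'.arr B = s.arr B) ∧
      s'.reg 4 ≤ r + j * (E * K) ∧ Extends n r (s.arr 5) (s'.reg 4) (s'.arr 5) ∧
      ∀ l < j, ∀ x < n, parentCode p x = s.arr 5 l + 1 →
        typeCount p (s.arr 6) (s.arr 5 l + 1) (s.arr 6 x) n ≤ K →
        Listed (s'.arr 5) (s'.reg 4) x) (by omega) ?_ ?_ ?_).mono ?_
  · refine ⟨fun x hx _ => ?_, by simp [h15], fun B _ => rfl, by simp [h4], ?_, ?_⟩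
    · have : x ≠ 11 := by omega
      simp [this]
    · simpa [h4] using Extends.refl hL
    · intro l hl
      omega
  · rintro j s' ⟨k1, k2, _⟩
    rw [k1 2 (by omega) (by omega)]
    exact ⟨k2, h2⟩
  · rintro j s' hj ⟨k1, k2, k3, k4, k5, k6⟩ hi
    have hjK : j * (E * K) + E * K ≤ m * (E * K) := by
      have : (j + 1) * (E * K) ≤ m * (E * K) := Nat.mul_le_mul_right _ hj
      rwa [Nat.succ_mul] at this
    have e2 := (k1 2 (by omega) (by omega)).trans h2
    have hLj := hL j (by omega)
    have e5 : s'.arr 5 j = s.arr 5 j := k5.eq j (by omega)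
    rw [runs_seqs_cons, runs_load, hi, e5]
    refine ⟨by omega, ?_⟩
    rw [runs_seqs_cons, runs_op]
    simp [e2]
    refine ⟨by omega, ?_⟩
    refine (runs_rareChildren (n := n) (p := p) (r := s'.reg 4) (K := K) (E := E)
      (a := s.arr 5 j + 1) ?_ ?_ ?_ ?_ ?_ ?_ ?_ ?_ ?_ ?_).mono ?_
    · simp [k1 0, h0]
    · simp [k1 2, h2]
    · simp [k1 6, h6]
    · simp [k1 10, h10]
    · simp
    · simp
    · simpa [k3 1] using hp
    · simpa [k3 6] using hD
    · simpa using k5.lt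
    · omega
    rintro s₂ t₂ ⟨ht₂, l1, l2, l3, l4, l5, l6⟩
    simp only [State.setReg_arr, k3 6 (by omega)] at l5 l6
    refine ⟨by omega, ?_, ?_, fun x hx hx4 => ?_, ?_, fun B hB => ?_, ?_, k5.trans l5, ?_⟩
    · rw [l1 11 (by omega) (by omega)]
      simp [hi]
    · rw [l1 2 (by omega) (by omega)]
      simp [e2]
    · have h1 := l1 x (by omega) hx4
      have h2 := k1 x hx hx4
      simp at h1
      grind
    · rw [l2 15 (by omega) (by omega)]
      simp [k2]
    · simp [l3 B hB, k3 B hB]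
    · rw [Nat.succ_mul]
      omega
    · intro l hl x hx ha hcard
      by_cases hlj : l = j
      · subst hlj
        exact l6 x hx ha hcard
      · exact l5.listed (k6 l (by omega) x hx ha hcard)
  · rintro s' t ⟨ht, -, k1, k2, k3, k4, k5, k6⟩
    exact ⟨by simpa using ht, k1, k3, k4, k5, k6⟩

/-- The vertices in the list of length `r` stored in `F`. -/
def listSet (n : ℕ) (F : ℕ → ℕ) (r : ℕ) : Set (Fin n) := {v | Listed F r v}

/-- Equal codes imply equal types. This direction is enough: a child that was not appended had a
large count, hence many siblings of its type. -/
theorem typeCount_le_ncard {F D : ℕ → ℕ} {a w : Fin n} (h : CodeInv G p F D r) :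
    typeCount p D (a + 1) (D w) n ≤ (sameType G p (listSet n F r) a w).ncard := by
  have hsub : (((Finset.range n).filter (fun x => parentCode p x = a + 1 ∧ D x = D w) :
      Finset ℕ) : Set ℕ) ⊆ Fin.val '' sameType G p (listSet n F r) a w := by
    intro x hx
    simp only [Finset.coe_filter, Finset.mem_range, Set.mem_ofPred_eq] at hx
    obtain ⟨hxn, hxa, hxw⟩ := hx
    refine ⟨⟨x, hxn⟩, ⟨parentCode_eq_succ_iff.1 hxa, ?_⟩, rfl⟩
    rintro b ⟨l, hl, hlb⟩
    exact (h.inj ⟨x, hxn⟩ w hxw l hl b hlb).symm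
  have h1 := Set.ncard_le_ncard hsub (Set.toFinite _)
  rw [Set.ncard_coe_finset, Set.ncard_image_of_injective _ Fin.val_injective] at h1
  exact h1

/-- A bound for the length of the list after a round. -/
def nextBound (k r : ℕ) : ℕ := 2 * r + r * (2 ^ r * (2 * k))

theorem runs_round {k i : ℕ} (hn : 1 ≤ n) (hW : nextBound k r + 2 ^ r + n * n + n + 1 < W)
    (h0 : s.reg 0 = n) (h2 : s.reg 2 = 1) (h3 : s.reg 3 = 0) (h4 : s.reg 4 = r)
    (h6 : s.reg 6 = 2 * k)
    (hG : s.arr 0 = matrixCode G) (hp : Stores (s.arr 1) p) (hL : ∀ j < r, s.arr 5 j < n)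
    (hA : CandidateSet G p q k i (listSet n (s.arr 5) r)) :
    Runs W round s (fun s' t => t ≤ 200 * ((r + 1) * 2 ^ r * n) ∧
      (∀ x < 9, x ≠ 4 → s'.reg x = s.reg x) ∧
      (∀ B, B ≠ 4 → B ≠ 5 → B ≠ 6 → s'.arr B = s.arr B) ∧
      r ≤ s'.reg 4 ∧ s'.reg 4 ≤ nextBound k r ∧ (∀ j < s'.reg 4, s'.arr 5 j < n) ∧
      CandidateSet G p q k (i + 1) (listSet n (s'.arr 5) (s'.reg 4))) := by
  unfold nextBound at hW ⊢
  have hW' : n * n + n + 1 < W ∧ 2 ^ r < W ∧ 2 * r + n + 1 < W ∧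
      2 * r + r * (2 ^ r * (2 * k)) + 2 ^ r + n + 1 < W := by
    generalize r * (2 ^ r * (2 * k)) = X at hW ⊢
    generalize 2 ^ r = Y at hW ⊢
    generalize n * n = Z at hW ⊢
    omega
  rw [round, runs_seqs_cons]
  refine (runs_typeCodes (r := r) (p := p) (G := G) hn hW'.1 hW'.2.1 h0 h2 h3 h4 hG hp
    hL).mono ?_
  rintro s₁ t₁ ⟨ht₁, g1, g2, g3, g4⟩
  have e5 : s₁.arr 5 = s.arr 5 := g2 5 (by omega) (by omega)
  have e1 : s₁.arr 1 = s.arr 1 := g2 1 (by omega) (by omega)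
  rw [runs_seqs_cons]
  refine (runs_appendParents (r := r) (p := p) hn hW'.2.2.1 ((g1 2 (by omega)).trans h2)
    ((g1 3 (by omega)).trans h3) ((g1 4 (by omega)).trans h4) (by rw [e1]; exact hp)
    (by rw [e5]; exact hL)).mono ?_
  rintro s₂ t₂ ⟨ht₂, k1, k2, k3, k4, k5, k6⟩
  rw [e5] at k5 k6
  have f6 : s₂.arr 6 = s₁.arr 6 := k2 6 (by omega)
  rw [runs_seqs_singleton]
  refine (runs_appendRare (n := n) (p := p) (r := 2 * r) (m := r) (K := 2 * k) (E := 2 ^ r)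
    ?_ ?_ ?_ ?_ k3 k4 (by omega) ?_ ?_ k5.lt hW'.2.2.2).mono ?_
  · rw [k1 0 (by omega) (by omega), g1 0 (by omega), h0]
  · rw [k1 2 (by omega) (by omega), g1 2 (by omega), h2]
  · rw [k1 6 (by omega) (by omega), g1 6 (by omega), h6]
  · rw [k1 10 (by omega) (by omega), g3]
  · rw [k2 1 (by omega), e1]; exact hp
  · rw [f6]; exact g4.lt
  rintro s₃ t₃ ⟨ht₃, l1, l2, l3, l4, l5⟩
  rw [f6] at l5
  have hext := k5.trans l4
  refine ⟨?_, ?_, ?_, hext.le, l3, l4.lt, hA.succ _ _ _ ?_ ?_ ?_⟩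
  · have h1 : 1 ≤ 2 ^ r := Nat.one_le_two_pow
    obtain ⟨e, he⟩ := Nat.exists_eq_add_of_le h1
    obtain ⟨n', hn'⟩ := Nat.exists_eq_add_of_le hn
    rw [he] at ht₃ ⊢
    subst hn'
    ring_nf at ht₁ ht₂ ht₃ ⊢
    omega
  · intro x hx hx4
    rw [l1 x (by omega) hx4, k1 x (by omega) hx4, g1 x hx]
  · intro B hB4 hB5 hB6
    rw [l2 B hB5, k2 B hB5, g2 B hB4 hB6]
  · rintro v hv
    exact hext.listed hv
  · rintro a ⟨l, hl, hla⟩ b hb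
    have := k6 l hl
    rw [hla, parentCode_of_some hb] at this
    exact l4.listed this
  · rintro a ⟨l, hl, hla⟩ w hw hwA
    refine lt_of_lt_of_le ?_ (typeCount_le_ncard g4)
    by_contra hle
    have hla' : s₂.arr 5 l = a := (k5.eq l hl).trans hla
    refine hwA (l5 l hl w w.2 ?_ ?_)
    · rw [hla', parentCode_of_some hw]
    · rw [hla']
      exact not_lt.1 hle

end RoundSpec

end RotDist

namespace RotDist

/-! ### Numbers as sequences of rotations. -/

section Simulation

variable {n r k : ℕ} {G : SimpleGraph (Fin n)} {p q : Fin n → Option (Fin n)} {F : ℕ → ℕ}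

/-- Rotates the vertex given by the last digit of the second component. -/
noncomputable def simStep (G : SimpleGraph (Fin n)) (F : ℕ → ℕ) (r : ℕ)
    (x : (Fin n → Option (Fin n)) × ℕ) : (Fin n → Option (Fin n)) × ℕ :=
  (if h : F (x.2 % r) < n then rotStep G x.1 ⟨F (x.2 % r), h⟩ else x.1, x.2 / r)

/-- A step that names a root, or no vertex at all, has no effect, so fewer than `i` rotations may
result. This holds for any list, which makes the search sound. -/
theorem exists_rotSeq_of_simStep {i z : ℕ} (h : ((simStep G F r)^[i] (p, z)).1 = q) :
    ∃ ℓ ≤ i, RotSeq G ℓ p q := by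
  induction i generalizing p z with
  | zero => exact ⟨0, le_rfl, (show p = q from h) ▸ RotSeq.nil p⟩
  | succ i ih =>
    rw [Function.iterate_succ_apply] at h
    obtain ⟨ℓ, hℓ, hs⟩ := ih h
    by_cases hF : F (z % r) < n
    · simp only [hF, dif_pos] at hs
      rcases hv : p ⟨F (z % r), hF⟩ with _ | u
      · rw [rotStep_of_none hv] at hs
        exact ⟨ℓ, by omega, hs⟩
      · rw [rotStep_of_some hv] at hs
        exact ⟨ℓ + 1, by omega, RotSeq.cons u _ hv hs⟩
    · simp only [hF, dif_neg, not_false_eq_true] at hs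
      exact ⟨ℓ, by omega, hs⟩

/-- A rotation is determined by its lower vertex alone. The positions of these vertices in the list
are the digits of `z` in base `r`, the earliest rotation being the last digit. -/
theorem exists_simStep_of_rotList {L : List (Fin n × Fin n)} (h : RotList G p L q)
    (hL : touched L ⊆ listSet n F r) :
    ∃ z < r ^ L.length, ((simStep G F r)^[L.length] (p, z)).1 = q := by
  induction h with
  | nil p => exact ⟨0, by simp, rfl⟩
  | @cons p q L u v huv _ ih =>
    rw [touched_cons] at hL
    obtain ⟨z, hz, hs⟩ := ih (fun x hx => hL (Or.inr hx))
    obtain ⟨l, hl, hlv⟩ : Listed F r v := hL (Or.inl (by simp))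
    have h1 : (l + r * z) % r = l := by simp [Nat.mod_eq_of_lt hl]
    have h2 : (l + r * z) / r = z := by
      rw [Nat.add_mul_div_left _ _ (by omega), Nat.div_eq_of_lt hl, zero_add]
    refine ⟨l + r * z, ?_, ?_⟩
    · rw [List.length_cons, pow_succ]
      have : r * (z + 1) ≤ r * r ^ L.length := Nat.mul_le_mul_left r hz
      rw [Nat.mul_succ] at this
      rw [mul_comm _ r]
      omega
    · rw [List.length_cons, Function.iterate_succ_apply]
      have : simStep G F r (p, l + r * z) = (rot G p u v, z) := by
        simp [simStep, h1, h2, hlv, rotStep_of_some huv]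
      rw [this]
      exact hs

theorem exists_simStep_iff {T T' : ElimForest G} {i : ℕ} (hr : 1 ≤ r) (hi : 2 * k < i)
    (hA : CandidateSet G T.parent T'.parent k i (listSet n F r)) :
    (∃ z < r ^ k, ∃ j ≤ k, ((simStep G F r)^[j] (T.parent, z)).1 = T'.parent) ↔
      rotDist T T' ≤ k := by
  rw [rotDist_le_iff]
  constructor
  · rintro ⟨z, _, j, hj, h⟩
    obtain ⟨ℓ, hℓ, hs⟩ := exists_rotSeq_of_simStep h
    exact ⟨ℓ, hℓ.trans hj, hs⟩
  · rintro ⟨ℓ, hℓ, hs⟩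
    obtain ⟨L, hL, hlen, hsub⟩ := exists_rotList_in_candidateSet hA T.isForest hs hℓ hi
    obtain ⟨z, hz, h⟩ := exists_simStep_of_rotList hL hsub
    exact ⟨z, hz.trans_le (Nat.pow_le_pow_right hr hlen), L.length, hlen, h⟩

end Simulation

/-! ### Trying all sequences of candidates. -/

section Search

/-- Sets register `19` to `0` if the arrays `2` and `3` differ. -/
def compare : Prog :=
  forLoop 9 0 (seqs [.load 10 3 9, .load 11 2 9, .ite (.eq 10 11) skip (.const 19 0)])

/-- Compares the current forest with the target and performs the rotation given by the last
digit of register `16`. -/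
def tryStep : Prog := seqs
  [.const 19 1, compare, .ite (.eq 19 2) (.const 14 1) skip, .divide 9 16 4, .times 10 9 4,
   .minus 10 16 10, .plus 16 9 3, .load 20 5 10, rotate]

/-- Performs the rotations given by the number in register `15`. -/
def tryNumber : Prog := seqs
  [forLoop 9 0 (seqs [.load 10 1 9, .store 3 9 10]), .plus 16 15 3, forLoop 18 17 tryStep]

/-- Tries all sequences of rotations of listed vertices. -/
def search : Prog := seqs
  [.const 13 1, forLoop 9 1 (.times 13 13 4), .const 14 0, .plus 17 1 2,
   forLoop 15 13 tryNumber, .plus 0 14 3]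

variable {n W r k : ℕ} {G : SimpleGraph (Fin n)} {p p' q : Fin n → Option (Fin n)} {s s' : State}
  {F : ℕ → ℕ}

/-- The part of the state that does not change during the search. -/
structure SearchCtx (G : SimpleGraph (Fin n)) (p q : Fin n → Option (Fin n)) (k r : ℕ) (F : ℕ → ℕ)
    (s : State) : Prop where
  reg0 : s.reg 0 = n
  reg1 : s.reg 1 = k
  reg2 : s.reg 2 = 1
  reg3 : s.reg 3 = 0
  reg4 : s.reg 4 = r
  arr0 : s.arr 0 = matrixCode G
  arr1 : Stores (s.arr 1) p
  arr2 : Stores (s.arr 2) q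
  arr5 : s.arr 5 = F

theorem SearchCtx.congr (h : SearchCtx G p q k r F s) (hreg : ∀ x < 5, s'.reg x = s.reg x)
    (h0 : s'.arr 0 = s.arr 0) (h1 : s'.arr 1 = s.arr 1) (h2 : s'.arr 2 = s.arr 2)
    (h5 : s'.arr 5 = s.arr 5) : SearchCtx G p q k r F s' := by
  obtain ⟨a0, a1, a2, a3, a4, b0, b1, b2, b5⟩ := h
  refine ⟨?_, ?_, ?_, ?_, ?_, h0.trans b0, h1 ▸ b1, h2 ▸ b2, h5.trans b5⟩
  all_goals rw [hreg _ (by omega)]; assumption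

theorem SearchCtx.setReg (h : SearchCtx G p q k r F s) {x m : ℕ} (hx : 5 ≤ x) :
    SearchCtx G p q k r F (s.setReg x m) := by
  refine h.congr (fun y hy => ?_) rfl rfl rfl rfl
  have : y ≠ x := by omega
  simp [this]

theorem runs_compare (hW : n < W) (h : SearchCtx G p q k r F s) (h3 : Stores (s.arr 3) p')
    (h19 : s.reg 19 = 1) : Runs W compare s (fun s' t => t ≤ 6 * n + 2 ∧
      (∀ x < 19, x ≠ 9 → x ≠ 10 → x ≠ 11 → s'.reg x = s.reg x) ∧ s'.arr = s.arr ∧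
      s'.reg 19 ≤ 1 ∧ (s'.reg 19 = 1 ↔ p' = q)) := by
  refine (runs_forLoop (N := n) (B := 4) (fun j s' =>
      (∀ x < 19, x ≠ 9 → x ≠ 10 → x ≠ 11 → s'.reg x = s.reg x) ∧ s'.arr = s.arr ∧
      s'.reg 19 ≤ 1 ∧ (s'.reg 19 = 1 ↔ ∀ i < j, parentCode p' i = parentCode q i)) hW
      ?_ ?_ ?_).mono ?_
  · refine ⟨fun x _ hx _ _ => by simp [hx], rfl, by simp [h19], by simp [h19]⟩
  · rintro j s' ⟨k1, _⟩
    rw [k1 0 (by omega) (by omega) (by omega) (by omega),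
      k1 2 (by omega) (by omega) (by omega) (by omega)]
    exact ⟨h.reg0, h.reg2⟩
  · rintro j s' hj ⟨k1, k2, k3, k4⟩ hi
    have e2 : s'.reg 2 = 1 := (k1 2 (by omega) (by omega) (by omega) (by omega)).trans h.reg2
    have hp' := h3 j hj
    have hq := h.arr2 j hj
    have hle := parentCode_le p' j
    have hle' := parentCode_le q j
    simp [hi, k2, hp', hq, runs_ite, runs_skip, e2]
    refine ⟨by omega, by omega, fun heq => ⟨by omega, fun x hx h9 h10 h11 => ?_, k3, ?_⟩,
      fun hne => ⟨by omega, fun x hx h9 h10 h11 => ?_, ⟨j, by omega, hne⟩⟩⟩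
    · have h99 : x ≠ 99 := by omega
      simp [h9, h10, h11, h99, k1 x hx h9 h10 h11]
    · rw [k4]
      constructor
      · intro h i hi
        rcases Nat.lt_or_eq_of_le hi with h' | h'
        · exact h i h'
        · rw [h', heq]
      · intro h i hi
        exact h i hi.le
    · have h19 : x ≠ 19 := by omega
      simp [h9, h10, h11, h19, k1 x hx h9 h10 h11]
  · rintro s' t ⟨ht, -, k1, k2, k3, k4⟩
    refine ⟨by omega, k1, k2, k3, k4.trans ⟨parentCode_inj, ?_⟩⟩
    rintro rfl i _
    rfl

theorem runs_tryStep {z : ℕ} (hW : n * n + n + 1 < W) (h : SearchCtx G p q k r F s) (hr : 1 ≤ r)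
    (hF : ∀ j < r, F j < n) (h3 : Stores (s.arr 3) p') (h16 : s.reg 16 = z) (hz : z < W) :
    Runs W tryStep s (fun s' t => t ≤ 66 * n + 100 ∧
      (∀ x < 19, x ≠ 9 → x ≠ 10 → x ≠ 11 → x ≠ 14 → x ≠ 16 → s'.reg x = s.reg x) ∧
      SearchCtx G p q k r F s' ∧ Stores (s'.arr 3) (simStep G F r (p', z)).1 ∧
      s'.reg 16 = (simStep G F r (p', z)).2 ∧
      (p' = q → s'.reg 14 = 1) ∧ (p' ≠ q → s'.reg 14 = s.reg 14)) := by
  rw [tryStep, runs_seqs_cons, runs_const]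
  refine ⟨by omega, ?_⟩
  rw [runs_seqs_cons]
  refine (runs_compare (by omega) (h.setReg (by omega)) (by simpa using h3) (by simp)).mono ?_
  rintro s₁ t₁ ⟨ht₁, g1, g2, g3, g4⟩
  have hctx : SearchCtx G p q k r F s₁ := by
    refine h.congr (fun x hx => ?_) ?_ ?_ ?_ ?_
    · rw [g1 x (by omega) (by omega) (by omega) (by omega)]
      have : x ≠ 19 := by omega
      simp [this]
    all_goals rw [g2]; rfl
  have e16 : s₁.reg 16 = z := by
    rw [g1 16 (by omega) (by omega) (by omega) (by omega)]
    simp [h16]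
  have hfound : Runs W (.ite (.eq 19 2) (.const 14 1) skip) s₁ (fun s' t => t ≤ 2 ∧
      (∀ x < 99, x ≠ 14 → s'.reg x = s₁.reg x) ∧ s'.arr = s₁.arr ∧ (p' = q → s'.reg 14 = 1) ∧
      (p' ≠ q → s'.reg 14 = s₁.reg 14)) := by
    rw [runs_ite, runs_const, runs_skip]
    rw [Test.holds_eq, hctx.reg2, g4]
    refine ⟨fun heq => ⟨by omega, le_rfl, fun x _ hx => by simp [hx], rfl, by simp,
      fun h => absurd heq h⟩, fun hne => ⟨by omega, le_rfl, fun x hx _ => ?_, rfl,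
      fun h => absurd h hne, fun _ => by simp⟩⟩
    have : x ≠ 99 := by omega
    simp [this]
  rw [runs_seqs_cons]
  refine hfound.mono ?_
  rintro s₂ t₂ ⟨ht₂, k1, k2, k3, k4⟩
  have hctx₂ : SearchCtx G p q k r F s₂ :=
    hctx.congr (fun x hx => k1 x (by omega) (by omega)) (by rw [k2]) (by rw [k2]) (by rw [k2])
      (by rw [k2])
  have f16 : s₂.reg 16 = z := (k1 16 (by omega) (by omega)).trans e16
  have hdiv : z / r ≤ z := Nat.div_le_self z r
  have hmul : z / r * r ≤ z := Nat.div_mul_le_self z r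
  have hmod : z - z / r * r = z % r := by
    have := Nat.div_add_mod z r
    rw [mul_comm] at this
    omega
  have hlt : z % r < r := Nat.mod_lt _ (by omega)
  have hFz := hF _ hlt
  have hsim : simStep G F r (p', z) = (rotStep G p' ⟨F (z % r), hFz⟩, z / r) := by
    simp [simStep, hFz]
  rw [hsim]
  simp [f16, hctx₂.reg4, hctx₂.reg3, hctx₂.arr5, hmod]
  refine ⟨by omega, by omega, by omega, by omega, by omega, ?_⟩
  refine (runs_rotate (G := G) (p := p') (v := ⟨F (z % r), hFz⟩) hW ?_ ?_ ?_ ?_ ?_ ?_).mono ?_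
  · simp [hctx₂.reg0]
  · simp [hctx₂.reg2]
  · simp [hctx₂.reg3]
  · simp
  · simp [hctx₂.arr0]
  · simpa [k2, g2] using h3
  rintro s₃ t₃ ⟨ht₃, l1, l2, l3⟩
  refine ⟨by omega, fun x hx h9 h10 h11 h14 h16 => ?_, ?_, l3, ?_, ?_, ?_⟩
  · have m1 := l1 x (by omega)
    have m2 := k1 x (by omega) h14
    have m3 := g1 x hx h9 h10 h11
    simp at m1 m3
    grind
  · refine hctx₂.congr (fun x hx => ?_) ?_ ?_ ?_ ?_
    · have m1 := l1 x (by omega)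
      simp at m1
      grind
    all_goals rw [l2 _ (by omega) (by omega)]; rfl
  · rw [l1 16 (by omega)]
    simp
  · intro hpq
    rw [l1 14 (by omega)]
    simp [k3 hpq]
  · intro hpq
    rw [l1 14 (by omega)]
    simp [k4 hpq]
    rw [g1 14 (by omega) (by omega) (by omega) (by omega)]
    simp

/-- Each step compares before it rotates. Hence `k + 1` steps inspect the forests after 0 to `k`
rotations, and the last rotation is performed in vain. -/
theorem runs_tryNumber {z : ℕ} (hW : n * n + n + 1 < W) (hkW : k + 1 < W)
    (h : SearchCtx G p q k r F s) (hr : 1 ≤ r) (hF : ∀ j < r, F j < n)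
    (h15 : s.reg 15 = z) (h17 : s.reg 17 = k + 1) (hz : z < W) :
    Runs W tryNumber s (fun s' t => t ≤ 5 * n + 6 + (k + 1) * (66 * n + 102) ∧
      s'.reg 13 = s.reg 13 ∧ s'.reg 15 = z ∧ s'.reg 17 = k + 1 ∧
      SearchCtx G p q k r F s' ∧
      ((∃ j ≤ k, ((simStep G F r)^[j] (p, z)).1 = q) → s'.reg 14 = 1) ∧
      ((¬ ∃ j ≤ k, ((simStep G F r)^[j] (p, z)).1 = q) → s'.reg 14 = s.reg 14)) := by
  rw [tryNumber, runs_seqs_cons]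
  refine (runs_forLoop (N := n) (B := 2) (fun j s' =>
      (∀ x < 20, x ≠ 9 → x ≠ 10 → s'.reg x = s.reg x) ∧ (∀ B, B ≠ 3 → s'.arr B = s.arr B) ∧
      ∀ i < j, s'.arr 3 i = parentCode p i) (by omega) ?_ ?_ ?_).mono ?_
  · exact ⟨fun x _ hx _ => by simp [hx], fun B _ => rfl, by simp⟩
  · rintro j s' ⟨k1, _⟩
    rw [k1 0 (by omega) (by omega) (by omega), k1 2 (by omega) (by omega) (by omega)]
    exact ⟨h.reg0, h.reg2⟩
  · rintro j s' hj ⟨k1, k2, k3⟩ hi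
    have e2 := (k1 2 (by omega) (by omega) (by omega)).trans h.reg2
    have e1 : s'.arr 1 j = parentCode p j := by rw [k2 1 (by omega), h.arr1 j hj]
    have hle := parentCode_le p j
    simp [hi, e1, e2]
    refine ⟨by omega, fun x hx h9 h10 => ?_, fun B hB => ?_, fun i hij => ?_⟩
    · simp [h9, h10, k1 x hx h9 h10]
    · simp [hB, k2 B hB]
    · by_cases hij' : i = j
      · subst hij'; simp
      · simp [hij', k3 i (by omega)]
  rintro s₁ t₁ ⟨ht₁, -, g1, g2, g3⟩
  have hctx : SearchCtx G p q k r F s₁ :=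
    h.congr (fun x hx => g1 x (by omega) (by omega) (by omega)) (g2 _ (by omega)) (g2 _ (by omega))
      (g2 _ (by omega)) (g2 _ (by omega))
  have e15 := (g1 15 (by omega) (by omega) (by omega)).trans h15
  have e17 := (g1 17 (by omega) (by omega) (by omega)).trans h17
  have e14 := g1 14 (by omega) (by omega) (by omega)
  have e13 := g1 13 (by omega) (by omega) (by omega)
  rw [runs_seqs_cons, runs_op]
  simp only [Op.eval, e15, hctx.reg3]
  refine ⟨by omega, ?_⟩
  rw [runs_seqs_singleton]
  -- Dividing by `r` never increases the number, so the remaining digits always fit into a word.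
  have hdig : ∀ j, ((simStep G F r)^[j] (p, z)).2 ≤ z := by
    intro j
    induction j with
    | zero => exact le_rfl
    | succ j ih =>
      rw [Function.iterate_succ_apply']
      exact (Nat.div_le_self _ _).trans ih
  refine (runs_forLoop (N := k + 1) (B := 66 * n + 100) (fun j s' =>
      s'.reg 13 = s.reg 13 ∧ s'.reg 15 = z ∧ s'.reg 17 = k + 1 ∧ SearchCtx G p q k r F s' ∧
      Stores (s'.arr 3) ((simStep G F r)^[j] (p, z)).1 ∧
      s'.reg 16 = ((simStep G F r)^[j] (p, z)).2 ∧
      ((∃ i < j, ((simStep G F r)^[i] (p, z)).1 = q) → s'.reg 14 = 1) ∧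
      ((¬ ∃ i < j, ((simStep G F r)^[i] (p, z)).1 = q) → s'.reg 14 = s.reg 14)) hkW
      ?_ ?_ ?_).mono ?_
  · refine ⟨by simp [e13], by simp [e15], by simp [e17], (hctx.setReg (by omega)).setReg (by omega),
      fun i hi => by simpa using g3 i hi, by simp, by simp, by simp [e14]⟩
  · rintro j s' ⟨_, _, k3, k4, _⟩
    exact ⟨k3, k4.reg2⟩
  · rintro j s' hj ⟨k1, k2, k3, k4, k5, k6, k7, k8⟩ hi
    refine (runs_tryStep hW k4 hr hF k5 k6 ((hdig j).trans_lt hz)).mono ?_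
    rintro s₂ t₂ ⟨ht₂, l1, l2, l3, l4, l5, l6⟩
    have hex : (∃ i < j + 1, ((simStep G F r)^[i] (p, z)).1 = q) ↔
        (∃ i < j, ((simStep G F r)^[i] (p, z)).1 = q) ∨ ((simStep G F r)^[j] (p, z)).1 = q := by
      constructor
      · rintro ⟨i, hi, h⟩
        rcases Nat.lt_succ_iff_lt_or_eq.1 hi with h' | h'
        · exact Or.inl ⟨i, h', h⟩
        · exact Or.inr (h' ▸ h)
      · rintro (⟨i, hi, h⟩ | h)
        · exact ⟨i, by omega, h⟩
        · exact ⟨j, by omega, h⟩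
    refine ⟨ht₂, ?_, l2.reg2, ?_, ?_, ?_, l2.setReg (by omega), ?_, ?_, ?_, ?_⟩
    · rw [l1 18 (by omega) (by omega) (by omega) (by omega) (by omega) (by omega), hi]
    · simp [l1 13 (by omega) (by omega) (by omega) (by omega) (by omega) (by omega), k1]
    · simp [l1 15 (by omega) (by omega) (by omega) (by omega) (by omega) (by omega), k2]
    · simp [l1 17 (by omega) (by omega) (by omega) (by omega) (by omega) (by omega), k3]
    · rw [Function.iterate_succ_apply']
      simpa using l3
    · rw [Function.iterate_succ_apply']
      simpa using l4
    · rw [hex]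
      intro h
      simp only [State.setReg_reg, show (14 : ℕ) ≠ 18 by omega, if_false]
      by_cases hq : ((simStep G F r)^[j] (p, z)).1 = q
      · exact l5 hq
      · rw [l6 hq]
        exact k7 (h.resolve_right hq)
    · rw [hex, not_or]
      rintro ⟨h1, h2⟩
      simp only [State.setReg_reg, show (14 : ℕ) ≠ 18 by omega, if_false]
      rw [l6 h2]
      exact k8 h1
  · rintro s₂ t₂ ⟨ht₂, -, k1, k2, k3, k4, -, -, k7, k8⟩
    simp only [Nat.lt_succ_iff] at k7 k8
    rw [show 66 * n + 100 + 2 = 66 * n + 102 from rfl] at ht₂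
    refine ⟨by omega, k1, k2, k3, k4, k7, k8⟩

theorem runs_search (hn : 1 ≤ n) (hW : n * n + n + 1 < W) (hkW : k + 1 < W) (hrW : r ^ k < W)
    (h : SearchCtx G p q k r F s) (hr : 1 ≤ r) (hF : ∀ j < r, F j < n) :
    Runs W search s (fun s' t => t ≤ 200 * (r ^ k * (k + 1) * n) ∧
      ((∃ z < r ^ k, ∃ j ≤ k, ((simStep G F r)^[j] (p, z)).1 = q) → s'.reg 0 = 1) ∧
      ((¬ ∃ z < r ^ k, ∃ j ≤ k, ((simStep G F r)^[j] (p, z)).1 = q) → s'.reg 0 = 0)) := by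
  rw [search, runs_seqs_cons, runs_const]
  refine ⟨by omega, ?_⟩
  rw [runs_seqs_cons]
  refine (runs_forLoop (N := k) (B := 1) (fun j s' => s'.reg 13 = r ^ j ∧
      SearchCtx G p q k r F s') (by omega) ?_ ?_ ?_).mono ?_
  · exact ⟨by simp, (h.setReg (by omega)).setReg (by omega)⟩
  · rintro j s' ⟨_, k2⟩
    exact ⟨k2.reg1, k2.reg2⟩
  · rintro j s' hj ⟨k1, k2⟩ hi
    have hpow : r ^ (j + 1) ≤ r ^ k := Nat.pow_le_pow_right hr hj
    rw [runs_op]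
    simp only [Op.eval, k1, k2.reg4, ← pow_succ]
    exact ⟨by omega, le_rfl, by simp [hi], by simp [k2.reg2], by simp,
      (k2.setReg (by omega)).setReg (by omega)⟩
  rintro s₁ t₁ ⟨ht₁, -, g1, g2⟩
  simp only [runs_seqs_cons, runs_const, runs_op, runs_seqs_singleton, Op.eval, State.setReg_reg]
  simp [g2.reg1, g2.reg2]
  refine ⟨by omega, hkW, ?_⟩
  refine (runs_forLoop (N := r ^ k) (B := 5 * n + 6 + (k + 1) * (66 * n + 102)) (fun z s' =>
      s'.reg 13 = r ^ k ∧ s'.reg 17 = k + 1 ∧ SearchCtx G p q k r F s' ∧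
      ((∃ y < z, ∃ j ≤ k, ((simStep G F r)^[j] (p, y)).1 = q) → s'.reg 14 = 1) ∧
      ((¬ ∃ y < z, ∃ j ≤ k, ((simStep G F r)^[j] (p, y)).1 = q) → s'.reg 14 = 0)) hrW
      ?_ ?_ ?_).mono ?_
  · exact ⟨by simp [g1], by simp, ((g2.setReg (by omega)).setReg (by omega)).setReg (by omega),
      by simp, by simp⟩
  · rintro z s' ⟨k1, _, k3, _⟩
    exact ⟨k1, k3.reg2⟩
  · rintro z s' hz ⟨k1, k2, k3, k4, k5⟩ hi
    refine (runs_tryNumber hW hkW k3 hr hF hi k2 (hz.trans hrW)).mono ?_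
    rintro s₂ t₂ ⟨ht₂, l1, l2, l3, l4, l5, l6⟩
    have hex : (∃ y < z + 1, ∃ j ≤ k, ((simStep G F r)^[j] (p, y)).1 = q) ↔
        (∃ y < z, ∃ j ≤ k, ((simStep G F r)^[j] (p, y)).1 = q) ∨
        ∃ j ≤ k, ((simStep G F r)^[j] (p, z)).1 = q := by
      constructor
      · rintro ⟨y, hy, h⟩
        rcases Nat.lt_succ_iff_lt_or_eq.1 hy with h' | h'
        · exact Or.inl ⟨y, h', h⟩
        · exact Or.inr (h' ▸ h)
      · rintro (⟨y, hy, h⟩ | h)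
        · exact ⟨y, by omega, h⟩
        · exact ⟨z, by omega, h⟩
    refine ⟨ht₂, l2, l4.reg2, by simp [l1, k1], by simp [l3], l4.setReg (by omega), ?_, ?_⟩
    · rw [hex]
      intro h
      simp only [State.setReg_reg, show (14 : ℕ) ≠ 15 by omega, if_false]
      by_cases hq : ∃ j ≤ k, ((simStep G F r)^[j] (p, z)).1 = q
      · exact l5 hq
      · rw [l6 hq]
        exact k4 (h.resolve_right hq)
    · rw [hex, not_or]
      rintro ⟨h1, h2⟩
      simp only [State.setReg_reg, show (14 : ℕ) ≠ 15 by omega, if_false]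
      rw [l6 h2]
      exact k5 h1
  · rintro s₂ t₂ ⟨ht₂, -, -, -, k3, k4, k5⟩
    rw [k3.reg3, add_zero]
    have hle : s₂.reg 14 ≤ 1 := by
      by_cases hq : ∃ y < r ^ k, ∃ j ≤ k, ((simStep G F r)^[j] (p, y)).1 = q
      · rw [k4 hq]
      · rw [k5 hq]
        omega
    refine ⟨by omega, ?_, fun z hz j hj hq => k4 ⟨z, hz, j, hj, hq⟩,
      fun hq => ⟨k5 (by push Not; exact hq), rfl⟩⟩
    have h1 : 1 ≤ r ^ k := Nat.one_le_pow _ _ hr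
    obtain ⟨e, he⟩ := Nat.exists_eq_add_of_le h1
    obtain ⟨n', hn'⟩ := Nat.exists_eq_add_of_le hn
    rw [he] at ht₂ ⊢
    subst hn'
    ring_nf at ht₁ ht₂ ⊢
    omega

end Search

end RotDist

namespace RotDist

/-! ### The initial list of candidates. -/

section Setup

/-- Marks the parents of the vertices whose parents differ in the two forests (and possibly the
vertex `0`) in the array `7`. -/
def markParents : Prog :=
  forLoop 8 0 (seqs [.load 9 1 8, .load 10 2 8, .ite (.eq 9 10) skip
    (seqs [.minus 9 9 2, .store 7 9 2, .minus 10 10 2, .store 7 10 2])])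

/-- Lists the vertex `0` and the marked vertices. -/
def listMarked : Prog := seqs
  [.store 5 3 3, .const 4 1,
   forLoop 8 0 (seqs [.load 9 7 8, .ite (.eq 9 2) (seqs [.store 5 4 8, .plus 4 4 2]) skip])]

/-- Computes the constants and the initial list. -/
def setup : Prog := seqs
  [.const 2 1, .const 3 0, .const 5 6, .times 5 5 1, .const 6 2, .plus 5 5 6, .times 6 6 1,
   .plus 7 6 2, markParents, listMarked]

variable {n W k : ℕ} {G : SimpleGraph (Fin n)} {p q : Fin n → Option (Fin n)} {s : State}
  {M : ℕ → ℕ}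

theorem mem_diffParents_of_parentCode {w x : ℕ} (hw : w < n) (hx : x < n)
    (h : parentCode p w ≠ parentCode q w)
    (hc : parentCode p w = x + 1 ∨ parentCode q w = x + 1) : ⟨x, hx⟩ ∈ diffParents p q := by
  refine ⟨⟨w, hw⟩, fun he => h ?_, ?_⟩
  · simp [parentCode, hw, he]
  · exact hc.imp (fun h => parentCode_eq_succ_iff.1 h) (fun h => parentCode_eq_succ_iff.1 h)

/-- A root whose parents differ causes a mark at vertex `0` by truncated subtraction, which explains
the exception `x = 0`. -/
theorem runs_markParents (hn : 1 ≤ n) (hW : n + 1 < W) (h0 : s.reg 0 = n) (h2 : s.reg 2 = 1)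
    (hp : Stores (s.arr 1) p) (hq : Stores (s.arr 2) q) (h7 : ∀ x, s.arr 7 x = 0) :
    Runs W markParents s (fun s' t => t ≤ 9 * n + 2 ∧
      (∀ x < 8, s'.reg x = s.reg x) ∧ (∀ B, B ≠ 7 → s'.arr B = s.arr B) ∧
      (∀ x, s'.arr 7 x ≤ 1) ∧
      (∀ x (hx : x < n), s'.arr 7 x = 1 → x = 0 ∨ ⟨x, hx⟩ ∈ diffParents p q) ∧
      ∀ x ∈ diffParents p q, s'.arr 7 x = 1) := by
  refine (runs_forLoop (N := n) (B := 7) (fun j s' =>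
      (∀ x < 8, s'.reg x = s.reg x) ∧ (∀ B, B ≠ 7 → s'.arr B = s.arr B) ∧
      (∀ x, s'.arr 7 x ≤ 1) ∧
      (∀ x (hx : x < n), s'.arr 7 x = 1 → x = 0 ∨ ⟨x, hx⟩ ∈ diffParents p q) ∧
      ∀ w < j, parentCode p w ≠ parentCode q w → ∀ x, parentCode p w = x + 1 ∨
        parentCode q w = x + 1 → s'.arr 7 x = 1) (by omega) ?_ ?_ ?_).mono ?_
  · refine ⟨fun x hx => ?_, fun B _ => rfl, by simp [h7], by simp [h7], by simp⟩
    have : x ≠ 8 := by omega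
    simp [this]
  · rintro j s' ⟨k1, _⟩
    rw [k1 0 (by omega), k1 2 (by omega)]
    exact ⟨h0, h2⟩
  · rintro j s' hj ⟨k1, k2, k3, k4, k5⟩ hi
    have e2 := (k1 2 (by omega)).trans h2
    have a1 : s'.arr 1 j = parentCode p j := by rw [k2 1 (by omega), hp j hj]
    have a2 : s'.arr 2 j = parentCode q j := by rw [k2 2 (by omega), hq j hj]
    have hle := parentCode_le p j
    have hle' := parentCode_le q j
    have hdiff := fun x hx => mem_diffParents_of_parentCode (p := p) (q := q) (x := x) hj hx
    simp [hi, e2, a1, a2, runs_ite, runs_skip]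
    refine ⟨by omega, by omega, fun heq => ⟨by omega, fun x hx => ?_, k2, k3, k4, ?_⟩,
      fun hne => ⟨by omega, by omega, by omega, by omega, fun x hx => ?_,
        fun B hB => ?_, fun x => ?_,
        fun x hx => ?_, ?_⟩⟩
    · grind
    · intro w hw hwne
      rcases Nat.lt_or_eq_of_le hw with h | h
      · exact k5 w h hwne
      · exact absurd (h ▸ heq) hwne
    · grind
    · simp [hB, k2 B hB]
    · have := k3 x
      simp only [Function.update_apply]
      split_ifs <;> omega
    · simp only [Function.update_apply]
      intro h
      by_cases hx0 : x = 0
      · exact Or.inl hx0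
      · have := hdiff x hx hne
        have := k4 x hx
        split_ifs at h with h1 h2
        · exact Or.inr (hdiff x hx hne (by omega))
        · exact Or.inr (hdiff x hx hne (by omega))
        · exact k4 x hx h
    · intro w hw hwne x hx
      simp only [Function.update_apply]
      split_ifs with h1 h2
      · rfl
      · rfl
      · rcases Nat.lt_or_eq_of_le hw with h | h
        · exact k5 w h hwne x hx
        · subst h
          omega
  · rintro s' t ⟨ht, -, k1, k2, k3, k4, k5⟩
    refine ⟨by omega, k1, k2, k3, k4, ?_⟩
    rintro x ⟨w, hw, hwx⟩
    refine k5 w w.2 (fun h => hw ?_) x ?_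
    · rcases hpw : p w with _ | a
      · rcases hqw : q w with _ | b
        · rfl
        · rw [parentCode_of_none hpw, parentCode_of_some hqw] at h
          omega
      · rw [parentCode_of_some hpw] at h
        rw [parentCode_eq_succ_iff.1 h.symm]
    · exact hwx.imp parentCode_eq_succ_iff.2 parentCode_eq_succ_iff.2

/-- The number of marked vertices below `j`. -/
def markCount (M : ℕ → ℕ) (j : ℕ) : ℕ := ((Finset.range j).filter (fun x => M x = 1)).card

theorem markCount_succ (M : ℕ → ℕ) (j : ℕ) :
    markCount M (j + 1) = markCount M j + if M j = 1 then 1 else 0 := by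
  unfold markCount
  rw [Finset.range_add_one, Finset.filter_insert]
  split_ifs with h
  · rw [Finset.card_insert_of_notMem (by simp)]
  · rfl

theorem markCount_le (M : ℕ → ℕ) (j : ℕ) : markCount M j ≤ j :=
  (Finset.card_filter_le _ _).trans (by simp)

theorem markCount_le_ncard {A : Set (Fin n)}
    (h : ∀ x (hx : x < n), M x = 1 → x = 0 ∨ ⟨x, hx⟩ ∈ A) : markCount M n ≤ A.ncard + 1 := by
  have hsub : (((Finset.range n).filter (fun x => M x = 1) : Finset ℕ) : Set ℕ) ⊆
      insert 0 (Fin.val '' A) := by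
    intro x hx
    simp only [Finset.coe_filter, Finset.mem_range, Set.mem_ofPred_eq] at hx
    exact (h x hx.1 hx.2).imp id (fun h => ⟨_, h, rfl⟩)
  have h1 := Set.ncard_le_ncard hsub (Set.toFinite _)
  rw [Set.ncard_coe_finset] at h1
  exact h1.trans ((Set.ncard_insert_le _ _).trans
    (Nat.add_le_add_right (Set.ncard_image_of_injective _ Fin.val_injective).le 1))

/-- Vertex `0` is put on the list in any case, so that the length, by which the search divides, is
positive. -/
theorem runs_listMarked (hn : 1 ≤ n) (hW : n + 1 < W) (h0 : s.reg 0 = n) (h2 : s.reg 2 = 1)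
    (h3 : s.reg 3 = 0) (h7 : ∀ x, s.arr 7 x ≤ 1) :
    Runs W listMarked s (fun s' t => t ≤ 6 * n + 4 ∧
      (∀ x < 8, x ≠ 4 → s'.reg x = s.reg x) ∧ (∀ B, B ≠ 5 → s'.arr B = s.arr B) ∧
      1 ≤ s'.reg 4 ∧ s'.reg 4 ≤ markCount (s.arr 7) n + 1 ∧ (∀ j < s'.reg 4, s'.arr 5 j < n) ∧
      ∀ x < n, s.arr 7 x = 1 → Listed (s'.arr 5) (s'.reg 4) x) := by
  rw [listMarked, runs_seqs_cons, runs_store, h3]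
  refine ⟨by omega, ?_⟩
  rw [runs_seqs_cons, runs_const]
  refine ⟨by omega, ?_⟩
  rw [runs_seqs_singleton]
  refine (runs_forLoop (N := n) (B := 4) (fun j s' =>
      (∀ x < 8, x ≠ 4 → s'.reg x = s.reg x) ∧ (∀ B, B ≠ 5 → s'.arr B = s.arr B) ∧
      s'.reg 4 ≤ markCount (s.arr 7) j + 1 ∧ Extends n 1 (fun _ => 0) (s'.reg 4) (s'.arr 5) ∧
      ∀ x < j, s.arr 7 x = 1 → Listed (s'.arr 5) (s'.reg 4) x) (by omega) ?_ ?_ ?_).mono ?_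
  · refine ⟨fun x hx hx4 => ?_, fun B hB => ?_, by simp, ⟨by simp, ?_, ?_⟩, by simp⟩
    · have : x ≠ 8 := by omega
      simp [this, hx4]
    · simp [hB]
    · simp
    · simp
      omega
  · rintro j s' ⟨k1, _⟩
    rw [k1 0 (by omega) (by omega), k1 2 (by omega) (by omega)]
    exact ⟨h0, h2⟩
  · rintro j s' hj ⟨k1, k2, k3, k4, k5⟩ hi
    have e2 := (k1 2 (by omega) (by omega)).trans h2
    have a7 := k2 7 (by omega)
    have h7j := h7 j
    have hcount := markCount_le (s.arr 7) j
    have hsucc := markCount_succ (s.arr 7) j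
    have happ := k4.append hj
    simp [hi, e2, a7, runs_ite, runs_skip]
    refine ⟨by omega, fun h1 => ⟨by omega, by omega, fun x hx hx4 => ?_, fun B hB => ?_, ?_, happ,
      fun x hx hx1 => ?_⟩, fun h1 => ⟨by omega, fun x hx hx4 => ?_, k2, ?_, k4,
      fun x hx hx1 => ?_⟩⟩
    · grind
    · simp [hB, k2 B hB]
    · rw [hsucc, if_pos h1]
      omega
    · by_cases hxj : x = j
      · exact ⟨s'.reg 4, by omega, by simp [hxj]⟩
      · obtain ⟨l, hl, hlx⟩ := k5 x (by omega) hx1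
        refine ⟨l, by omega, ?_⟩
        rw [Function.update_of_ne (by omega)]
        exact hlx
    · grind
    · rw [hsucc, if_neg h1]
      omega
    · have : x ≠ j := by
        rintro rfl
        exact h1 hx1
      exact k5 x (by omega) hx1
  · rintro s' t ⟨ht, -, k1, k2, k3, k4, k5⟩
    exact ⟨by omega, k1, k2, k4.le, k3, k4.lt, k5⟩

/-- The excess 2 over the number of differing parents comes from the possible spurious mark of
vertex `0` and from the fixed first entry. Register `5` holds the resulting threshold for rejection.
-/
theorem runs_setup (hn : 1 ≤ n) (hW : n + 2 < W) (hkW : 6 * k + 6 < W)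
    (h0 : s.reg 0 = n) (h1 : s.reg 1 = k)
    (hp : Stores (s.arr 1) p) (hq : Stores (s.arr 2) q) (h7 : ∀ x, s.arr 7 x = 0) :
    Runs W setup s (fun s' t => t ≤ 29 * n ∧
      s'.reg 0 = n ∧ s'.reg 1 = k ∧ s'.reg 2 = 1 ∧ s'.reg 3 = 0 ∧ s'.reg 5 = 6 * k + 2 ∧
      s'.reg 6 = 2 * k ∧ s'.reg 7 = 2 * k + 1 ∧ (∀ B < 3, s'.arr B = s.arr B) ∧
      1 ≤ s'.reg 4 ∧ s'.reg 4 ≤ (diffParents p q).ncard + 2 ∧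
      (∀ j < s'.reg 4, s'.arr 5 j < n) ∧ diffParents p q ⊆ listSet n (s'.arr 5) (s'.reg 4)) := by
  simp only [setup, runs_seqs_cons, runs_const, runs_op, Op.eval, State.setReg_reg]
  simp [h1]
  refine ⟨by omega, by omega, by omega, by omega, by omega, by omega, by omega, by omega, ?_⟩
  refine (runs_markParents (n := n) (p := p) (q := q) hn (by omega) ?_ ?_ ?_ ?_ ?_).mono ?_
  · simp [h0]
  · simp
  · simpa using hp
  · simpa using hq
  · simpa using h7
  rintro s₁ t₁ ⟨ht₁, g1, g2, g3, g4, g5⟩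
  refine (runs_listMarked (n := n) hn (by omega) ?_ ?_ ?_ g3).mono ?_
  · simp [g1 0 (by omega), h0]
  · simp [g1 2 (by omega)]
  · simp [g1 3 (by omega)]
  rintro s₂ t₂ ⟨ht₂, k1, k2, k3, k4, k5, k6⟩
  refine ⟨by omega, ?_, ?_, ?_, ?_, ?_, ?_, ?_, fun B hB => ?_, k3, ?_, k5, ?_⟩
  · simp [k1 0 (by omega) (by omega), g1 0 (by omega), h0]
  · simp [k1 1 (by omega) (by omega), g1 1 (by omega), h1]
  · simp [k1 2 (by omega) (by omega), g1 2 (by omega)]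
  · simp [k1 3 (by omega) (by omega), g1 3 (by omega)]
  · simp [k1 5 (by omega) (by omega), g1 5 (by omega)]
  · simp [k1 6 (by omega) (by omega), g1 6 (by omega)]
  · simp [k1 7 (by omega) (by omega), g1 7 (by omega)]
  · rw [k2 B (by omega), g2 B (by omega)]
    rfl
  · exact k4.trans (Nat.add_le_add_right (markCount_le_ncard g4) 1)
  · intro x hx
    exact k6 x x.2 (g5 x hx)

end Setup

end RotDist

namespace RotDist

/-! ### The length of the list compared with the tower. -/

section ListBound

/-- A bound for the length of the list of candidates after `i` rounds. -/
def listBound (k : ℕ) : ℕ → ℕ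
  | 0 => 6 * k + 2
  | i + 1 => nextBound k (listBound k i)

theorem nextBound_mono (k : ℕ) {r r' : ℕ} (h : r ≤ r') : nextBound k r ≤ nextBound k r' := by
  unfold nextBound
  gcongr
  · omega

theorem le_nextBound (k r : ℕ) : r ≤ nextBound k r := by
  unfold nextBound
  omega

theorem listBound_mono (k : ℕ) : Monotone (listBound k) :=
  monotone_nat_of_le_succ fun _ => le_nextBound k _

theorem le_listBound (k i : ℕ) : 6 * k + 2 ≤ listBound k i := listBound_mono k (Nat.zero_le i)

/-- This absorbs the time of a round and its number of type codes into the bound for the length of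
the next list. -/
theorem succ_mul_two_pow_le_nextBound {k r : ℕ} (hk : 1 ≤ k) (hr : 1 ≤ r) :
    (r + 1) * 2 ^ r ≤ nextBound k r := by
  have h : r * (2 ^ r * 2) ≤ r * (2 ^ r * (2 * k)) := by gcongr; omega
  have h' : 1 * 2 ^ r ≤ r * 2 ^ r := Nat.mul_le_mul_right _ hr
  unfold nextBound
  nlinarith

theorem sq_le_two_pow {r : ℕ} (hr : 4 ≤ r) : r ^ 2 ≤ 2 ^ r := by
  induction r, hr using Nat.le_induction with
  | base => norm_num
  | succ r hr ih =>
    rw [pow_succ 2 r]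
    nlinarith

/-- As `2 * k ≤ r`, all polynomial factors are at most `2 ^ r`. Besides them only the number of
types counts, and two exponentials suffice for one round. -/
theorem nextBound_le {k r : ℕ} (h : 6 * k + 2 ≤ r) (hr : 4 ≤ r) : nextBound k r ≤ 2 ^ 2 ^ r := by
  have h1 : r ^ 2 ≤ 2 ^ r := sq_le_two_pow hr
  have h2 : r * (2 ^ r * (2 * k)) ≤ 2 ^ r * 2 ^ r := by
    calc r * (2 ^ r * (2 * k)) = 2 ^ r * (r * (2 * k)) := by ring
      _ ≤ 2 ^ r * (r * r) := by gcongr; omega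
      _ ≤ 2 ^ r * 2 ^ r := by gcongr; rwa [← sq]
  have h3 : 2 * r ≤ 2 ^ r := by nlinarith
  have h4 : 2 ^ r ≤ 2 ^ r * 2 ^ r := Nat.le_mul_of_pos_left _ (by positivity)
  have h5 : 2 ^ (r + r + 1) ≤ 2 ^ 2 ^ r := Nat.pow_le_pow_right (by omega) (by nlinarith)
  rw [pow_succ, pow_add] at h5
  unfold nextBound
  omega

theorem tower_mono (h : ℕ) : Monotone (tower h) := by
  induction h with
  | zero => exact monotone_id
  | succ h ih => exact fun x y hxy => Nat.pow_le_pow_right (by omega) (ih hxy)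

theorem tower_height_mono (x : ℕ) : Monotone (fun h => tower h x) :=
  monotone_nat_of_le_succ fun _ => Nat.lt_two_pow_self.le

theorem listBound_le_tower {k : ℕ} (hk : 1 ≤ k) (i : ℕ) :
    listBound k i ≤ tower (2 * i) (6 * k + 2) := by
  induction i with
  | zero => exact le_rfl
  | succ i ih =>
    have h := le_listBound k i
    exact (nextBound_le h (by omega)).trans
      (Nat.pow_le_pow_right (by omega) (Nat.pow_le_pow_right (by omega) ih))

/-- The final length dominates `k`, so the left side is at most twice exponential in it: two more
twos on top of the two for each round. The constant 10 is chosen so that `6 * k + 2 ≤ 10 * k ^ 2`,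
and base `k` is no smaller than base 2. -/
theorem listBound_pow_le_runtime {k : ℕ} (hk : 2 ≤ k) :
    700 * (listBound k (2 * k + 1) ^ k * (k + 1)) ≤ runtime 10 k := by
  have h0 := le_listBound k (2 * k + 1)
  have h1 := listBound_le_tower (show 1 ≤ k by omega) (2 * k + 1)
  set ρ := listBound k (2 * k + 1)
  -- For `k ≥ 2` the length bound is at least `6 * 2 + 2 = 14`.
  have h2 : 700 ≤ ρ ^ 3 := le_trans (by norm_num) (Nat.pow_le_pow_left (show 14 ≤ ρ by omega) 3)
  calc 700 * (ρ ^ k * (k + 1)) ≤ ρ ^ 3 * (ρ ^ k * ρ) := by gcongr; omega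
    _ = ρ ^ (k + 4) := by ring
    _ ≤ ρ ^ ρ := Nat.pow_le_pow_right (by omega) (by omega)
    _ ≤ (2 ^ ρ) ^ ρ := Nat.pow_le_pow_left Nat.lt_two_pow_self.le _
    _ = 2 ^ ρ ^ 2 := by rw [← pow_mul, sq]
    _ ≤ 2 ^ 2 ^ ρ := Nat.pow_le_pow_right (by omega) (sq_le_two_pow (by omega))
    _ ≤ 2 ^ 2 ^ tower (2 * (2 * k + 1)) (6 * k + 2) :=
      Nat.pow_le_pow_right (by omega) (Nat.pow_le_pow_right (by omega) h1)
    _ = 2 ^ tower (2 * (2 * k + 1) + 1) (6 * k + 2) := rfl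
    _ ≤ 2 ^ tower (2 * (2 * k + 1) + 1) (10 * k ^ 2) :=
      Nat.pow_le_pow_right (by omega) (tower_mono _ (by nlinarith))
    _ ≤ 2 ^ tower ((3 * k + 1) * (4 * k)) (10 * k ^ 2) :=
      Nat.pow_le_pow_right (by omega) (tower_height_mono _ (by nlinarith))
    _ ≤ k ^ tower ((3 * k + 1) * (4 * k)) (10 * k ^ 2) := Nat.pow_le_pow_left hk _
    _ ≤ runtime 10 k :=
      Nat.pow_le_pow_right (by omega) (Nat.le_mul_of_pos_left _ (by omega))

theorem one_le_runtime (c : ℕ) {k : ℕ} (hk : 1 ≤ k) : 1 ≤ runtime c k := Nat.one_le_pow _ _ hk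

/-- For `k = 1` the running time is a power of 1, which dominates nothing; this single case goes
into the constant. -/
theorem exists_le_mul_of_two_le {f g : ℕ → ℕ} (h : ∀ k, 2 ≤ k → f k ≤ g k) (hg : 1 ≤ g 1) :
    ∃ D, ∀ k, 1 ≤ k → f k ≤ D * g k := by
  refine ⟨f 1 + 1, fun k hk => ?_⟩
  rcases Nat.lt_or_eq_of_le hk with hk | rfl
  · exact (h k hk).trans (Nat.le_mul_of_pos_left _ (Nat.succ_pos _))
  · exact (Nat.le_succ _).trans (Nat.le_mul_of_pos_right _ hg)

end ListBound

/-! ### The complete algorithm. -/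

section Main

/-- Computes a list of candidates and tries all sequences of rotations of candidates. -/
def main : Prog := seqs
  [setup, .ite (.lt 5 4) (.const 0 0) (seqs [forLoop 8 7 round, search])]

variable {n W k : ℕ} {G : SimpleGraph (Fin n)} {T T' : ElimForest G}

theorem ncard_diffParents_le_of_rotDist_le (h : rotDist T T' ≤ k) :
    (diffParents T.parent T'.parent).ncard ≤ 6 * k := by
  obtain ⟨ℓ, hℓ, hs⟩ := rotDist_le_iff.1 h
  obtain ⟨L, hL, rfl⟩ := rotSeq_iff_exists_rotList.1 hs
  exact (ncard_diffParents_le hL).trans (by omega)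

theorem runs_main (hn : 1 ≤ n) (hk : 1 ≤ k)
    (hW : n * n + n + 2 * listBound k (2 * k + 1) ^ k + 6 < W) :
    Runs W main (input G T T' k) (fun s t =>
      t ≤ 700 * (listBound k (2 * k + 1) ^ k * (k + 1) * n) ∧
      (rotDist T T' ≤ k → s.reg 0 = 1) ∧ (¬ rotDist T T' ≤ k → s.reg 0 = 0)) := by
  have hρ := le_listBound k (2 * k + 1)
  have hρk : listBound k (2 * k + 1) ≤ listBound k (2 * k + 1) ^ k :=
    Nat.le_self_pow (by omega) _
  have hmono := listBound_mono k
  set ρ := listBound k (2 * k + 1) with hρ_def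
  have hX : ρ * n ≤ ρ ^ k * (k + 1) * n :=
    Nat.mul_le_mul_right _ (hρk.trans (Nat.le_mul_of_pos_right _ (by omega)))
  have hX' : 8 * n ≤ ρ * n := Nat.mul_le_mul_right _ (by omega)
  rw [main, runs_seqs_cons]
  refine (runs_setup (n := n) (k := k) (p := T.parent) (q := T'.parent) hn (by omega) (by omega)
    rfl rfl (fun _ _ => rfl) (fun _ _ => rfl) (fun _ => rfl)).mono ?_
  rintro s t ⟨ht, g0, g1, g2, g3, g5, g6, g7, ga, g4, g4', gL, gA⟩
  rw [runs_seqs_singleton, runs_ite, Test.holds_lt, g5]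
  -- More than `6 * k + 2` entries mean more than `6 * k` differing parents, so rejection is
  -- correct.
  refine ⟨fun hlt => ?_, fun hle => ?_⟩
  · rw [runs_const]
    refine ⟨by omega, by omega, fun h => ?_, fun _ => by simp⟩
    have := ncard_diffParents_le_of_rotDist_le h
    omega
  rw [runs_seqs_cons]
  refine (runs_forLoop (N := 2 * k + 1) (B := 200 * (ρ * n)) (fun i s' =>
      (∀ x < 8, x ≠ 4 → s'.reg x = s.reg x) ∧ (∀ B < 3, s'.arr B = s.arr B) ∧
      1 ≤ s'.reg 4 ∧ s'.reg 4 ≤ listBound k i ∧ (∀ j < s'.reg 4, s'.arr 5 j < n) ∧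
      CandidateSet G T.parent T'.parent k i (listSet n (s'.arr 5) (s'.reg 4))) (by omega)
      ?_ ?_ ?_).mono ?_
  · refine ⟨fun x hx _ => ?_, fun B _ => rfl, by simpa using g4, ?_, by simpa using gL, ?_⟩
    · have : x ≠ 8 := by omega
      simp [this]
    · simp [listBound]
      omega
    · exact .zero _ (by simpa using gA)
  · rintro i s' ⟨k1, _⟩
    rw [k1 7 (by omega) (by omega), k1 2 (by omega) (by omega)]
    exact ⟨g7, g2⟩
  · rintro i s' hi ⟨k1, k2, k3, k4, k5, k6⟩ h8
    have hnext : nextBound k (s'.reg 4) ≤ listBound k (i + 1) := nextBound_mono k k4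
    have hle : listBound k (i + 1) ≤ ρ := hmono (by omega)
    have hpow := succ_mul_two_pow_le_nextBound hk k3
    have hpow' : 2 ^ s'.reg 4 ≤ (s'.reg 4 + 1) * 2 ^ s'.reg 4 :=
      Nat.le_mul_of_pos_left _ (by omega)
    have htime : (s'.reg 4 + 1) * 2 ^ s'.reg 4 * n ≤ ρ * n := Nat.mul_le_mul_right _ (by omega)
    refine (runs_round (r := s'.reg 4) (p := T.parent) (q := T'.parent) (G := G) (k := k) (i := i)
      hn (by omega) ?_ ?_ ?_ rfl ?_ ?_ ?_ k5 k6).mono ?_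
    · rw [k1 0 (by omega) (by omega), g0]
    · rw [k1 2 (by omega) (by omega), g2]
    · rw [k1 3 (by omega) (by omega), g3]
    · rw [k1 6 (by omega) (by omega), g6]
    · rw [k2 0 (by omega), ga 0 (by omega)]
      rfl
    · rw [k2 1 (by omega), ga 1 (by omega)]
      exact fun _ _ => rfl
    rintro s₂ t₂ ⟨ht₂, l1, l2, l3, l4, l5, l6⟩
    refine ⟨by omega, ?_, ?_, fun x hx h4 => ?_, fun B hB => ?_, by simp; omega, by simp; omega,
      by simpa using l5, by simpa using l6⟩
    · rw [l1 8 (by omega) (by omega), h8]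
    · rw [l1 2 (by omega) (by omega), k1 2 (by omega) (by omega), g2]
    · have : x ≠ 8 := by omega
      simp [this, l1 x (by omega) h4, k1 x hx h4]
    · simp [l2 B (by omega) (by omega) (by omega), k2 B hB]
  rintro s₂ t₂ ⟨ht₂, -, k1, k2, k3, k4, k5, k6⟩
  rw [runs_seqs_singleton]
  have hpow : s₂.reg 4 ^ k ≤ ρ ^ k := Nat.pow_le_pow_left k4 k
  refine (runs_search (n := n) (k := k) (r := s₂.reg 4) (F := s₂.arr 5) (p := T.parent)
    (q := T'.parent) (G := G) hn (by omega) (by omega) (by omega) ?_ k3 k5).mono ?_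
  · refine ⟨?_, ?_, ?_, ?_, rfl, ?_, ?_, ?_, rfl⟩
    · rw [k1 0 (by omega) (by omega), g0]
    · rw [k1 1 (by omega) (by omega), g1]
    · rw [k1 2 (by omega) (by omega), g2]
    · rw [k1 3 (by omega) (by omega), g3]
    · rw [k2 0 (by omega), ga 0 (by omega)]
      rfl
    · rw [k2 1 (by omega), ga 1 (by omega)]
      exact fun _ _ => rfl
    · rw [k2 2 (by omega), ga 2 (by omega)]
      exact fun _ _ => rfl
  rintro s₃ t₃ ⟨ht₃, l1, l2⟩
  rw [exists_simStep_iff k3 (by omega) k6] at l1 l2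
  refine ⟨?_, l1, l2⟩
  -- The rounds contribute at most 404 and the search 200 to the constant 700; the rest covers the
  -- setup and the tests.
  have h1 : s₂.reg 4 ^ k * (k + 1) * n ≤ ρ ^ k * (k + 1) * n := by gcongr
  have h2 : (2 * k + 1) * (202 * (ρ * n)) ≤ 404 * (ρ ^ k * (k + 1) * n) := by
    have : (k + 1) * (ρ * n) ≤ ρ ^ k * (k + 1) * n := by
      calc (k + 1) * (ρ * n) = ρ * (k + 1) * n := by ring
        _ ≤ ρ ^ k * (k + 1) * n := by gcongr
    nlinarith
  have h3 : (2 * k + 1) * (200 * (ρ * n) + 2) ≤ (2 * k + 1) * (202 * (ρ * n)) :=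
    Nat.mul_le_mul_left _ (by omega)
  omega

/-- The product `R * n` bounds `n` and, up to the factor `D`, the number of sequences tried. So its
square, times a constant, suffices as word bound, and any `C ≥ 2 * D + 11` serves as factor and as
exponent. -/
theorem exec_main_input {C D : ℕ} (hC : 2 * D + 11 ≤ C)
    (hD : 700 * (listBound k (2 * k + 1) ^ k * (k + 1)) ≤ D * runtime 10 k)
    (hn : 1 ≤ n) (hk : 1 ≤ k) :
    Runs (C * (runtime 10 k * n) ^ C) main (input G T T' k) (fun s t =>
      t ≤ C * (runtime 10 k * n) ∧
      (rotDist T T' ≤ k → s.reg 0 = 1) ∧ (¬ rotDist T T' ≤ k → s.reg 0 = 0)) := by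
  have hR := one_le_runtime 10 hk
  set R := runtime 10 k
  have hnR : n ≤ R * n := Nat.le_mul_of_pos_left _ hR
  have hRn : R ≤ R * n := Nat.le_mul_of_pos_right _ hn
  refine (runs_main hn hk ?_).mono ?_
  · have h1 : listBound k (2 * k + 1) ^ k ≤ D * (R * n) := by
      refine le_trans ?_ (hD.trans (Nat.mul_le_mul_left _ hRn))
      exact (Nat.le_mul_of_pos_right _ (Nat.succ_pos k)).trans
        (Nat.le_mul_of_pos_left _ (by omega))
    have h2 : (R * n) ^ 2 ≤ (R * n) ^ C := Nat.pow_le_pow_right (by omega) (by omega)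
    have h3 : C * (R * n) ^ 2 ≤ C * (R * n) ^ C := Nat.mul_le_mul_left _ h2
    have h4 : (2 * D + 11) * (R * n) ^ 2 ≤ C * (R * n) ^ 2 := Nat.mul_le_mul_right _ hC
    have h5 : n * n ≤ (R * n) ^ 2 := by
      rw [sq]
      exact Nat.mul_le_mul hnR hnR
    have h6 : R * n ≤ (R * n) ^ 2 := Nat.le_self_pow (by omega) _
    have h7 : D * (R * n) ≤ D * (R * n) ^ 2 := Nat.mul_le_mul_left _ h6
    rw [add_mul, mul_assoc] at h4
    omega
  · rintro s t ⟨ht, h⟩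
    refine ⟨ht.trans ?_, h⟩
    calc 700 * (listBound k (2 * k + 1) ^ k * (k + 1) * n)
        = 700 * (listBound k (2 * k + 1) ^ k * (k + 1)) * n := by ring
      _ ≤ D * R * n := Nat.mul_le_mul_right _ hD
      _ = D * (R * n) := by ring
      _ ≤ C * (R * n) := Nat.mul_le_mul_right _ (by omega)

end Main

end RotDist

theorem theorem1 :
    ∃ (P : Prog) (c C : ℕ), ∀ (n k : ℕ), 1 ≤ n → 1 ≤ k →
      ∀ (G : SimpleGraph (Fin n)) (T T' : ElimForest G),
        ∃ (t : ℕ) (s : State),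
          Exec (C * (runtime c k * n) ^ C) P (input G T T' k) t s ∧
          t ≤ C * (runtime c k * n) ∧
          (rotDist T T' ≤ (k : ℕ∞) → s.reg 0 = 1) ∧
          (¬ rotDist T T' ≤ (k : ℕ∞) → s.reg 0 = 0) := by
  obtain ⟨D, hD⟩ := exists_le_mul_of_two_le
    (fun k hk => listBound_pow_le_runtime hk) (one_le_runtime 10 le_rfl)
  exact ⟨main, 10, 2 * D + 11, fun n k hn hk G T T' => exec_main_input le_rfl (hD k hk) hn hk⟩
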